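/- Let $R$ be a commutative ring and let $(\mathcal X,\diamond,\mathbf 1)$ be an essentially small symmetric monoidal category enriched in $R$-modules (so $\diamond$ is $R$-bilinear). Let $\mathcal F$ be the category of $R$-linear functors $\mathcal X\to R\text{-Mod}$, with its symmetric monoidal structure $\otimes$ (Day convolution). Let $A$ be a commutative monoid in $\mathcal F$ that is tensor idempotent, i.e. its multiplication $\mu_A:A\otimes A\to A$ is an isomorphism in $\mathcal F$. Let $n\ge 0$ and let $A_n=A[t_1,\dots,t_n]$ be the monoid of polynomials, $A_n(x)=A(x)[t_1,\dots,t_n]$. Call an $A_n$-module $P$ *$\mathcal F$-projective* if every morphism $P\to N$ of $A_n$-modules lifts along every morphism $L\to N$ of $A_n$-modules that is a split epimorphism in $\mathcal F$. Then every $A_n$-module $M$ admits a finite $\mathcal F$-split resolution of length $n$ $$0\to L_n\to L_{n-1}\to\cdots\to L_1\to L_0\to M\to 0$$ by $\mathcal F$-projective $A_n$-modules $L_0,\dots,L_n$; that is, this complex is exact in the category of $A_n$-modules, and as a complex in $\mathcal F$ it is split (there are maps $s$ of degree $1$ with $dsd=d$). More precisely, let $C=A[u_1,\dots,u_n,v_1,\dots,v_n]$,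 considered as an $A_n$-bimodule with $t_i$ acting on the left by $u_i$ and on the right by $v_i$, let $\alpha_i=u_i-v_i$, and let $K_C(\alpha)$ be the Koszul complex of $C$, with $K_p=\bigoplus_{S\subseteq\{1,\dots,n\},\,|S|=p}C$ and differential given on the summand of $S=\{i_1<\dots<i_p\}$ by $\sum_{k}(-1)^{k+1}\alpha_{i_k}$ with values in the summands of $S\setminus\{i_k\}$. Then the resolution can be taken to be $K_C(\alpha)\otimes_{A_n}M$, with augmentation $C\otimes_{A_n}M\to A_n\otimes_{A_n}M\cong M$ induced by the morphism of monoids $C\to A_n$ that is the identity on $A$ and maps $u_i$ and $v_i$ to $t_i$. -/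

import Mathlib

open CategoryTheory MonoidalCategory

universe w v u

noncomputable section

/-- The category `𝓕` of `R`-linear functors from `X` to `R`-modules. -/
abbrev LinFun (R : Type w) [CommRing R] (X : Type u) [Category.{v} X] [Preadditive X]
    [Linear R X] :=
  ObjectProperty.FullSubcategory
    (fun F : X ⥤ ModuleCat.{w} R => F.Additive ∧ F.Linear R)

namespace LinFun

variable {R : Type w} [CommRing R] {X : Type u} [Category.{v} X] [Preadditive X] [Linear R X]

/-- The value `F(x)`. -/
abbrev val (F : LinFun R X) (x : X) : Type w := F.obj.obj x

/-- The linear map `F(f) : F(x) → F(y)`. -/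
def act (F : LinFun R X) {x y : X} (f : x ⟶ y) : F.val x →ₗ[R] F.val y := (F.obj.map f).hom

@[simp] lemma act_id (F : LinFun R X) (x : X) (a : F.val x) : F.act (𝟙 x) a = a := by
  simp [act]

lemma act_comp (F : LinFun R X) {x y z : X} (f : x ⟶ y) (g : y ⟶ z) (a : F.val x) :
    F.act (f ≫ g) a = F.act g (F.act f a) := by
  simp [act]

lemma act_add (F : LinFun R X) {x y : X} (f g : x ⟶ y) : F.act (f + g) = F.act f + F.act g := by
  have := F.property.1
  simp [act]

lemma act_smul (F : LinFun R X) {x y : X} (r : R) (f : x ⟶ y) :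
    F.act (r • f) = r • F.act f := by
  have := F.property.2
  simp [act]

/-- The component at `x` of a morphism of `𝓕`. -/
def comp {F G : LinFun R X} (φ : F ⟶ G) (x : X) : F.val x →ₗ[R] G.val x := (φ.hom.app x).hom

lemma comp_act {F G : LinFun R X} (φ : F ⟶ G) {x y : X} (f : x ⟶ y) (a : F.val x) :
    comp φ y (F.act f a) = G.act f (comp φ x a) :=
  congrArg (fun h => h.hom a) (φ.hom.naturality f)

@[simp] lemma comp_id (F : LinFun R X) (x : X) (a : F.val x) : comp (𝟙 F) x a = a := rfl

@[simp] lemma comp_comp {F G H : LinFun R X} (φ : F ⟶ G) (ψ : G ⟶ H) (x : X) (a : F.val x) :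
    comp (φ ≫ ψ) x a = comp ψ x (comp φ x a) := rfl

@[simp] lemma comp_add {F G : LinFun R X} (φ ψ : F ⟶ G) (x : X) (a : F.val x) :
    comp (φ + ψ) x a = comp φ x a + comp ψ x a := rfl

@[simp] lemma comp_neg {F G : LinFun R X} (φ : F ⟶ G) (x : X) (a : F.val x) :
    comp (-φ) x a = - comp φ x a := rfl

@[simp] lemma comp_zero {F G : LinFun R X} (x : X) (a : F.val x) :
    comp (0 : F ⟶ G) x a = 0 := rfl

lemma hom_ext {F G : LinFun R X} {φ ψ : F ⟶ G} (h : ∀ x a, comp φ x a = comp ψ x a) :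
    φ = ψ := by
  apply ObjectProperty.hom_ext
  ext x a
  exact h x a

/-- Constructor for objects of `𝓕`. -/
abbrev of (V : X → Type w) [∀ x, AddCommGroup (V x)] [∀ x, Module R (V x)]
    (m : ∀ {x y : X}, (x ⟶ y) →ₗ[R] V x →ₗ[R] V y)
    (m_id : ∀ x (a : V x), m (𝟙 x) a = a)
    (m_comp : ∀ {x y z : X} (f : x ⟶ y) (g : y ⟶ z) (a : V x), m (f ≫ g) a = m g (m f a)) :
    LinFun R X where
  obj :=
    { obj := fun x => ModuleCat.of R (V x)
      map := fun f => ModuleCat.ofHom (m f)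
      map_id := fun x => by ext a; exact m_id x a
      map_comp := fun f g => by ext a; exact m_comp f g a }
  property := ⟨⟨fun {x y f g} => by ext a; simp⟩, ⟨fun {x y} f r => by ext a; simp⟩⟩

/-- Constructor for morphisms of `𝓕`. -/
def homMk {F G : LinFun R X} (φ : ∀ x, F.val x →ₗ[R] G.val x)
    (h : ∀ {x y : X} (f : x ⟶ y) (a : F.val x), φ y (F.act f a) = G.act f (φ x a)) : F ⟶ G :=
  ObjectProperty.homMk
    { app := fun x => ModuleCat.ofHom (φ x)
      naturality := fun x y f => by ext a; exact h f a }

@[simp] lemma comp_homMk {F G : LinFun R X} (φ : ∀ x, F.val x →ₗ[R] G.val x)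
    (h : ∀ {x y : X} (f : x ⟶ y) (a : F.val x), φ y (F.act f a) = G.act f (φ x a)) (x : X) :
    comp (homMk φ h) x = φ x := rfl

/-- For a bilinear map `μ : P × Q → F(x)`, the trilinear map `(f, p, q) ↦ F(f)(μ(p, q))`. -/
def actMul (F : LinFun R X) {P Q : Type*} [AddCommGroup P] [Module R P] [AddCommGroup Q]
    [Module R Q] {x z : X} (μ : P →ₗ[R] Q →ₗ[R] F.val x) :
    (x ⟶ z) →ₗ[R] P →ₗ[R] Q →ₗ[R] F.val z where
  toFun f := μ.compr₂ (F.act f)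
  map_add' f g := by ext; simp [act_add]
  map_smul' r f := by ext; simp [act_smul]

@[simp] lemma actMul_apply (F : LinFun R X) {P Q : Type*} [AddCommGroup P] [Module R P]
    [AddCommGroup Q] [Module R Q] {x z : X} (μ : P →ₗ[R] Q →ₗ[R] F.val x) (f : x ⟶ z) (p : P)
    (q : Q) : F.actMul μ f p q = F.act f (μ p q) := rfl

end LinFun

/-- A monoid in `𝓕` (for the tensor product of `𝓕`, see `dayTensor` below), given by its
products `A(x) × A(y) → A(x ⊗ y)`, `(a, b) ↦ a × b`, and its identity element in `A(𝟙)`. -/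
structure FMonoid (R : Type w) [CommRing R] (X : Type u) [Category.{v} X] [Preadditive X]
    [Linear R X] [MonoidalCategory X] where
  toFun : LinFun R X
  mul (x y : X) : toFun.val x →ₗ[R] toFun.val y →ₗ[R] toFun.val (x ⊗ y)
  one : toFun.val (𝟙_ X)
  mul_natural {x x' y y' : X} (f : x ⟶ x') (g : y ⟶ y') (a : toFun.val x) (b : toFun.val y) :
    mul x' y' (toFun.act f a) (toFun.act g b) = toFun.act (f ⊗ₘ g) (mul x y a b)
  mul_assoc {x y z : X} (a : toFun.val x) (b : toFun.val y) (c : toFun.val z) :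
    toFun.act (α_ x y z).hom (mul (x ⊗ y) z (mul x y a b) c) = mul x (y ⊗ z) a (mul y z b c)
  one_mul {x : X} (a : toFun.val x) : toFun.act (λ_ x).hom (mul (𝟙_ X) x one a) = a
  mul_one {x : X} (a : toFun.val x) : toFun.act (ρ_ x).hom (mul x (𝟙_ X) a one) = a

section

variable {R : Type w} [CommRing R] {X : Type u} [Category.{v} X] [Preadditive X] [Linear R X]
  [MonoidalCategory X]

/-- Commutative monoids in `𝓕`. -/
class FMonoid.IsComm [BraidedCategory X] (A : FMonoid R X) : Prop where
  comm {x y : X} (a : A.toFun.val x) (b : A.toFun.val y) :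
    A.toFun.act (β_ x y).hom (A.mul x y a b) = A.mul y x b a

/-- Morphisms of monoids in `𝓕`. -/
structure FMonoid.Hom (A B : FMonoid R X) where
  hom : A.toFun ⟶ B.toFun
  map_mul {x y : X} (a : A.toFun.val x) (b : A.toFun.val y) :
    LinFun.comp hom (x ⊗ y) (A.mul x y a b) =
      B.mul x y (LinFun.comp hom x a) (LinFun.comp hom y b)
  map_one : LinFun.comp hom (𝟙_ X) A.one = B.one

/-- (Left) modules over a monoid `A` in `𝓕`, given by `A(x) × M(y) → M(x ⊗ y)`. -/
structure FMod (A : FMonoid R X) where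
  toFun : LinFun R X
  smul (x y : X) : A.toFun.val x →ₗ[R] toFun.val y →ₗ[R] toFun.val (x ⊗ y)
  smul_natural {x x' y y' : X} (f : x ⟶ x') (g : y ⟶ y') (a : A.toFun.val x)
    (m : toFun.val y) :
    smul x' y' (A.toFun.act f a) (toFun.act g m) = toFun.act (f ⊗ₘ g) (smul x y a m)
  mul_smul {x y z : X} (a : A.toFun.val x) (b : A.toFun.val y) (m : toFun.val z) :
    toFun.act (α_ x y z).hom (smul (x ⊗ y) z (A.mul x y a b) m) =
      smul x (y ⊗ z) a (smul y z b m)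
  one_smul {x : X} (m : toFun.val x) : toFun.act (λ_ x).hom (smul (𝟙_ X) x A.one m) = m

namespace FMod

variable {A : FMonoid R X}

/-- The group of morphisms of `A`-modules. -/
def homs (M N : FMod A) : AddSubgroup (M.toFun ⟶ N.toFun) where
  carrier := {φ | ∀ (x y : X) (a : A.toFun.val x) (m : M.toFun.val y),
    LinFun.comp φ (x ⊗ y) (M.smul x y a m) = N.smul x y a (LinFun.comp φ y m)}
  zero_mem' x y a m := by simp
  add_mem' h h' x y a m := by simp [h x y a m, h' x y a m]
  neg_mem' h x y a m := by simp [h x y a m]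

instance : Category (FMod A) where
  Hom M N := homs M N
  id M := ⟨𝟙 _, fun x y a m => by simp⟩
  comp f g := ⟨f.1 ≫ g.1, fun x y a m => by simp [f.2 x y a m, g.2 x y]⟩

instance : Preadditive (FMod A) where
  homGroup M N := inferInstanceAs (AddCommGroup (homs M N))
  add_comp _ _ _ f f' g := Subtype.ext (Preadditive.add_comp _ _ _ f.1 f'.1 g.1)
  comp_add _ _ _ f g g' := Subtype.ext (Preadditive.comp_add _ _ _ f.1 g.1 g'.1)

variable (A) in
/-- The restriction (forgetful) functor from `A`-modules to `𝓕`. -/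
def forget : FMod A ⥤ LinFun R X where
  obj M := M.toFun
  map f := f.1

instance : (forget A).Additive where

lemma hom_ext {M N : FMod A} {f g : M ⟶ N}
    (h : ∀ x m, LinFun.comp f.1 x m = LinFun.comp g.1 x m) : f = g :=
  Subtype.ext (LinFun.hom_ext h)

end FMod

end


/-! ### The tensor product of `𝓕` -/

section

variable {R : Type w} [CommRing R] {X : Type u} [Category.{v} X] [Preadditive X] [Linear R X]
  [MonoidalCategory X]

/-- Generators `[f, a, b]` of `(F ⊗ G)(z)`. -/
abbrev DayGen (F G : LinFun R X) (z : X) : Type (max u v w) :=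
  Σ x y : X, (x ⊗ y ⟶ z) × F.val x × G.val y

/-- The relations of the coend `∫^{x, y} X(x ⊗ y, z) ⊗ F(x) ⊗ G(y)`: multilinearity, and
`[(φ ⊗ ψ) ≫ f, a, b] = [f, F(φ)(a), G(ψ)(b)]`. -/
inductive DayRel (F G : LinFun R X) (z : X) : (DayGen F G z →₀ R) → Prop
  | add_hom {x y : X} (f f' : x ⊗ y ⟶ z) (a : F.val x) (b : G.val y) :
      DayRel F G z (.single ⟨x, y, f + f', a, b⟩ 1 -
        (.single ⟨x, y, f, a, b⟩ 1 + .single ⟨x, y, f', a, b⟩ 1))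
  | smul_hom {x y : X} (r : R) (f : x ⊗ y ⟶ z) (a : F.val x) (b : G.val y) :
      DayRel F G z (.single ⟨x, y, r • f, a, b⟩ 1 - r • .single ⟨x, y, f, a, b⟩ 1)
  | add_left {x y : X} (f : x ⊗ y ⟶ z) (a a' : F.val x) (b : G.val y) :
      DayRel F G z (.single ⟨x, y, f, a + a', b⟩ 1 -
        (.single ⟨x, y, f, a, b⟩ 1 + .single ⟨x, y, f, a', b⟩ 1))
  | smul_left {x y : X} (r : R) (f : x ⊗ y ⟶ z) (a : F.val x) (b : G.val y) :
      DayRel F G z (.single ⟨x, y, f, r • a, b⟩ 1 - r • .single ⟨x, y, f, a, b⟩ 1)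
  | add_right {x y : X} (f : x ⊗ y ⟶ z) (a : F.val x) (b b' : G.val y) :
      DayRel F G z (.single ⟨x, y, f, a, b + b'⟩ 1 -
        (.single ⟨x, y, f, a, b⟩ 1 + .single ⟨x, y, f, a, b'⟩ 1))
  | smul_right {x y : X} (r : R) (f : x ⊗ y ⟶ z) (a : F.val x) (b : G.val y) :
      DayRel F G z (.single ⟨x, y, f, a, r • b⟩ 1 - r • .single ⟨x, y, f, a, b⟩ 1)
  | dinatural {x x' y y' : X} (φ : x ⟶ x') (ψ : y ⟶ y') (f : x' ⊗ y' ⟶ z) (a : F.val x)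
      (b : G.val y) :
      DayRel F G z (.single ⟨x, y, (φ ⊗ₘ ψ) ≫ f, a, b⟩ 1 -
        .single ⟨x', y', f, F.act φ a, G.act ψ b⟩ 1)

/-- The coend `∫^{x, y} X(x ⊗ y, z) ⊗ F(x) ⊗ G(y)`, in a large universe. -/
abbrev DayBig (F G : LinFun R X) (z : X) : Type (max u v w) :=
  (DayGen F G z →₀ R) ⧸ Submodule.span R {t | DayRel F G z t}

namespace DayBig

variable {F G : LinFun R X}

/-- The class `[f, a, b]`, as a trilinear map. -/
def mk (F G : LinFun R X) (x y z : X) :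
    (x ⊗ y ⟶ z) →ₗ[R] F.val x →ₗ[R] G.val y →ₗ[R] DayBig F G z where
  toFun f := LinearMap.mk₂ R (fun a b => Submodule.Quotient.mk (.single ⟨x, y, f, a, b⟩ 1))
    (fun a a' b => by
      rw [← Submodule.Quotient.mk_add, Submodule.Quotient.eq]
      exact Submodule.subset_span (.add_left f a a' b))
    (fun r a b => by
      rw [← Submodule.Quotient.mk_smul, Submodule.Quotient.eq]
      exact Submodule.subset_span (.smul_left r f a b))
    (fun a b b' => by
      rw [← Submodule.Quotient.mk_add, Submodule.Quotient.eq]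
      exact Submodule.subset_span (.add_right f a b b'))
    (fun r a b => by
      rw [← Submodule.Quotient.mk_smul, Submodule.Quotient.eq]
      exact Submodule.subset_span (.smul_right r f a b))
  map_add' f f' := by
    ext a b
    simp only [LinearMap.mk₂_apply, LinearMap.add_apply]
    rw [← Submodule.Quotient.mk_add, Submodule.Quotient.eq]
    exact Submodule.subset_span (.add_hom f f' a b)
  map_smul' r f := by
    ext a b
    simp only [LinearMap.mk₂_apply, LinearMap.smul_apply, RingHom.id_apply]
    rw [← Submodule.Quotient.mk_smul, Submodule.Quotient.eq]
    exact Submodule.subset_span (.smul_hom r f a b)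

lemma mk_dinatural {x x' y y' z : X} (φ : x ⟶ x') (ψ : y ⟶ y') (f : x' ⊗ y' ⟶ z)
    (a : F.val x) (b : G.val y) :
    mk F G x y z ((φ ⊗ₘ ψ) ≫ f) a b = mk F G x' y' z f (F.act φ a) (G.act ψ b) :=
  (Submodule.Quotient.eq _).2 (Submodule.subset_span (.dinatural φ ψ f a b))

lemma induction {z : X} {p : DayBig F G z → Prop} (t : DayBig F G z)
    (h_mk : ∀ x y f a b, p (mk F G x y z f a b)) (h_zero : p 0)
    (h_add : ∀ s t, p s → p t → p (s + t)) : p t := by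
  induction t using Submodule.Quotient.induction_on with | _ t
  induction t using Finsupp.induction_linear with
  | zero => exact h_zero
  | add s t hs ht => exact h_add _ _ hs ht
  | single g r =>
    obtain ⟨x, y, f, a, b⟩ := g
    have : (Submodule.Quotient.mk (.single ⟨x, y, f, a, b⟩ r) : DayBig F G z) =
        mk F G x y z f (r • a) b := by
      rw [map_smul]
      change _ = r • Submodule.Quotient.mk _
      rw [← Submodule.Quotient.mk_smul, Finsupp.smul_single, smul_eq_mul, mul_one]
    rw [this]
    exact h_mk _ _ _ _ _

/-- Universal property of the coend. -/
def lift {z : X} {V : Type*} [AddCommGroup V] [Module R V]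
    (φ : ∀ x y, (x ⊗ y ⟶ z) →ₗ[R] F.val x →ₗ[R] G.val y →ₗ[R] V)
    (h : ∀ (x x' y y' : X) (p : x ⟶ x') (q : y ⟶ y') (f : x' ⊗ y' ⟶ z) (a : F.val x)
      (b : G.val y), φ x y ((p ⊗ₘ q) ≫ f) a b = φ x' y' f (F.act p a) (G.act q b)) :
    DayBig F G z →ₗ[R] V :=
  Submodule.liftQ _
    (Finsupp.linearCombination R fun g : DayGen F G z =>
      φ g.1 g.2.1 g.2.2.1 g.2.2.2.1 g.2.2.2.2) (by
    rw [Submodule.span_le]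
    rintro _ (_ | _ | _ | _ | _ | _ | _) <;>
      simp [h])

@[simp] lemma lift_mk {z : X} {V : Type*} [AddCommGroup V] [Module R V]
    (φ : ∀ x y, (x ⊗ y ⟶ z) →ₗ[R] F.val x →ₗ[R] G.val y →ₗ[R] V)
    (h : ∀ (x x' y y' : X) (p : x ⟶ x') (q : y ⟶ y') (f : x' ⊗ y' ⟶ z) (a : F.val x)
      (b : G.val y), φ x y ((p ⊗ₘ q) ≫ f) a b = φ x' y' f (F.act p a) (G.act q b))
    {x y : X} (f : x ⊗ y ⟶ z) (a : F.val x) (b : G.val y) :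
    lift φ h (mk F G x y z f a b) = φ x y f a b := by
  change Finsupp.linearCombination R _ (Finsupp.single _ _) = _
  simp

instance [EssentiallySmall.{w} X] (F G : LinFun R X) (z : X) : Small.{w} (DayBig F G z) := by
  let e := equivSmallModel.{w} X
  let S := Σ x y : SmallModel.{w} X, (e.inverse.obj x ⊗ e.inverse.obj y ⟶ z) ×
    F.val (e.inverse.obj x) × G.val (e.inverse.obj y)
  have : Small.{w} S := inferInstance
  let g : (Shrink.{w} S →₀ R) →ₗ[R] DayBig F G z :=
    Finsupp.linearCombination R fun s =>
      let s := (equivShrink S).symm s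
      mk F G _ _ z s.2.2.1 s.2.2.2.1 s.2.2.2.2
  have hg : ∀ s : S, g (.single (equivShrink S s) 1) =
      mk F G _ _ z s.2.2.1 s.2.2.2.1 s.2.2.2.2 := fun s => by
    simp only [g, Finsupp.linearCombination_single, one_smul]
    rw [Equiv.symm_apply_apply]
  refine small_of_surjective (f := g) fun t => ?_
  change t ∈ LinearMap.range g
  induction t using induction with
  | h_zero => exact zero_mem _
  | h_add s t hs ht => exact add_mem hs ht
  | h_mk x y f a b =>
    let i := e.unitIso.app x
    let j := e.unitIso.app y
    refine ⟨.single (equivShrink S ⟨e.functor.obj x, e.functor.obj y, (i.inv ⊗ₘ j.inv) ≫ f,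
      F.act i.hom a, G.act j.hom b⟩) 1, ?_⟩
    rw [hg, mk_dinatural, ← F.act_comp, ← G.act_comp, i.hom_inv_id, j.hom_inv_id]
    simp

end DayBig

variable [EssentiallySmall.{w} X]

/-- The value at `z` of the tensor product `F ⊗ G` in `𝓕`. -/
def DayVal (F G : LinFun R X) (z : X) : Type w := Shrink.{w} (DayBig F G z)

namespace DayVal

instance (F G : LinFun R X) (z : X) : AddCommGroup (DayVal F G z) :=
  (equivShrink (DayBig F G z)).symm.addCommGroup

instance (F G : LinFun R X) (z : X) : Module R (DayVal F G z) :=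
  (equivShrink (DayBig F G z)).symm.module R

/-- The value of `F ⊗ G` at `z` is the coend, moved to the universe of `R`. -/
def equiv (F G : LinFun R X) (z : X) : DayVal F G z ≃ₗ[R] DayBig F G z :=
  (equivShrink (DayBig F G z)).symm.linearEquiv R

variable {F G : LinFun R X}

/-- The class `[f, a, b]`, as a trilinear map. -/
def mk (F G : LinFun R X) (x y z : X) :
    (x ⊗ y ⟶ z) →ₗ[R] F.val x →ₗ[R] G.val y →ₗ[R] DayVal F G z where
  toFun f := (DayBig.mk F G x y z f).compr₂ (equiv F G z).symm.toLinearMap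
  map_add' f g := by ext; simp
  map_smul' r f := by ext; simp

lemma mk_dinatural {x x' y y' z : X} (φ : x ⟶ x') (ψ : y ⟶ y') (f : x' ⊗ y' ⟶ z)
    (a : F.val x) (b : G.val y) :
    mk F G x y z ((φ ⊗ₘ ψ) ≫ f) a b = mk F G x' y' z f (F.act φ a) (G.act ψ b) :=
  congrArg (equiv F G z).symm (DayBig.mk_dinatural φ ψ f a b)

lemma induction {z : X} {p : DayVal F G z → Prop} (t : DayVal F G z)
    (h_mk : ∀ x y f a b, p (mk F G x y z f a b)) (h_zero : p 0)
    (h_add : ∀ s t, p s → p t → p (s + t)) : p t := by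
  obtain ⟨t, rfl⟩ := (equiv F G z).symm.surjective t
  induction t using DayBig.induction with
  | h_mk x y f a b => exact h_mk x y f a b
  | h_zero => rw [map_zero]; exact h_zero
  | h_add s t hs ht => rw [map_add]; exact h_add _ _ hs ht

/-- Universal property of the coend. -/
def lift {z : X} {V : Type*} [AddCommGroup V] [Module R V]
    (φ : ∀ x y, (x ⊗ y ⟶ z) →ₗ[R] F.val x →ₗ[R] G.val y →ₗ[R] V)
    (h : ∀ (x x' y y' : X) (p : x ⟶ x') (q : y ⟶ y') (f : x' ⊗ y' ⟶ z) (a : F.val x)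
      (b : G.val y), φ x y ((p ⊗ₘ q) ≫ f) a b = φ x' y' f (F.act p a) (G.act q b)) :
    DayVal F G z →ₗ[R] V :=
  DayBig.lift φ h ∘ₗ (equiv F G z).toLinearMap

@[simp] lemma lift_mk {z : X} {V : Type*} [AddCommGroup V] [Module R V]
    (φ : ∀ x y, (x ⊗ y ⟶ z) →ₗ[R] F.val x →ₗ[R] G.val y →ₗ[R] V)
    (h : ∀ (x x' y y' : X) (p : x ⟶ x') (q : y ⟶ y') (f : x' ⊗ y' ⟶ z) (a : F.val x)
      (b : G.val y), φ x y ((p ⊗ₘ q) ≫ f) a b = φ x' y' f (F.act p a) (G.act q b))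
    {x y : X} (f : x ⊗ y ⟶ z) (a : F.val x) (b : G.val y) :
    lift φ h (mk F G x y z f a b) = φ x y f a b := by
  simp [lift, mk]

end DayVal

/-- The functoriality `[f, a, b] ↦ [f ≫ g, a, b]` of `F ⊗ G`. -/
def DayVal.act (F G : LinFun R X) (z z' : X) :
    (z ⟶ z') →ₗ[R] DayVal F G z →ₗ[R] DayVal F G z' where
  toFun g := DayVal.lift
    (fun x y => DayVal.mk F G x y z' ∘ₗ Linear.rightComp R (x ⊗ y) g)
    (fun x x' y y' p q f a b => by simp [← DayVal.mk_dinatural])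
  map_add' g g' := by
    ext t
    induction t using DayVal.induction <;> simp_all; abel
  map_smul' r g := by
    ext t
    induction t using DayVal.induction <;> simp_all

@[simp] lemma DayVal.act_mk (F G : LinFun R X) {x y z z' : X} (g : z ⟶ z') (f : x ⊗ y ⟶ z)
    (a : F.val x) (b : G.val y) :
    DayVal.act F G z z' g (DayVal.mk F G x y z f a b) = DayVal.mk F G x y z' (f ≫ g) a b :=
  DayVal.lift_mk _ _ f a b

/-- The tensor product of `𝓕`: the `R`-linear Day convolution of `F` and `G`. -/
abbrev dayTensor (F G : LinFun R X) : LinFun R X :=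
  LinFun.of (DayVal F G) (fun {z z'} => DayVal.act F G z z')
    (fun z t => by induction t using DayVal.induction <;> simp_all)
    (fun f g t => by induction t using DayVal.induction <;> simp_all)

/-- The component at `z` of the multiplication `A ⊗ A ⟶ A`, `[f, a, b] ↦ A(f)(a × b)`. -/
def FMonoid.mulVal (A : FMonoid R X) (z : X) : DayVal A.toFun A.toFun z →ₗ[R] A.toFun.val z :=
  DayVal.lift (fun x y => A.toFun.actMul (A.mul x y))
    (fun x x' y y' p q f a b => by simp [A.mul_natural, LinFun.act_comp])

@[simp] lemma FMonoid.mulVal_mk (A : FMonoid R X) {x y z : X} (f : x ⊗ y ⟶ z)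
    (a : A.toFun.val x) (b : A.toFun.val y) :
    A.mulVal z (DayVal.mk _ _ x y z f a b) = A.toFun.act f (A.mul x y a b) :=
  DayVal.lift_mk _ _ f a b

lemma FMonoid.mulVal_act (A : FMonoid R X) {z z' : X} (f : z ⟶ z')
    (t : DayVal A.toFun A.toFun z) :
    A.mulVal z' (DayVal.act _ _ z z' f t) = A.toFun.act f (A.mulVal z t) := by
  induction t using DayVal.induction with
  | h_mk x y g a b => simp [LinFun.act_comp]
  | h_zero => simp
  | h_add s t hs ht => simp [hs, ht]

/-- The multiplication `μ_A : A ⊗ A ⟶ A` of a monoid in `𝓕`. -/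
def FMonoid.mulHom (A : FMonoid R X) : dayTensor A.toFun A.toFun ⟶ A.toFun :=
  LinFun.homMk A.mulVal A.mulVal_act

/-- `A` is tensor idempotent if `μ_A` is an isomorphism in `𝓕`. -/
def FMonoid.IsTensorIdempotent (A : FMonoid R X) : Prop := IsIso A.mulHom

end


/-! ### Polynomials -/

section

variable {R : Type w} [CommRing R]

/-- For a bilinear map `β`, the bilinear map
`(∑ᵢ aᵢ tⁱ, ∑ⱼ bⱼ tʲ) ↦ ∑ᵢⱼ β(aᵢ, bⱼ) tⁱ⁺ʲ`; polynomials with coefficients in a module `V` are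
finitely supported functions from multi-indices to `V`. -/
def polyMul (σ : Type) {U V W : Type*} [AddCommGroup U] [Module R U] [AddCommGroup V] [Module R V]
    [AddCommGroup W] [Module R W] (β : U →ₗ[R] V →ₗ[R] W) :
    ((σ →₀ ℕ) →₀ U) →ₗ[R] ((σ →₀ ℕ) →₀ V) →ₗ[R] ((σ →₀ ℕ) →₀ W) :=
  Finsupp.lsum R fun i => LinearMap.flip
    (Finsupp.lsum R fun j => (β.compr₂ (Finsupp.lsingle (i + j))).flip)

@[simp] lemma polyMul_single (σ : Type) {U V W : Type*} [AddCommGroup U] [Module R U]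
    [AddCommGroup V] [Module R V] [AddCommGroup W] [Module R W] (β : U →ₗ[R] V →ₗ[R] W)
    (i j : σ →₀ ℕ) (a : U) (b : V) :
    polyMul σ β (.single i a) (.single j b) = .single (i + j) (β a b) := by
  simp [polyMul]

/-- A property of polynomials that is additive and holds for monomials holds for all. -/
lemma poly_induction {σ : Type} {U : Type*} [AddCommGroup U] {p : ((σ →₀ ℕ) →₀ U) → Prop}
    (f : (σ →₀ ℕ) →₀ U) (h_single : ∀ i a, p (.single i a)) (h_zero : p 0)
    (h_add : ∀ s t, p s → p t → p (s + t)) : p f :=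
  Finsupp.induction_linear f h_zero h_add h_single

variable {X : Type u} [Category.{v} X] [Preadditive X] [Linear R X]

/-- The functor of polynomials `F[t_s, s ∈ σ]`, `x ↦ F(x)[t_s, s ∈ σ]`, with arrows acting on
coefficients. -/
abbrev LinFun.poly (F : LinFun R X) (σ : Type) : LinFun R X :=
  LinFun.of (fun x => (σ →₀ ℕ) →₀ F.val x)
    (fun {x y} =>
      { toFun := fun f => Finsupp.mapRange.linearMap (F.act f)
        map_add' := fun f g => by ext; simp [LinFun.act_add]
        map_smul' := fun r f => by ext; simp [LinFun.act_smul] })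
    (fun x p => by ext; simp)
    (fun f g p => by ext; simp [LinFun.act_comp])

lemma LinFun.poly_act_single (F : LinFun R X) (σ : Type) {x y : X} (f : x ⟶ y) (i : σ →₀ ℕ)
    (a : F.val x) :
    (F.poly σ).act f (Finsupp.single i a : (σ →₀ ℕ) →₀ F.val x) =
      (Finsupp.single i (F.act f a) : (σ →₀ ℕ) →₀ F.val y) :=
  Finsupp.mapRange_single (hf := map_zero _)

variable [MonoidalCategory X]

/-- The monoid of polynomials `A[t_s, s ∈ σ]` over a monoid `A` in `𝓕`. -/
abbrev FMonoid.poly (A : FMonoid R X) (σ : Type) : FMonoid R X where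
  toFun := A.toFun.poly σ
  mul x y := polyMul σ (A.mul x y)
  one := (Finsupp.single 0 A.one : (σ →₀ ℕ) →₀ A.toFun.val (𝟙_ X))
  mul_natural {x x' y y'} f g p q := by
    induction p using poly_induction with
    | h_zero => simp only [map_zero, LinearMap.zero_apply]
    | h_add s t hs ht => simp only [map_add, LinearMap.add_apply, hs, ht]
    | h_single i a =>
    induction q using poly_induction with
    | h_zero => simp only [map_zero]
    | h_add s t hs ht => simp only [map_add, hs, ht]
    | h_single j b =>
    rw [LinFun.poly_act_single, LinFun.poly_act_single, polyMul_single, polyMul_single,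
      LinFun.poly_act_single, A.mul_natural]
  mul_assoc {x y z} p q r := by
    induction p using poly_induction with
    | h_zero => simp only [map_zero, LinearMap.zero_apply]
    | h_add s t hs ht => simp only [map_add, LinearMap.add_apply, hs, ht]
    | h_single i a =>
    induction q using poly_induction with
    | h_zero => simp only [map_zero, LinearMap.zero_apply]
    | h_add s t hs ht => simp only [map_add, LinearMap.add_apply, hs, ht]
    | h_single j b =>
    induction r using poly_induction with
    | h_zero => simp only [map_zero]
    | h_add s t hs ht => simp only [map_add, hs, ht]
    | h_single k c =>
    rw [polyMul_single, polyMul_single, polyMul_single, polyMul_single, LinFun.poly_act_single,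
      A.mul_assoc, add_assoc]
  one_mul {x} p := by
    induction p using poly_induction with
    | h_zero => simp only [map_zero]
    | h_add s t hs ht => simp only [map_add, hs, ht]
    | h_single i a => rw [polyMul_single, LinFun.poly_act_single, A.one_mul, zero_add]
  mul_one {x} p := by
    induction p using poly_induction with
    | h_zero => simp only [map_zero, LinearMap.zero_apply]
    | h_add s t hs ht => simp only [map_add, LinearMap.add_apply, hs, ht]
    | h_single i a => rw [polyMul_single, LinFun.poly_act_single, A.mul_one, add_zero]

instance [BraidedCategory X] (A : FMonoid R X) [A.IsComm] (σ : Type) : (A.poly σ).IsComm where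
  comm {x y} p q := by
    induction p using poly_induction with
    | h_zero => simp only [map_zero, LinearMap.zero_apply]
    | h_add s t hs ht => simp only [map_add, LinearMap.add_apply, hs, ht]
    | h_single i a =>
    induction q using poly_induction with
    | h_zero => simp only [map_zero, LinearMap.zero_apply]
    | h_add s t hs ht => simp only [map_add, LinearMap.add_apply, hs, ht]
    | h_single j b =>
    rw [polyMul_single, polyMul_single, LinFun.poly_act_single, FMonoid.IsComm.comm, add_comm]

/-- The variable `t_s`, an element of `A[t_s, s ∈ σ](𝟙)`. -/
def FMonoid.var (A : FMonoid R X) {σ : Type} (s : σ) : (A.poly σ).toFun.val (𝟙_ X) :=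
  (Finsupp.single (Finsupp.single s 1) A.one : (σ →₀ ℕ) →₀ A.toFun.val (𝟙_ X))

/-- The morphism of monoids `A[t_s, s ∈ σ] → A[t_s, s ∈ τ]` which is the identity on `A` and maps
`t_s` to `t_{e(s)}`. -/
def FMonoid.rename (A : FMonoid R X) {σ τ : Type} (e : σ → τ) : (A.poly σ).Hom (A.poly τ) where
  hom := LinFun.homMk
    (fun x => (Finsupp.lmapDomain (A.toFun.val x) R (Finsupp.mapDomain e) :
      ((σ →₀ ℕ) →₀ A.toFun.val x) →ₗ[R] ((τ →₀ ℕ) →₀ A.toFun.val x)))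
    (fun {x y} f p => by
      induction p using poly_induction with
      | h_zero => simp only [map_zero]
      | h_add s t hs ht => simp only [map_add, hs, ht]
      | h_single i a =>
      rw [LinFun.poly_act_single, Finsupp.lmapDomain_apply, Finsupp.lmapDomain_apply,
        Finsupp.mapDomain_single, Finsupp.mapDomain_single, LinFun.poly_act_single])
  map_mul {x y} p q := by
    rw [LinFun.comp_homMk, LinFun.comp_homMk, LinFun.comp_homMk]
    induction p using poly_induction with
    | h_zero => simp only [map_zero, LinearMap.zero_apply]
    | h_add s t hs ht => simp only [map_add, LinearMap.add_apply, hs, ht]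
    | h_single i a =>
    induction q using poly_induction with
    | h_zero => simp only [map_zero]
    | h_add s t hs ht => simp only [map_add, hs, ht]
    | h_single j b =>
    rw [Finsupp.lmapDomain_apply, Finsupp.lmapDomain_apply, polyMul_single,
      Finsupp.lmapDomain_apply, Finsupp.mapDomain_single, Finsupp.mapDomain_single,
      Finsupp.mapDomain_single, polyMul_single, Finsupp.mapDomain_add]
  map_one := by
    rw [LinFun.comp_homMk, Finsupp.lmapDomain_apply]
    rw [Finsupp.mapDomain_single, Finsupp.mapDomain_zero]

end


/-! ### The Koszul complex -/

section

/-- The subsets of `{1, …, n}` with `p` elements. -/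
abbrev KIdx (n p : ℕ) : Type := {S : Finset (Fin n) // S.card = p}

/-- `T ∪ {i}` for `i ∉ T`. -/
def KIdx.insert {n p : ℕ} (T : KIdx n p) (i : {i // i ∉ T.1}) : KIdx n (p + 1) :=
  ⟨Insert.insert i.1 T.1, by rw [Finset.card_insert_of_notMem i.2, T.2]⟩

/-- The sign `(-1)^{k+1}`, where `i` is the `k`-th element of `T ∪ {i}`. -/
def koszulSign {n : ℕ} (T : Finset (Fin n)) (i : Fin n) : ℤ :=
  (-1) ^ (T.filter (· < i)).card

lemma koszulSign_insert {n : ℕ} (T : Finset (Fin n)) {i j : Fin n} (hi : i ∉ T) (hj : j ∉ T)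
    (hij : i ≠ j) :
    koszulSign T i * koszulSign (insert i T) j = -(koszulSign T j * koszulSign (insert j T) i) := by
  simp only [koszulSign, Finset.filter_insert]
  rcases lt_or_gt_of_ne hij with h | h
  · rw [if_pos h, if_neg h.not_gt, Finset.card_insert_of_notMem (by simp [hi]), pow_succ]
    ring
  · rw [if_pos h, if_neg h.not_gt, Finset.card_insert_of_notMem (by simp [hj]), pow_succ]
    ring

variable {R : Type w} [CommRing R] {V : Type*} [AddCommGroup V] [Module R V]

/-- For endomorphisms `L₁, …, Lₙ` of `V`, the map `⨁_{|S| = p + 1} V → ⨁_{|S| = p} V` which on the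
summand `S = {i₁ < … < i_{p+1}}` is the sum of the `(-1)^{k+1} L_{i_k}`, with values in the
summand `S \ {i_k}`. -/
def koszulMap {n : ℕ} (L : Fin n → V →ₗ[R] V) (p : ℕ) :
    (KIdx n (p + 1) → V) →ₗ[R] (KIdx n p → V) :=
  LinearMap.pi fun T => ∑ i : {i // i ∉ T.1},
    koszulSign T.1 i.1 • (L i.1 ∘ₗ LinearMap.proj (T.insert i))

lemma koszulMap_apply {n : ℕ} (L : Fin n → V →ₗ[R] V) (p : ℕ) (c : KIdx n (p + 1) → V)
    (T : KIdx n p) :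
    koszulMap L p c T = ∑ i : {i // i ∉ T.1}, koszulSign T.1 i.1 • L i.1 (c (T.insert i)) := by
  simp [koszulMap]

lemma koszulMap_comp {n : ℕ} (L : Fin n → V →ₗ[R] V) (hL : ∀ i j v, L i (L j v) = L j (L i v))
    (p : ℕ) (c : KIdx n (p + 2) → V) : koszulMap L p (koszulMap L (p + 1) c) = 0 := by
  ext T
  simp only [koszulMap_apply, map_sum, Finset.smul_sum, map_zsmul, Pi.zero_apply, smul_smul]
  rw [Finset.sum_sigma']
  have hj : ∀ (i : {i // i ∉ T.1}) (j : {j // j ∉ (T.insert i).1}), j.1 ∉ T.1 ∧ i.1 ≠ j.1 :=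
    fun i j => by
      have := j.2
      simp only [KIdx.insert, Finset.mem_insert, not_or] at this
      exact ⟨this.2, fun h => this.1 h.symm⟩
  refine Finset.sum_involution
    (fun q _ => ⟨⟨q.2.1, (hj q.1 q.2).1⟩, ⟨q.1.1, by
      simp only [KIdx.insert, Finset.mem_insert, not_or]
      exact ⟨(hj q.1 q.2).2, q.1.2⟩⟩⟩) ?_ ?_ (fun _ _ => by simp) (fun _ _ => rfl)
  · rintro ⟨i, j⟩ -
    have h1 := koszulSign_insert T.1 i.2 (hj i j).1 (hj i j).2
    dsimp only [KIdx.insert] at h1 ⊢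
    rw [h1, hL i.1 j.1]
    simp only [Finset.insert_comm j.1 i.1 T.1, neg_smul, neg_add_cancel]
  · rintro ⟨i, j⟩ - - h
    have := congrArg (fun q => q.1.1) h
    exact (hj i j).2 this.symm

lemma koszulMap_natural {n : ℕ} {W : Type*} [AddCommGroup W] [Module R W] (L : Fin n → V →ₗ[R] V)
    (L' : Fin n → W →ₗ[R] W) (g : V →ₗ[R] W) (h : ∀ i v, L' i (g v) = g (L i v)) (p : ℕ)
    (c : KIdx n (p + 1) → V) (T : KIdx n p) :
    koszulMap L' p (fun S => g (c S)) T = g (koszulMap L p c T) := by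
  simp only [koszulMap_apply, map_sum, map_zsmul, h]

/-- The bilinear map `(a, (c_s)) ↦ (β(a, c_s))`. -/
def piMul (ι : Type) {U V W : Type*} [AddCommGroup U] [Module R U] [AddCommGroup V] [Module R V]
    [AddCommGroup W] [Module R W] (β : U →ₗ[R] V →ₗ[R] W) : U →ₗ[R] (ι → V) →ₗ[R] (ι → W) :=
  LinearMap.mk₂ R (fun a c s => β a (c s))
    (fun a a' c => by ext; simp) (fun r a c => by ext; simp) (fun a c c' => by ext; simp)
    (fun r a c => by ext; simp)

variable {X : Type u} [Category.{v} X] [Preadditive X] [Linear R X] [MonoidalCategory X]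

/-- `A` as a module over itself. -/
abbrev FMonoid.self (A : FMonoid R X) : FMod A where
  toFun := A.toFun
  smul := A.mul
  smul_natural := A.mul_natural
  mul_smul := A.mul_assoc
  one_smul := A.one_mul

/-- The map `L_a : A(x) → A(x)`, `b ↦ A(λ_x)(a × b)`, for `a ∈ A(𝟙)`. -/
def FMonoid.leftMul (A : FMonoid R X) (a : A.toFun.val (𝟙_ X)) (x : X) :
    A.toFun.val x →ₗ[R] A.toFun.val x :=
  A.toFun.act (λ_ x).hom ∘ₗ A.mul (𝟙_ X) x a

lemma FMonoid.leftMul_apply (A : FMonoid R X) (a : A.toFun.val (𝟙_ X)) (x : X)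
    (b : A.toFun.val x) : A.leftMul a x b = A.toFun.act (λ_ x).hom (A.mul (𝟙_ X) x a b) := rfl

lemma FMonoid.leftMul_act (A : FMonoid R X) (a : A.toFun.val (𝟙_ X)) {x y : X} (f : x ⟶ y)
    (b : A.toFun.val x) : A.leftMul a y (A.toFun.act f b) = A.toFun.act f (A.leftMul a x b) := by
  have := A.mul_natural (𝟙 (𝟙_ X)) f a b
  rw [LinFun.act_id] at this
  rw [leftMul_apply, leftMul_apply, this, ← LinFun.act_comp, ← LinFun.act_comp]
  simp

lemma FMonoid.leftMul_mul (A : FMonoid R X) (a : A.toFun.val (𝟙_ X)) {x y : X}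
    (b : A.toFun.val x) (c : A.toFun.val y) :
    A.leftMul a (x ⊗ y) (A.mul x y b c) = A.mul x y (A.leftMul a x b) c := by
  have h := A.mul_natural (λ_ x).hom (𝟙 y) (A.mul _ _ a b) c
  rw [LinFun.act_id] at h
  rw [leftMul_apply, leftMul_apply, h, ← A.mul_assoc, ← LinFun.act_comp]
  simp

lemma FMonoid.mul_leftMul [BraidedCategory X] (A : FMonoid R X) [A.IsComm]
    (a : A.toFun.val (𝟙_ X)) {x y : X} (b : A.toFun.val x) (c : A.toFun.val y) :
    A.mul x y b (A.leftMul a y c) = A.leftMul a (x ⊗ y) (A.mul x y b c) := by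
  have h := A.mul_natural (𝟙 x) (λ_ y).hom b (A.mul _ _ a c)
  have h' := A.mul_natural (ρ_ x).hom (𝟙 y) (A.mul _ _ b a) c
  rw [LinFun.act_id] at h h'
  rw [leftMul_mul, leftMul_apply, h, ← A.mul_assoc, ← LinFun.act_comp, leftMul_apply,
    ← FMonoid.IsComm.comm b a, ← LinFun.act_comp, braiding_leftUnitor, h']
  simp

lemma FMonoid.leftMul_comm [BraidedCategory X] (A : FMonoid R X) [A.IsComm]
    (a b : A.toFun.val (𝟙_ X)) {x : X} (c : A.toFun.val x) :
    A.leftMul a x (A.leftMul b x c) = A.leftMul b x (A.leftMul a x c) := by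
  conv_lhs => rw [leftMul_apply A b, leftMul_act, ← A.mul_leftMul]
  rfl

/-- `K_p^n(A) = ⨁_{S ⊆ {1, …, n}, |S| = p} A`. -/
abbrev koszulObj (A : FMonoid R X) (n p : ℕ) : FMod A where
  toFun := LinFun.of (fun x => KIdx n p → A.toFun.val x)
    (fun {x y} =>
      { toFun := fun f => LinearMap.pi fun S => A.toFun.act f ∘ₗ LinearMap.proj S
        map_add' := fun f g => by ext; simp [LinFun.act_add]
        map_smul' := fun r f => by ext; simp [LinFun.act_smul] })
    (fun x c => by ext; simp)
    (fun f g c => by ext; simp [LinFun.act_comp])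
  smul x y := piMul (KIdx n p) (A.mul x y)
  smul_natural f g a c := by
    funext S
    exact A.mul_natural f g a (c S)
  mul_smul a b c := by
    funext S
    exact A.mul_assoc a b (c S)
  one_smul c := by
    funext S
    exact A.one_mul (c S)

variable [BraidedCategory X]

/-- The differential `d : K_{p+1}^n(A) → K_p^n(A)` of the Koszul complex. -/
def koszulD (A : FMonoid R X) [A.IsComm] {n : ℕ} (α : Fin n → A.toFun.val (𝟙_ X)) (p : ℕ) :
    koszulObj A n (p + 1) ⟶ koszulObj A n p :=
  ⟨LinFun.homMk (fun x => koszulMap (fun i => A.leftMul (α i) x) p) (fun f c => by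
      funext T
      exact koszulMap_natural _ _ (A.toFun.act f) (fun i b => A.leftMul_act (α i) f b) p c T),
    fun x y a c => by
      funext T
      exact koszulMap_natural _ _ (A.mul x y a) (fun i b => (A.mul_leftMul (α i) a b).symm) p c T⟩

/-- The Koszul complex `K_A(α)` of `A`-modules, for a commutative monoid `A` and
`α = (α₁, …, αₙ)` in `A(𝟙)`. -/
def koszulComplex (A : FMonoid R X) [A.IsComm] {n : ℕ} (α : Fin n → A.toFun.val (𝟙_ X)) :
    ChainComplex (FMod A) ℕ :=
  ChainComplex.of (koszulObj A n) (koszulD A α) (fun p => by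
    apply FMod.hom_ext
    intro x c
    exact koszulMap_comp _ (fun i j v => A.leftMul_comm _ _ v) p c)

end


/-! ### The tensor product over a monoid -/

section

variable {R : Type w} [CommRing R] {X : Type u} [Category.{v} X] [Preadditive X] [Linear R X]
  [MonoidalCategory X] [BraidedCategory X] {B C : FMonoid R X}

/-- The right action `K(x) × B(y) → K(x ⊗ y)` of `B` on a module `K` over a commutative monoid
`C`, obtained by restriction along a morphism of monoids `r : B → C`. -/
def FMod.rsmul (r : B.Hom C) (K : FMod C) (x y : X) :
    K.toFun.val x →ₗ[R] B.toFun.val y →ₗ[R] K.toFun.val (x ⊗ y) :=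
  ((K.smul y x).compr₂ (K.toFun.act (β_ y x).hom) ∘ₗ LinFun.comp r.hom y).flip

lemma FMod.rsmul_apply (r : B.Hom C) (K : FMod C) {x y : X} (k : K.toFun.val x)
    (b : B.toFun.val y) :
    K.rsmul r x y k b = K.toFun.act (β_ y x).hom (K.smul y x (LinFun.comp r.hom y b) k) := rfl

variable [EssentiallySmall.{w} X]

/-- The relations `[f, k · b, m] = [f, k, b · m]` defining `(K ⊗_B M)(z)` as a quotient of
`(K ⊗ M)(z)`, that is, the image at `z` of the difference of the two maps
`K ⊗ B ⊗ M ⟶ K ⊗ M` given by the actions. -/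
def balRel (r : B.Hom C) (K : FMod C) (M : FMod B) (z : X) :
    Submodule R (DayVal K.toFun M.toFun z) :=
  Submodule.span R {t | ∃ (x y y' : X) (f : (x ⊗ y) ⊗ y' ⟶ z) (k : K.toFun.val x)
    (b : B.toFun.val y) (m : M.toFun.val y'),
    t = DayVal.mk _ _ (x ⊗ y) y' z f (K.rsmul r x y k b) m -
      DayVal.mk _ _ x (y ⊗ y') z ((α_ x y y').inv ≫ f) k (M.smul y y' b m)}

/-- The value `(K ⊗_B M)(z)`. -/
abbrev BalVal (r : B.Hom C) (K : FMod C) (M : FMod B) (z : X) : Type w :=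
  DayVal K.toFun M.toFun z ⧸ balRel r K M z

namespace BalVal

variable {r : B.Hom C} {K : FMod C} {M : FMod B}

/-- The class `[f, k, m]` in `(K ⊗_B M)(z)`, as a trilinear map. -/
def mk (r : B.Hom C) (K : FMod C) (M : FMod B) (x y z : X) :
    (x ⊗ y ⟶ z) →ₗ[R] K.toFun.val x →ₗ[R] M.toFun.val y →ₗ[R] BalVal r K M z where
  toFun f := (DayVal.mk K.toFun M.toFun x y z f).compr₂ (balRel r K M z).mkQ
  map_add' f g := by ext; simp
  map_smul' r f := by ext; simp

lemma mk_dinatural {x x' y y' z : X} (φ : x ⟶ x') (ψ : y ⟶ y') (f : x' ⊗ y' ⟶ z)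
    (k : K.toFun.val x) (m : M.toFun.val y) :
    mk r K M x y z ((φ ⊗ₘ ψ) ≫ f) k m = mk r K M x' y' z f (K.toFun.act φ k) (M.toFun.act ψ m) :=
  congrArg (balRel r K M z).mkQ (DayVal.mk_dinatural φ ψ f k m)

lemma mk_balanced {x y y' z : X} (f : (x ⊗ y) ⊗ y' ⟶ z) (k : K.toFun.val x)
    (b : B.toFun.val y) (m : M.toFun.val y') :
    mk r K M (x ⊗ y) y' z f (K.rsmul r x y k b) m =
      mk r K M x (y ⊗ y') z ((α_ x y y').inv ≫ f) k (M.smul y y' b m) :=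
  (Submodule.Quotient.eq _).2 (Submodule.subset_span ⟨x, y, y', f, k, b, m, rfl⟩)

lemma induction {z : X} {p : BalVal r K M z → Prop} (t : BalVal r K M z)
    (h_mk : ∀ x y f k m, p (mk r K M x y z f k m)) (h_zero : p 0)
    (h_add : ∀ s t, p s → p t → p (s + t)) : p t := by
  induction t using Submodule.Quotient.induction_on with | _ t
  induction t using DayVal.induction with
  | h_mk x y f a b => exact h_mk x y f a b
  | h_zero => exact h_zero
  | h_add s t hs ht => exact h_add _ _ hs ht

/-- Universal property of `(K ⊗_B M)(z)`. -/
def lift {z : X} {V : Type*} [AddCommGroup V] [Module R V]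
    (φ : ∀ x y, (x ⊗ y ⟶ z) →ₗ[R] K.toFun.val x →ₗ[R] M.toFun.val y →ₗ[R] V)
    (h : ∀ (x x' y y' : X) (p : x ⟶ x') (q : y ⟶ y') (f : x' ⊗ y' ⟶ z) (k : K.toFun.val x)
      (m : M.toFun.val y),
      φ x y ((p ⊗ₘ q) ≫ f) k m = φ x' y' f (K.toFun.act p k) (M.toFun.act q m))
    (h' : ∀ (x y y' : X) (f : (x ⊗ y) ⊗ y' ⟶ z) (k : K.toFun.val x) (b : B.toFun.val y)
      (m : M.toFun.val y'), φ (x ⊗ y) y' f (K.rsmul r x y k b) m =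
        φ x (y ⊗ y') ((α_ x y y').inv ≫ f) k (M.smul y y' b m)) :
    BalVal r K M z →ₗ[R] V :=
  Submodule.liftQ _ (DayVal.lift φ h) (by
    rw [balRel, Submodule.span_le]
    rintro _ ⟨x, y, y', f, k, b, m, rfl⟩
    simp [h'])

@[simp] lemma lift_mk {z : X} {V : Type*} [AddCommGroup V] [Module R V]
    (φ : ∀ x y, (x ⊗ y ⟶ z) →ₗ[R] K.toFun.val x →ₗ[R] M.toFun.val y →ₗ[R] V)
    (h : ∀ (x x' y y' : X) (p : x ⟶ x') (q : y ⟶ y') (f : x' ⊗ y' ⟶ z) (k : K.toFun.val x)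
      (m : M.toFun.val y),
      φ x y ((p ⊗ₘ q) ≫ f) k m = φ x' y' f (K.toFun.act p k) (M.toFun.act q m))
    (h' : ∀ (x y y' : X) (f : (x ⊗ y) ⊗ y' ⟶ z) (k : K.toFun.val x) (b : B.toFun.val y)
      (m : M.toFun.val y'), φ (x ⊗ y) y' f (K.rsmul r x y k b) m =
        φ x (y ⊗ y') ((α_ x y y').inv ≫ f) k (M.smul y y' b m))
    {x y : X} (f : x ⊗ y ⟶ z) (k : K.toFun.val x) (m : M.toFun.val y) :
    lift (r := r) φ h h' (mk r K M x y z f k m) = φ x y f k m :=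
  DayVal.lift_mk φ h f k m

/-- The functoriality `[f, k, m] ↦ [f ≫ g, k, m]` of `K ⊗_B M`. -/
def act (r : B.Hom C) (K : FMod C) (M : FMod B) (z z' : X) :
    (z ⟶ z') →ₗ[R] BalVal r K M z →ₗ[R] BalVal r K M z' where
  toFun g := lift (fun x y => mk r K M x y z' ∘ₗ Linear.rightComp R (x ⊗ y) g)
    (fun x x' y y' p q f a b => by simp [← mk_dinatural])
    (fun x y y' f k b m => by simp [mk_balanced])
  map_add' g g' := by
    refine LinearMap.ext fun t => ?_
    induction t using induction <;> simp_all; abel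
  map_smul' r g := by
    refine LinearMap.ext fun t => ?_
    induction t using induction <;> simp_all

@[simp] lemma act_mk {x y z z' : X} (g : z ⟶ z') (f : x ⊗ y ⟶ z) (k : K.toFun.val x)
    (m : M.toFun.val y) :
    act r K M z z' g (mk r K M x y z f k m) = mk r K M x y z' (f ≫ g) k m :=
  lift_mk (r := r) _ _ (fun x y y' f k b m => by simp [mk_balanced]) f k m

end BalVal

/-- `K ⊗_B M`, as an object of `𝓕`. -/
abbrev balFun (r : B.Hom C) (K : FMod C) (M : FMod B) : LinFun R X :=
  LinFun.of (BalVal r K M) (fun {z z'} => BalVal.act r K M z z')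
    (fun z t => by induction t using BalVal.induction <;> simp_all)
    (fun f g t => by induction t using BalVal.induction <;> simp_all)

/-- The map `K ⊗_B M → K' ⊗_B M` induced by a morphism of `C`-modules `K → K'`, at `z`. -/
def BalVal.map (r : B.Hom C) {K K' : FMod C} (φ : K ⟶ K') (M : FMod B) (z : X) :
    BalVal r K M z →ₗ[R] BalVal r K' M z :=
  BalVal.lift (r := r)
    (fun x y =>
      { toFun := fun f => BalVal.mk r K' M x y z f ∘ₗ LinFun.comp φ.1 x
        map_add' := fun f g => by ext; simp
        map_smul' := fun s f => by ext; simp })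
    (fun x x' y y' p q f k m => by
      simp [BalVal.mk_dinatural, LinFun.comp_act])
    (fun x y y' f k b m => by
      have h : LinFun.comp φ.1 (x ⊗ y) (K.rsmul r x y k b) =
          K'.rsmul r x y (LinFun.comp φ.1 x k) b := by
        rw [FMod.rsmul_apply, FMod.rsmul_apply, LinFun.comp_act, φ.2]
      simp [h, BalVal.mk_balanced])

@[simp] lemma BalVal.map_mk (r : B.Hom C) {K K' : FMod C} (φ : K ⟶ K') (M : FMod B) {x y z : X}
    (f : x ⊗ y ⟶ z) (k : K.toFun.val x) (m : M.toFun.val y) :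
    BalVal.map r φ M z (BalVal.mk r K M x y z f k m) =
      BalVal.mk r K' M x y z f (LinFun.comp φ.1 x k) m := by
  rw [BalVal.map, BalVal.lift_mk]
  rfl

/-- The map `(C ⊗_B M)(z) → M(z)`, `[f, c, m] ↦ M(f)(π(c) · m)`, induced by a morphism of monoids
`π : C → B` which is a retraction of `r`. -/
def BalVal.aug [C.IsComm] (r : B.Hom C) (π : C.Hom B)
    (hr : ∀ x b, LinFun.comp π.hom x (LinFun.comp r.hom x b) = b) (M : FMod B) (z : X) :
    BalVal r C.self M z →ₗ[R] M.toFun.val z :=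
  BalVal.lift (r := r) (fun x y => M.toFun.actMul (M.smul x y ∘ₗ LinFun.comp π.hom x))
    (fun x x' y y' p q f c m => by
      simp [LinFun.act_comp, LinFun.comp_act, M.smul_natural])
    (fun x y y' f c b m => by
      have h : (C.self.rsmul r x y c b) = C.mul x y c (LinFun.comp r.hom y b) :=
        FMonoid.IsComm.comm _ _
      simp [h, π.map_mul, hr, ← M.mul_smul, ← LinFun.act_comp _ (α_ x y y').hom])

@[simp] lemma BalVal.aug_mk [C.IsComm] (r : B.Hom C) (π : C.Hom B)
    (hr : ∀ x b, LinFun.comp π.hom x (LinFun.comp r.hom x b) = b) (M : FMod B) {x y z : X}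
    (f : x ⊗ y ⟶ z) (c : C.toFun.val x) (m : M.toFun.val y) :
    BalVal.aug r π hr M z (BalVal.mk r C.self M x y z f c m) =
      M.toFun.act f (M.smul x y (LinFun.comp π.hom x c) m) := by
  rw [BalVal.aug, BalVal.lift_mk]
  rfl

end

section

variable {R : Type w} [CommRing R] {X : Type u} [Category.{v} X] [Preadditive X] [Linear R X]
  [MonoidalCategory X] [SymmetricCategory X] {B C : FMonoid R X}

/-- The two actions of `C` on a `C`-module (on the left, and on the right through the symmetry)
commute, when `C` is commutative. -/
lemma FMod.smul_rsmul [C.IsComm] (r : B.Hom C) (K : FMod C) {x y z : X} (c : C.toFun.val x)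
    (k : K.toFun.val y) (b : B.toFun.val z) :
    K.smul x (y ⊗ z) c (K.rsmul r y z k b) =
      K.toFun.act (α_ x y z).hom (K.rsmul r (x ⊗ y) z (K.smul x y c k) b) := by
  have h1 := K.smul_natural (𝟙 x) (β_ z y).hom c (K.smul z y (LinFun.comp r.hom z b) k)
  have h2 := K.smul_natural (β_ x z).hom (𝟙 y) (C.mul x z c (LinFun.comp r.hom z b)) k
  rw [LinFun.act_id] at h1 h2
  rw [FMod.rsmul_apply, FMod.rsmul_apply, h1, ← K.mul_smul, ← K.mul_smul,
    ← FMonoid.IsComm.comm c, h2, ← LinFun.act_comp, ← LinFun.act_comp, ← LinFun.act_comp,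
    ← LinFun.act_comp]
  congr 1
  have h3 := BraidedCategory.hexagon_forward z x y
  simp only [id_tensorHom, tensorHom_id, h3, ← comp_whiskerRight_assoc,
    SymmetricCategory.symmetry, id_whiskerRight, Category.id_comp]

variable [MonoidalPreadditive X] [MonoidalLinear R X] [EssentiallySmall.{w} X]

/-- The left action of `b ∈ B(x')` on `[f, k, m]`, through `l : B → C`. -/
def BalVal.smulMk (l r : B.Hom C) (K : FMod C) (M : FMod B) (x' x y z : X) :
    (x ⊗ y ⟶ z) →ₗ[R] K.toFun.val x →ₗ[R] M.toFun.val y →ₗ[R]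
      B.toFun.val x' →ₗ[R] BalVal r K M (x' ⊗ z) where
  toFun f := LinearMap.mk₂ R
    (fun k m => ((BalVal.mk r K M (x' ⊗ x) y (x' ⊗ z) ((α_ x' x y).hom ≫ x' ◁ f)).flip m) ∘ₗ
      (K.smul x' x).flip k ∘ₗ LinFun.comp l.hom x')
    (fun k k' m => by ext; simp) (fun s k m => by ext; simp) (fun k m m' => by ext; simp)
    (fun s k m => by ext; simp)
  map_add' f g := by ext; simp
  map_smul' s f := by ext; simp

@[simp] lemma BalVal.smulMk_apply (l r : B.Hom C) (K : FMod C) (M : FMod B) {x' x y z : X}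
    (f : x ⊗ y ⟶ z) (k : K.toFun.val x) (m : M.toFun.val y) (b : B.toFun.val x') :
    BalVal.smulMk l r K M x' x y z f k m b =
      BalVal.mk r K M (x' ⊗ x) y (x' ⊗ z) ((α_ x' x y).hom ≫ x' ◁ f)
        (K.smul x' x (LinFun.comp l.hom x' b) k) m := rfl

/-- The left action `B(x') × (K ⊗_B M)(z) → (K ⊗_B M)(x' ⊗ z)`, through `l : B → C`. -/
def BalVal.smul [C.IsComm] (l r : B.Hom C) (K : FMod C) (M : FMod B) (x' z : X) :
    B.toFun.val x' →ₗ[R] BalVal r K M z →ₗ[R] BalVal r K M (x' ⊗ z) :=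
  (BalVal.lift (r := r) (fun x y => BalVal.smulMk l r K M x' x y z)
    (fun x x'' y y' p q f k m => by
      refine LinearMap.ext fun b => ?_
      have h := K.smul_natural (𝟙 x') p (LinFun.comp l.hom x' b) k
      rw [LinFun.act_id] at h
      simp only [BalVal.smulMk_apply]
      rw [h, ← BalVal.mk_dinatural]
      congr 3
      simp [MonoidalCategory.tensorHom_def])
    (fun x y y' f k b m => by
      refine LinearMap.ext fun b' => ?_
      simp only [BalVal.smulMk_apply]
      rw [K.smul_rsmul]
      have h := BalVal.mk_dinatural (r := r) (K := K) (M := M) (α_ x' x y).hom (𝟙 y')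
        ((α_ x' (x ⊗ y) y').hom ≫ x' ◁ f)
        (K.rsmul r (x' ⊗ x) y (K.smul x' x (LinFun.comp l.hom x' b') k) b) m
      rw [LinFun.act_id] at h
      rw [← h, BalVal.mk_balanced]
      congr 3
      simp)).flip

@[simp] lemma BalVal.smul_mk [C.IsComm] (l r : B.Hom C) (K : FMod C) (M : FMod B) {x' x y z : X}
    (b : B.toFun.val x') (f : x ⊗ y ⟶ z) (k : K.toFun.val x) (m : M.toFun.val y) :
    BalVal.smul l r K M x' z b (BalVal.mk r K M x y z f k m) =
      BalVal.mk r K M (x' ⊗ x) y (x' ⊗ z) ((α_ x' x y).hom ≫ x' ◁ f)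
        (K.smul x' x (LinFun.comp l.hom x' b) k) m := by
  rw [BalVal.smul, LinearMap.flip_apply, BalVal.lift_mk, BalVal.smulMk_apply]

/-- The `B`-module `K ⊗_B M`, for a module `K` over a commutative monoid `C`, seen as a
`(B, B)`-bimodule through `l : B → C` on the left and `r : B → C` on the right. -/
abbrev balTensor [C.IsComm] (l r : B.Hom C) (K : FMod C) (M : FMod B) : FMod B where
  toFun := balFun r K M
  smul := BalVal.smul l r K M
  smul_natural {x x' y y'} f g b t := by
    change BalVal.smul l r K M x' y' (B.toFun.act f b) (BalVal.act r K M y y' g t) =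
      BalVal.act r K M _ _ (f ⊗ₘ g) (BalVal.smul l r K M x y b t)
    induction t using BalVal.induction with
    | h_zero => simp only [map_zero]
    | h_add s t hs ht => simp only [map_add, hs, ht]
    | h_mk x₁ y₁ e k m =>
      have h := K.smul_natural f (𝟙 x₁) (LinFun.comp l.hom x b) k
      rw [LinFun.act_id] at h
      have h' := BalVal.mk_dinatural (r := r) (K := K) (M := M) (f ⊗ₘ 𝟙 x₁) (𝟙 y₁)
        ((α_ x' x₁ y₁).hom ≫ x' ◁ (e ≫ g)) (K.smul x x₁ (LinFun.comp l.hom x b) k) m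
      rw [LinFun.act_id] at h'
      rw [BalVal.act_mk, BalVal.smul_mk, BalVal.smul_mk, BalVal.act_mk, LinFun.comp_act, h, ← h']
      congr 3
      simp [MonoidalCategory.tensorHom_def, whisker_exchange_assoc]
  mul_smul {x y z} a b t := by
    change BalVal.act r K M _ _ (α_ x y z).hom (BalVal.smul l r K M _ z (B.mul x y a b) t) =
      BalVal.smul l r K M x _ a (BalVal.smul l r K M y z b t)
    induction t using BalVal.induction with
    | h_zero => simp only [map_zero]
    | h_add s t hs ht => simp only [map_add, hs, ht]
    | h_mk x₁ y₁ e k m =>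
      have h' := BalVal.mk_dinatural (r := r) (K := K) (M := M) (α_ x y x₁).hom (𝟙 y₁)
        ((α_ x (y ⊗ x₁) y₁).hom ≫ x ◁ ((α_ y x₁ y₁).hom ≫ y ◁ e))
        (K.smul (x ⊗ y) x₁ (C.mul x y (LinFun.comp l.hom x a) (LinFun.comp l.hom y b)) k) m
      rw [LinFun.act_id, K.mul_smul] at h'
      rw [BalVal.smul_mk, BalVal.smul_mk, BalVal.smul_mk, BalVal.act_mk, l.map_mul, ← h']
      congr 3
      simp
  one_smul {x} t := by
    change BalVal.act r K M _ _ (λ_ x).hom (BalVal.smul l r K M _ x B.one t) = t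
    induction t using BalVal.induction with
    | h_zero => simp only [map_zero]
    | h_add s t hs ht => simp only [map_add, hs, ht]
    | h_mk x₁ y₁ e k m =>
      have h' := BalVal.mk_dinatural (r := r) (K := K) (M := M) (λ_ x₁).hom (𝟙 y₁) e
        (K.smul (𝟙_ X) x₁ C.one k) m
      rw [LinFun.act_id, K.one_smul] at h'
      rw [BalVal.smul_mk, BalVal.act_mk, l.map_one, ← h']
      congr 3
      simp

/-- The functor `- ⊗_B M` from `C`-modules to `B`-modules. -/
def balFunctor [C.IsComm] (l r : B.Hom C) (M : FMod B) : FMod C ⥤ FMod B where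
  obj K := balTensor l r K M
  map {K K'} φ := ⟨LinFun.homMk (fun z => BalVal.map r φ M z) (fun {z z'} g t => by
      change BalVal.map r φ M z' (BalVal.act r K M z z' g t) =
        BalVal.act r K' M z z' g (BalVal.map r φ M z t)
      induction t using BalVal.induction with
      | h_zero => simp only [map_zero]
      | h_add s t hs ht => simp only [map_add, hs, ht]
      | h_mk x y f k m => simp),
    fun x z b t => by
      change BalVal.map r φ M _ (BalVal.smul l r K M x z b t) =
        BalVal.smul l r K' M x z b (BalVal.map r φ M z t)
      induction t using BalVal.induction with
      | h_zero => simp only [map_zero]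
      | h_add s t hs ht => simp only [map_add, hs, ht]
      | h_mk x y f k m => simp [φ.2 _ _]⟩
  map_id K := by
    apply FMod.hom_ext
    intro z t
    change BalVal.map r (𝟙 K) M z t = t
    induction t using BalVal.induction with
    | h_zero => simp only [map_zero]
    | h_add s t hs ht => simp only [map_add, hs, ht]
    | h_mk x y f k m => rw [BalVal.map_mk]; rfl
  map_comp {K K' K''} φ ψ := by
    apply FMod.hom_ext
    intro z t
    change BalVal.map r (φ ≫ ψ) M z t = BalVal.map r ψ M z (BalVal.map r φ M z t)
    induction t using BalVal.induction with
    | h_zero => simp only [map_zero]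
    | h_add s t hs ht => simp only [map_add, hs, ht]
    | h_mk x y f k m => rw [BalVal.map_mk, BalVal.map_mk, BalVal.map_mk]; rfl

instance [C.IsComm] (l r : B.Hom C) (M : FMod B) : (balFunctor l r M).Additive where
  map_add {K K' φ ψ} := by
    apply FMod.hom_ext
    intro z t
    change BalVal.map r (φ + ψ) M z t = BalVal.map r φ M z t + BalVal.map r ψ M z t
    induction t using BalVal.induction with
    | h_zero => simp only [map_zero, add_zero]
    | h_add s t hs ht => rw [map_add, map_add, map_add, hs, ht]; abel
    | h_mk x y f k m =>
      rw [BalVal.map_mk, BalVal.map_mk, BalVal.map_mk, ← LinearMap.add_apply, ← map_add]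
      rfl

/-- The morphism of `B`-modules `C ⊗_B M → M`, `[f, c, m] ↦ M(f)(π(c) · m)`, induced by a morphism
of monoids `π : C → B` which is a retraction of `l` and of `r`. -/
def balAug [C.IsComm] (l r : B.Hom C) (π : C.Hom B)
    (hl : ∀ x b, LinFun.comp π.hom x (LinFun.comp l.hom x b) = b)
    (hr : ∀ x b, LinFun.comp π.hom x (LinFun.comp r.hom x b) = b) (M : FMod B) :
    (balFunctor l r M).obj C.self ⟶ M :=
  ⟨LinFun.homMk (BalVal.aug r π hr M) (fun {z z'} g t => by
      change BalVal.aug r π hr M z' (BalVal.act r C.self M z z' g t) =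
        M.toFun.act g (BalVal.aug r π hr M z t)
      induction t using BalVal.induction with
      | h_zero => simp only [map_zero]
      | h_add s t hs ht => simp only [map_add, hs, ht]
      | h_mk x y f c m =>
        rw [BalVal.act_mk, BalVal.aug_mk, BalVal.aug_mk, LinFun.act_comp]),
    fun x' z b t => by
      change BalVal.aug r π hr M _ (BalVal.smul l r C.self M x' z b t) =
        M.smul x' z b (BalVal.aug r π hr M z t)
      induction t using BalVal.induction with
      | h_zero => simp only [map_zero]
      | h_add s t hs ht => simp only [map_add, hs, ht]
      | h_mk x y f c m =>
        have h := M.smul_natural (𝟙 x') f b (M.smul x y (LinFun.comp π.hom x c) m)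
        rw [LinFun.act_id] at h
        rw [BalVal.smul_mk, BalVal.aug_mk, BalVal.aug_mk, h, ← M.mul_smul, π.map_mul, hl,
          LinFun.act_comp, id_tensorHom]⟩

end

/-! ### Relative projectivity and split resolutions -/

section

variable {𝒞 𝒟 : Type*} [Category 𝒞] [Category 𝒟]

/-- `P` is projective relative to a functor `U : 𝒞 ⥤ 𝒟` (`𝒟`-projective) if morphisms from `P`
lift along every morphism `g` of `𝒞` such that `U(g)` is a split epimorphism. -/
def RelProjective (U : 𝒞 ⥤ 𝒟) (P : 𝒞) : Prop :=
  ∀ ⦃L N : 𝒞⦄ (g : L ⟶ N), IsSplitEpi (U.map g) → ∀ f : P ⟶ N, ∃ h : P ⟶ L, h ≫ g = f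

/-- A complex is split if there are maps `s` (of degree `1`) with `d s d = d`. -/
def IsSplitComplex [Preadditive 𝒟] (L : ChainComplex 𝒟 ℕ) : Prop :=
  ∃ s : ∀ i, L.X i ⟶ L.X (i + 1), ∀ i, L.d (i + 1) i ≫ s i ≫ L.d (i + 1) i = L.d (i + 1) i

/-- The complex `… → L₁ → L₀ → M → 0` is a `𝒟`-split resolution of `M`: it is exact in `𝒞`, and its
image under `U : 𝒞 ⥤ 𝒟` is a split complex. -/
structure IsSplitResolution [Preadditive 𝒞] [Preadditive 𝒟] (U : 𝒞 ⥤ 𝒟) [U.Additive]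
    (L : ChainComplex 𝒞 ℕ) {M : 𝒞} (ε : L.X 0 ⟶ M) (hε : L.d 1 0 ≫ ε = 0) : Prop where
  exact : (L.augment ε hε).Acyclic
  split : IsSplitComplex ((U.mapHomologicalComplex _).obj (L.augment ε hε))

end

/-! ### The Koszul resolution of `A[t₁, …, tₙ]`, tensored with a module -/

section

variable {R : Type w} [CommRing R] {X : Type u} [Category.{v} X] [Preadditive X] [Linear R X]
  [MonoidalCategory X]

/-- `A[u₁, …, uₙ, v₁, …, vₙ]`. -/
abbrev FMonoid.poly₂ (A : FMonoid R X) (n : ℕ) : FMonoid R X := A.poly (Fin n ⊕ Fin n)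

/-- The morphism of monoids `A[t] → A[u, v]`, `tᵢ ↦ uᵢ`. -/
def FMonoid.uIncl (A : FMonoid R X) (n : ℕ) : (A.poly (Fin n)).Hom (A.poly₂ n) :=
  A.rename Sum.inl

/-- The morphism of monoids `A[t] → A[u, v]`, `tᵢ ↦ vᵢ`. -/
def FMonoid.vIncl (A : FMonoid R X) (n : ℕ) : (A.poly (Fin n)).Hom (A.poly₂ n) :=
  A.rename Sum.inr

/-- The morphism of monoids `A[u, v] → A[t]`, `uᵢ ↦ tᵢ`, `vᵢ ↦ tᵢ`. When `A` is tensor idempotent,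
it corresponds to the multiplication of `A[t]` under `A[t] ⊗ A[t] ≅ A[u, v]`. -/
def FMonoid.fold (A : FMonoid R X) (n : ℕ) : (A.poly₂ n).Hom (A.poly (Fin n)) :=
  A.rename (Sum.elim id id)

/-- The elements `αᵢ = uᵢ - vᵢ`. -/
def FMonoid.diff (A : FMonoid R X) (n : ℕ) (i : Fin n) : (A.poly₂ n).toFun.val (𝟙_ X) :=
  A.var (Sum.inl i) - A.var (Sum.inr i)

lemma FMonoid.rename_rename (A : FMonoid R X) {σ τ υ : Type} (e : σ → τ) (e' : τ → υ) (x : X)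
    (p : (A.poly σ).toFun.val x) :
    LinFun.comp (A.rename e').hom x (LinFun.comp (A.rename e).hom x p) =
      LinFun.comp (A.rename (e' ∘ e)).hom x p := by
  change Finsupp.mapDomain _ (Finsupp.mapDomain _ _) = Finsupp.mapDomain _ _
  rw [← Finsupp.mapDomain_comp]
  congr 1
  funext i
  exact Finsupp.mapDomain_comp.symm

lemma FMonoid.rename_id (A : FMonoid R X) {σ : Type} (x : X) (p : (A.poly σ).toFun.val x) :
    LinFun.comp (A.rename id).hom x p = p := by
  change Finsupp.mapDomain _ _ = _
  rw [show (Finsupp.mapDomain id : (σ →₀ ℕ) → (σ →₀ ℕ)) = id from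
    funext fun i => Finsupp.mapDomain_id, Finsupp.mapDomain_id]

lemma FMonoid.fold_uIncl (A : FMonoid R X) (n : ℕ) (x : X) (p : (A.poly (Fin n)).toFun.val x) :
    LinFun.comp (A.fold n).hom x (LinFun.comp (A.uIncl n).hom x p) = p := by
  rw [fold, uIncl, rename_rename]
  exact A.rename_id x p

lemma FMonoid.fold_vIncl (A : FMonoid R X) (n : ℕ) (x : X) (p : (A.poly (Fin n)).toFun.val x) :
    LinFun.comp (A.fold n).hom x (LinFun.comp (A.vIncl n).hom x p) = p := by
  rw [fold, vIncl, rename_rename]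
  exact A.rename_id x p

/-- The isomorphism `K_0^n(A) → A`. -/
def koszulZero (A : FMonoid R X) (n : ℕ) : koszulObj A n 0 ⟶ A.self :=
  ⟨LinFun.homMk (fun _ => LinearMap.proj (⟨∅, rfl⟩ : KIdx n 0)) (fun _ _ => rfl),
    fun _ _ _ _ => rfl⟩

variable [SymmetricCategory X] [MonoidalPreadditive X] [MonoidalLinear R X]
  [EssentiallySmall.{w} X] (A : FMonoid R X) [A.IsComm] (n : ℕ) (M : FMod (A.poly (Fin n)))

/-- The complex of `A[t]`-modules `K_C(α) ⊗_{A[t]} M`, where `C = A[u, v]`, an `A[t]`-bimodule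
through `u` on the left and through `v` on the right, and `αᵢ = uᵢ - vᵢ`. -/
def koszulTensor : ChainComplex (FMod (A.poly (Fin n))) ℕ :=
  ((balFunctor (A.uIncl n) (A.vIncl n) M).mapHomologicalComplex _).obj
    (koszulComplex (A.poly₂ n) (A.diff n))

/-- The augmentation `C ⊗_{A[t]} M → A[t] ⊗_{A[t]} M ≅ M`. -/
def koszulTensorAug : (koszulTensor A n M).X 0 ⟶ M :=
  (balFunctor (A.uIncl n) (A.vIncl n) M).map (koszulZero (A.poly₂ n) n) ≫
    balAug (A.uIncl n) (A.vIncl n) (A.fold n) (A.fold_uIncl n) (A.fold_vIncl n) M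

end

end

/-! After base change to `M`, the Koszul complex becomes elementary. In `A[u, v] ⊗_{A[t]} M` the
variables `v` can be moved across the tensor sign, where they act as the `t`. What remains is
`M[u]`: polynomials in `u` with coefficients in `M`, on which `A[t]` acts through `u`, and only the
constants of `A` act on the coefficients (`balIsoFree`). Multiplication by `αᵢ = uᵢ - vᵢ` becomes
the operator `Lᵢ = uᵢ - tᵢ`, with `tᵢ` acting on coefficients, and the augmentation becomes the
evaluation `p(u) ↦ p(t)`. Since `- ⊗_{A[t]} M` is additive and the Koszul differential is an
integral combination of projections followed by the `αᵢ`, the whole complex is isomorphic to the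
Koszul complex of the commuting endomorphisms `Lᵢ` of `M[u]` (`koszulTensorIso`). The resolution `L`
is this second complex.

For one variable, let `Eᵢ` be the evaluation at `uᵢ = tᵢ` and `Dᵢ` the divided difference `p ↦ (p -
Eᵢ p) / (uᵢ - tᵢ)`. Then `Lᵢ Dᵢ = 1 - Eᵢ` and `Dᵢ Lᵢ = 1`, so `Dᵢ` contracts the two-term complex of
`Lᵢ` onto the image of `Eᵢ`. For `n` variables one takes the usual homotopy of a tensor product of
`n` contractions, `∑ₘ E₀ ⋯ E_{m-1} Dₘ`, where the contraction onto degree 0 in the factors before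
`m` vanishes in degree 1. On the summand of `S` only the term `m = min S` survives, which gives the
formula of `koszulHtpy`. It satisfies `dh + hd = 1` in positive degrees, and in degree 0 it
satisfies `dh = 1 - E₀ ⋯ E_{n-1}`, where the last product is evaluation followed by the inclusion of
constants. With the inclusion `M → M[u]`, it therefore contracts the augmented complex. This works
for any additive coefficients with commuting `tᵢ` (`KoszulContraction`, `polyKoszulContraction`).

The homotopy is natural in the coefficients, hence a morphism of `𝓕`, although it is not linear over
`u`. That suffices: a contraction in `𝓕` gives a splitting in `𝓕`, and also exactness at every
object of `X`, which implies exactness of complexes of modules (`FMod.exact_of_pointwise`).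

Tensor idempotence enters through projectivity. If `μ_A` is an isomorphism, then `a ⊗ 1 = 1 ⊗ a` in
`A ⊗ A`, and every morphism of `𝓕` between `A`-modules is `A`-linear
(`FMonoid.IsTensorIdempotent.mem_homs`). So a section in `𝓕` of an epimorphism of `A[t]`-modules is
automatically `A`-linear. Composed with the restriction to constants of a morphism from `N[t]`, it
extends to an `A[t]`-linear lift. Thus every `N[t]` is `𝓕`-projective, and the terms of the
resolution are finite powers of `M[u]`, indexed by subsets of an `n`-element set. -/

noncomputable section

/-! ### A contracting homotopy of the Koszul complex -/

section

variable {R : Type w} [CommRing R] {V : Type*} [AddCommGroup V] [Module R V] {n : ℕ}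

/-- The composite `E₀ ∘ ⋯ ∘ E_{k-1}`. -/
def prodBelow (E : Fin n → V →ₗ[R] V) : ℕ → V →ₗ[R] V
  | 0 => LinearMap.id
  | k + 1 => prodBelow E k ∘ₗ (if h : k < n then E ⟨k, h⟩ else LinearMap.id)

lemma prodBelow_succ (E : Fin n → V →ₗ[R] V) (i : Fin n) (v : V) :
    prodBelow E (i + 1) v = prodBelow E i (E i v) := by
  simp [prodBelow]

/-- A system of operators `Eᵢ`, `Dᵢ` exhibiting each `Lᵢ` as injective, with `Eᵢ` a projection along
the image of `Lᵢ`, compatibly with the other `Lⱼ`. -/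
structure KoszulContraction (L D E : Fin n → V →ₗ[R] V) : Prop where
  L_D (i : Fin n) (v : V) : L i (D i v) = v - E i v
  D_L (i : Fin n) (v : V) : D i (L i v) = v
  L_D_comm {i j : Fin n} (h : i ≠ j) (v : V) : L i (D j v) = D j (L i v)
  L_E_comm {i j : Fin n} (h : i ≠ j) (v : V) : L i (E j v) = E j (L i v)

namespace KoszulContraction

variable {L D E : Fin n → V →ₗ[R] V}

/-- Evaluate `L D = 1 - E` on `L v` and use `D L = 1`. -/
lemma E_L (H : KoszulContraction L D E) (i : Fin n) (v : V) : E i (L i v) = 0 := by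
  have := H.L_D i (L i v)
  rw [H.D_L] at this
  exact sub_eq_self.1 this.symm

lemma L_prodBelow (H : KoszulContraction L D E) {i : Fin n} {k : ℕ} (hk : k ≤ i) (v : V) :
    L i (prodBelow E k v) = prodBelow E k (L i v) := by
  induction k generalizing v with
  | zero => rfl
  | succ k ih =>
    have hkn : k < n := by omega
    rw [prodBelow_succ E ⟨k, hkn⟩, prodBelow_succ E ⟨k, hkn⟩, ih (by omega),
      H.L_E_comm (fun h => by subst h; simp at hk)]

/-- The factors `Eⱼ` with `j > i` are applied first and commute with `Lᵢ`; then `Lᵢ v'` meets `Eᵢ`,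
which kills it. -/
lemma prodBelow_L (H : KoszulContraction L D E) {i : Fin n} {k : ℕ} (hk : i < k)
    (hkn : k ≤ n) (v : V) :
    prodBelow E k (L i v) = 0 := by
  induction k generalizing v with
  | zero => omega
  | succ k ih =>
    rw [prodBelow_succ E ⟨k, by omega⟩]
    by_cases h : i = ⟨k, by omega⟩
    · rw [← h, H.E_L, map_zero]
    · rw [← H.L_E_comm h]
      refine ih ?_ (by omega) _
      have : i.1 ≠ k := fun h' => h (Fin.ext h')
      omega

/-- Telescoping. -/
lemma sum_L_prodBelow_D (H : KoszulContraction L D E) {k : ℕ} (hk : k ≤ n) (v : V) :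
    ∑ i : Fin n with i.1 < k, L i (prodBelow E i (D i v)) = v - prodBelow E k v := by
  induction k with
  | zero => simp [prodBelow]
  | succ k ih =>
    have : ({i : Fin n | i.1 < k + 1} : Finset (Fin n)) =
        insert ⟨k, hk⟩ ({i : Fin n | i.1 < k} : Finset (Fin n)) := by
      ext i
      simp [Fin.ext_iff]
      omega
    -- The new term is `E₀ ⋯ E_{k-1} (1 - Eₖ) v`, because `Lₖ` commutes with the earlier factors and
    -- meets `Dₖ`.
    rw [this, Finset.sum_insert (by simp), ih (by omega), prodBelow_succ E ⟨k, hk⟩,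
      H.L_prodBelow le_rfl, H.L_D, map_sub]
    simp

end KoszulContraction

/-! ### Smallest elements of index sets, and the homotopy defined with them. -/

lemma KIdx.nonempty {p : ℕ} (S : KIdx n (p + 1)) : S.1.Nonempty :=
  Finset.card_pos.1 (by rw [S.2]; omega)

/-- The smallest element of `S`. -/
def KIdx.min {p : ℕ} (S : KIdx n (p + 1)) : Fin n := S.1.min' S.nonempty

lemma KIdx.min_mem {p : ℕ} (S : KIdx n (p + 1)) : S.min ∈ S.1 := Finset.min'_mem _ _

lemma KIdx.min_le {p : ℕ} (S : KIdx n (p + 1)) {i : Fin n} (h : i ∈ S.1) : S.min ≤ i :=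
  Finset.min'_le _ _ h

lemma KIdx.min_eq {p : ℕ} (S : KIdx n (p + 1)) {i : Fin n} (h : i ∈ S.1)
    (h' : ∀ j ∈ S.1, i ≤ j) : S.min = i :=
  le_antisymm (S.min_le h) (h' _ S.min_mem)

/-- `S` without its smallest element. -/
def KIdx.eraseMin {p : ℕ} (S : KIdx n (p + 1)) : KIdx n p :=
  ⟨S.1.erase S.min, by rw [Finset.card_erase_of_mem S.min_mem, S.2]; rfl⟩

/-- The homotopy `⨁_{|S| = p} V → ⨁_{|S| = p + 1} V`. -/
def koszulHtpy (D E : Fin n → V →ₗ[R] V) (p : ℕ) : (KIdx n p → V) →ₗ[R] (KIdx n (p + 1) → V) :=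
  LinearMap.pi fun S => prodBelow E S.min ∘ₗ D S.min ∘ₗ LinearMap.proj S.eraseMin

lemma koszulHtpy_apply (D E : Fin n → V →ₗ[R] V) (p : ℕ) (c : KIdx n p → V)
    (S : KIdx n (p + 1)) :
    koszulHtpy D E p c S = prodBelow E S.min (D S.min (c S.eraseMin)) := rfl

lemma koszulSign_of_forall_le {T : Finset (Fin n)} {i : Fin n} (h : ∀ j ∈ T, i ≤ j) :
    koszulSign T i = 1 := by
  rw [koszulSign, Finset.filter_false_of_mem (fun j hj => not_lt.2 (h j hj))]
  simp

/-- One element fewer lies below `i`. This sign makes `dh` and `hd` cancel off the diagonal. -/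
lemma koszulSign_erase {T : Finset (Fin n)} {i j : Fin n} (hj : j ∈ T) (h : j < i) :
    koszulSign (T.erase j) i = - koszulSign T i := by
  rw [koszulSign, koszulSign, Finset.filter_erase]
  have : j ∈ T.filter (· < i) := by simp [hj, h]
  rw [← Finset.card_erase_add_one this, pow_succ]
  ring

/-! ### The homotopy identities. -/

namespace KoszulContraction

variable {L D E : Fin n → V →ₗ[R] V}

/-- Over the empty set, `dh` is the full telescoping sum `∑ᵢ Lᵢ E₀ ⋯ E_{i-1} Dᵢ`, since `i` is the
smallest element of `{i}`. -/
lemma koszulMap_koszulHtpy_zero (H : KoszulContraction L D E) (c : KIdx n 0 → V) (T : KIdx n 0) :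
    koszulMap L 0 (koszulHtpy D E 0 c) T = c T - prodBelow E n (c T) := by
  have hT : T.1 = ∅ := Finset.card_eq_zero.1 T.2
  rw [← H.sum_L_prodBelow_D le_rfl, koszulMap_apply]
  simp only [Fin.is_lt, Finset.filter_true]
  refine Finset.sum_bij (fun i _ => i.1) (by simp) (fun i _ j _ h => Subtype.ext h)
    (fun i _ => ⟨⟨i, by simp [hT]⟩, by simp⟩) (fun i _ => ?_)
  have hm : (T.insert i).min = i.1 := KIdx.min_eq _ (by simp [KIdx.insert])
    (by simp [KIdx.insert, hT])
  have he : (T.insert i).eraseMin = T := by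
    refine Subtype.ext ?_
    simp only [KIdx.eraseMin, hm]
    simp [KIdx.insert, Finset.erase_insert i.2]
  rw [koszulHtpy_apply, hm, he, koszulSign_of_forall_le (by simp [hT]), one_smul]

/-- The component at `T` is compared index by index with the telescoping formula for `c T` cut off
at `i₀ = min T`. Indices below `i₀` give its terms through `dh`, the index `i₀` gives the remainder
`E₀ ⋯ E_{i₀-1} (c T)` through `hd`, and larger indices cancel between `dh` and `hd`. -/
lemma koszulMap_koszulHtpy_succ (H : KoszulContraction L D E) (p : ℕ) (c : KIdx n (p + 1) → V) :
    koszulMap L (p + 1) (koszulHtpy D E (p + 1) c) + koszulHtpy D E p (koszulMap L p c) = c := by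
  funext T
  rw [Pi.add_apply, koszulMap_apply, koszulHtpy_apply, koszulMap_apply]
  set i₀ := T.min with hi₀
  -- The two sums run over the complements of different sets, `T` and `T \ {i₀}`. Extension by zero
  -- to all indices lets them be added termwise.
  have key : ∀ (S : Finset (Fin n)) (g : {i // i ∉ S} → V),
      ∑ i : {i // i ∉ S}, g i = ∑ i : Fin n, if h : i ∉ S then g ⟨i, h⟩ else 0 := by
    intro S g
    rw [Finset.sum_dite, Finset.sum_const_zero, add_zero]
    refine Finset.sum_bij (fun i _ => ⟨i.1, by simp [i.2]⟩) (by simp)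
      (fun i _ j _ h => Subtype.ext (by simpa using h)) (fun i _ => ?_) (fun i _ => rfl)
    exact ⟨⟨i.1, (Finset.mem_filter.1 i.2).2⟩, by simp, rfl⟩
  have hsum := H.sum_L_prodBelow_D i₀.2.le (c T)
  rw [map_sum, map_sum, key, key, ← Finset.sum_add_distrib]
  have hT : c T = ∑ i : Fin n, (if i.1 < i₀ then L i (prodBelow E i (D i (c T))) else 0) +
      ∑ i : Fin n, (if i = i₀ then prodBelow E i₀ (c T) else 0) := by
    rw [← Finset.sum_filter, hsum, Finset.sum_ite_eq' Finset.univ i₀]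
    simp
  rw [hT, ← Finset.sum_add_distrib]
  refine Finset.sum_congr rfl fun i _ => ?_
  have hmem := T.min_mem
  rw [← hi₀] at hmem
  have hE : T.eraseMin.1 = T.1.erase i₀ := rfl
  rcases lt_trichotomy i i₀ with h | h | h
  -- Here `i` is the new minimum of `T ∪ {i}`, so `dh` contributes a telescoping term. In `hd` the
  -- operator `Lᵢ` moves past `D` and is killed by the factor `Eᵢ`.
  · have hiT : i ∉ T.1 := fun h' => absurd (T.min_le h') (not_le.2 h)
    have hm : (T.insert ⟨i, hiT⟩).min = i := KIdx.min_eq _ (by simp [KIdx.insert])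
      (by simpa [KIdx.insert] using fun j hj => h.le.trans (T.min_le hj))
    have he : (T.insert ⟨i, hiT⟩).eraseMin = T := by
      refine Subtype.ext ?_
      simp only [KIdx.eraseMin, hm]
      simp [KIdx.insert, Finset.erase_insert hiT]
    have hiE : i ∉ T.eraseMin.1 := by simp [hE, hiT]
    rw [dif_pos hiT, dif_pos hiE, koszulHtpy_apply, hm, he,
      koszulSign_of_forall_le (fun j hj => h.le.trans (T.min_le hj)), if_pos (Fin.lt_def.1 h),
      if_neg h.ne,
      map_zsmul, map_zsmul, ← H.L_D_comm h.ne, H.prodBelow_L h i₀.2.le]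
    simp
  -- Only `hd` sees this index, since `i₀ ∈ T`; it contributes `E₀ ⋯ E_{i₀-1} D L (c T)`, and `D L =
  -- 1`.
  · rw [h]
    have hiE : i₀ ∉ T.eraseMin.1 := by simp [hE]
    have he : T.eraseMin.insert ⟨i₀, hiE⟩ = T := by
      refine Subtype.ext ?_
      simp [KIdx.insert, hE, Finset.insert_erase hmem]
    have hs : koszulSign T.eraseMin.1 i₀ = 1 :=
      koszulSign_of_forall_le fun j hj => T.min_le (Finset.mem_of_mem_erase hj)
    rw [dif_neg (by simpa using hmem), dif_pos hiE, he, hs, if_neg (lt_irrefl _), if_pos rfl,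
      one_smul, H.D_L]
  -- Adding `i > i₀` does not change the minimum. For `i ∉ T`, `Lᵢ` commutes with all operators of
  -- the homotopy, and the two contributions differ by a sign.
  · rw [if_neg (by simpa using h.le), if_neg h.ne', add_zero]
    by_cases hiT : i ∈ T.1
    · rw [dif_neg (by simpa using hiT), dif_neg (by simp [hE, hiT, h.ne']), add_zero]
    · have hiE : i ∉ T.eraseMin.1 := by simp [hE, hiT]
      have hm : (T.insert ⟨i, hiT⟩).min = i₀ := KIdx.min_eq _ (by simp [KIdx.insert, hmem])
        (by simpa [KIdx.insert] using ⟨h.le, fun j hj => T.min_le hj⟩)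
      have he : (T.insert ⟨i, hiT⟩).eraseMin = T.eraseMin.insert ⟨i, hiE⟩ := by
        refine Subtype.ext ?_
        simp only [KIdx.eraseMin, hm]
        simp [KIdx.insert, Finset.erase_insert_of_ne h.ne', ← hi₀]
      have hs : koszulSign T.eraseMin.1 i = - koszulSign T.1 i := koszulSign_erase hmem h
      rw [dif_pos hiT, dif_pos hiE, koszulHtpy_apply, hm, he, hs,
        H.L_prodBelow h.le, H.L_D_comm h.ne', map_zsmul, map_zsmul, neg_smul, add_neg_cancel]

end KoszulContraction

lemma prodBelow_natural {W : Type*} [AddCommGroup W] [Module R W] {E : Fin n → V →ₗ[R] V}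
    {E' : Fin n → W →ₗ[R] W} {g : V →ₗ[R] W} (h : ∀ i v, E' i (g v) = g (E i v)) (k : ℕ) (v : V) :
    prodBelow E' k (g v) = g (prodBelow E k v) := by
  induction k generalizing v with
  | zero => rfl
  | succ k ih =>
    simp only [prodBelow, LinearMap.comp_apply]
    split_ifs <;> simp [h, ih]

end

/-! ### The operators `uᵢ - tᵢ` on polynomials -/

section

variable {R : Type w} [CommRing R] {V : Type*} [AddCommGroup V] [Module R V] {n : ℕ}

/-- The operator `uᵢ - tᵢ` on `V[u₁, …, uₙ]`, where the monomials `tᵏ` act on `V` through `τ`. -/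
def polyDiff (τ : (Fin n →₀ ℕ) → V →ₗ[R] V) (i : Fin n) :
    ((Fin n →₀ ℕ) →₀ V) →ₗ[R] ((Fin n →₀ ℕ) →₀ V) :=
  Finsupp.lmapDomain V R (fun k => Finsupp.single i 1 + k) -
    Finsupp.mapRange.linearMap (τ (Finsupp.single i 1))

/-- The division by `uᵢ - tᵢ`, that is, the map
`p(u) ↦ (p(u) - p(u₁, …, u_{i-1}, tᵢ, u_{i+1}, …, uₙ)) / (uᵢ - tᵢ)`. -/
def polyDiv (τ : (Fin n →₀ ℕ) → V →ₗ[R] V) (i : Fin n) :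
    ((Fin n →₀ ℕ) →₀ V) →ₗ[R] ((Fin n →₀ ℕ) →₀ V) :=
  Finsupp.lsum R fun k => ∑ a ∈ Finset.range (k i),
    Finsupp.lsingle (k.update i a) ∘ₗ τ (Finsupp.single i (k i - 1 - a))

/-- The map `p(u) ↦ p(u₁, …, u_{i-1}, tᵢ, u_{i+1}, …, uₙ)`. -/
def polyEvalAt (τ : (Fin n →₀ ℕ) → V →ₗ[R] V) (i : Fin n) :
    ((Fin n →₀ ℕ) →₀ V) →ₗ[R] ((Fin n →₀ ℕ) →₀ V) :=
  Finsupp.lsum R fun k => Finsupp.lsingle (k.update i 0) ∘ₗ τ (Finsupp.single i (k i))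

/-- The map `V[u₁, …, uₙ] → V`, `p(u) ↦ p(t)`. -/
def polyEval (τ : (Fin n →₀ ℕ) → V →ₗ[R] V) : ((Fin n →₀ ℕ) →₀ V) →ₗ[R] V :=
  Finsupp.lsum R τ

variable (τ : (Fin n →₀ ℕ) → V →ₗ[R] V)

lemma polyDiff_single (i : Fin n) (k : Fin n →₀ ℕ) (v : V) :
    polyDiff τ i (.single k v) =
      .single (Finsupp.single i 1 + k) v - .single k (τ (Finsupp.single i 1) v) := by
  simp [polyDiff, Finsupp.mapDomain_single]

lemma polyDiv_single (i : Fin n) (k : Fin n →₀ ℕ) (v : V) :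
    polyDiv τ i (.single k v) = ∑ a ∈ Finset.range (k i),
      .single (k.update i a) (τ (Finsupp.single i (k i - 1 - a)) v) := by
  simp [polyDiv]

lemma polyEvalAt_single (i : Fin n) (k : Fin n →₀ ℕ) (v : V) :
    polyEvalAt τ i (.single k v) = .single (k.update i 0) (τ (Finsupp.single i (k i)) v) := by
  simp [polyEvalAt]

lemma polyEval_single (k : Fin n →₀ ℕ) (v : V) : polyEval τ (.single k v) = τ k v := by
  simp [polyEval]

lemma Finsupp.single_add_update_self (i : Fin n) (k : Fin n →₀ ℕ) (a : ℕ) :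
    Finsupp.single i 1 + k.update i a = k.update i (a + 1) := by
  ext j
  by_cases h : j = i
  · subst h; simp [add_comm]
  · simp [Finsupp.single_eq_of_ne h, Function.update_of_ne h]

lemma Finsupp.update_single_add_self (i : Fin n) (k : Fin n →₀ ℕ) (a : ℕ) :
    (Finsupp.single i 1 + k).update i a = k.update i a := by
  ext j
  by_cases h : j = i
  · subst h; simp
  · simp [Finsupp.single_eq_of_ne h, Function.update_of_ne h]

lemma Finsupp.single_add_update_of_ne {i j : Fin n} (h : i ≠ j) (k : Fin n →₀ ℕ) (a : ℕ) :
    (Finsupp.single i 1 + k).update j a = Finsupp.single i 1 + k.update j a := by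
  ext l
  by_cases h' : l = j
  · subst h'; simp [Finsupp.single_eq_of_ne h.symm]
  · simp [Function.update_of_ne h']

variable {τ}

lemma polyDiff_comm (hadd : ∀ k l v, τ (k + l) v = τ k (τ l v)) (i j : Fin n)
    (f : (Fin n →₀ ℕ) →₀ V) : polyDiff τ i (polyDiff τ j f) = polyDiff τ j (polyDiff τ i f) := by
  induction f using poly_induction with
  | h_zero => simp only [map_zero]
  | h_add s t hs ht => simp only [map_add, hs, ht]
  | h_single k v =>
    simp only [polyDiff_single, map_sub, ← hadd]
    rw [add_left_comm, add_comm (Finsupp.single i 1) (Finsupp.single j 1)]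
    abel

/-- On `uᵢᵐ` the division is `∑_{a < m} uᵢᵃ tᵢ^{m-1-a}`, and everything reduces to the factorization
of `uᵢᵐ - tᵢᵐ`. Operators attached to different variables commute because they change different
exponents and the powers of `t` commute on coefficients. -/
lemma polyKoszulContraction (hzero : ∀ v, τ 0 v = v) (hadd : ∀ k l v, τ (k + l) v = τ k (τ l v)) :
    KoszulContraction (polyDiff τ) (polyDiv τ) (polyEvalAt τ) where
  L_D i f := by
    induction f using poly_induction with
    | h_zero => simp only [map_zero, sub_zero]
    | h_add s t hs ht => simp only [map_add, hs, ht]; abel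
    | h_single k v =>
      -- Telescoping of `uᵢᵃ tᵢ^{kᵢ - a}`: the value at `a = kᵢ` is the given monomial, the value at
      -- `a = 0` its evaluation at `uᵢ = tᵢ`.
      have h := Finset.sum_range_sub
        (fun a => (Finsupp.single (k.update i a) (τ (Finsupp.single i (k i - a)) v) :
          (Fin n →₀ ℕ) →₀ V)) (k i)
      simp only [Finsupp.update_self, Nat.sub_self, Finsupp.single_zero, hzero, Nat.sub_zero] at h
      rw [polyDiv_single, polyEvalAt_single, map_sum, ← h]
      refine Finset.sum_congr rfl fun a ha => ?_
      have ha := Finset.mem_range.1 ha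
      rw [polyDiff_single, Finsupp.single_add_update_self, ← hadd, ← Finsupp.single_add,
        show 1 + (k i - 1 - a) = k i - a by omega, show k i - 1 - a = k i - (a + 1) by omega]
  D_L i f := by
    induction f using poly_induction with
    | h_zero => simp only [map_zero]
    | h_add s t hs ht => simp only [map_add, hs, ht]
    | h_single k v =>
      rw [polyDiff_single, map_sub, polyDiv_single, polyDiv_single]
      have hk : (Finsupp.single i 1 + k : Fin n →₀ ℕ) i = k i + 1 := by simp [add_comm]
      -- The quotient of `uᵢ^{m+1}` and `tᵢ` times the quotient of `uᵢᵐ` have the same terms for `a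
      -- < m`; only the top term `a = m` remains.
      rw [hk, Finset.sum_range_succ]
      simp only [Finsupp.update_single_add_self]
      rw [add_sub_right_comm, sub_eq_zero_of_eq (Finset.sum_congr rfl fun a ha => ?_)]
      · simp [hzero]
      · have ha := Finset.mem_range.1 ha
        rw [← hadd, ← Finsupp.single_add, show k i + 1 - 1 - a = k i - 1 - a + 1 by omega]
  L_D_comm {i j} h f := by
    induction f using poly_induction with
    | h_zero => simp only [map_zero]
    | h_add s t hs ht => simp only [map_add, hs, ht]
    | h_single k v =>
      rw [polyDiff_single, map_sub, polyDiv_single, polyDiv_single, polyDiv_single, map_sum,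
        show (Finsupp.single i 1 + k : Fin n →₀ ℕ) j = k j by simp [Finsupp.single_eq_of_ne h.symm],
        ← Finset.sum_sub_distrib]
      refine Finset.sum_congr rfl fun a _ => ?_
      rw [polyDiff_single, Finsupp.single_add_update_of_ne h, ← hadd, ← hadd,
        add_comm (Finsupp.single j _)]
  L_E_comm {i j} h f := by
    induction f using poly_induction with
    | h_zero => simp only [map_zero]
    | h_add s t hs ht => simp only [map_add, hs, ht]
    | h_single k v =>
      rw [polyDiff_single, map_sub, polyEvalAt_single, polyEvalAt_single, polyEvalAt_single,
        polyDiff_single, show (Finsupp.single i 1 + k : Fin n →₀ ℕ) j = k j by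
          simp [Finsupp.single_eq_of_ne h.symm], Finsupp.single_add_update_of_ne h, ← hadd,
        ← hadd, add_comm (Finsupp.single j _)]

lemma polyEval_polyDiff (hadd : ∀ k l v, τ (k + l) v = τ k (τ l v)) (i : Fin n)
    (f : (Fin n →₀ ℕ) →₀ V) : polyEval τ (polyDiff τ i f) = 0 := by
  induction f using poly_induction with
  | h_zero => simp only [map_zero]
  | h_add s t hs ht => simp only [map_add, hs, ht, add_zero]
  | h_single k v =>
    rw [polyDiff_single, map_sub, polyEval_single, polyEval_single, ← hadd, add_comm, sub_self]

/-- Evaluating all the variables gives the constant polynomial `p(t)`. -/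
lemma prodBelow_polyEvalAt (hzero : ∀ v, τ 0 v = v) (hadd : ∀ k l v, τ (k + l) v = τ k (τ l v))
    (f : (Fin n →₀ ℕ) →₀ V) :
    prodBelow (polyEvalAt τ) n f = .single 0 (polyEval τ f) := by
  have H := polyKoszulContraction hzero hadd
  -- Constants are fixed by every evaluation.
  have h0 : ∀ (m : ℕ) (v : V), prodBelow (polyEvalAt τ) m (.single 0 v) = .single 0 v := by
    intro m
    induction m with
    | zero => intro v; rfl
    | succ m ih =>
      intro v
      simp only [prodBelow, LinearMap.comp_apply]
      split_ifs with h
      · rw [polyEvalAt_single, Finsupp.coe_zero, Pi.zero_apply, Finsupp.single_zero, hzero,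
          show (0 : Fin n →₀ ℕ).update ⟨m, h⟩ 0 = 0 by ext j; simp, ih]
      · exact ih v
  -- The full composite kills the image of each `uᵢ - tᵢ`, so monomials in `u` may be traded for the
  -- same monomials in `t` acting on the coefficient. This avoids following exponents through the
  -- successive evaluations.
  have hk : ∀ (k l : Fin n →₀ ℕ) (v : V), prodBelow (polyEvalAt τ) n (.single (k + l) v) =
      prodBelow (polyEvalAt τ) n (.single l (τ k v)) := by
    intro k
    induction k using Finsupp.induction_linear with
    | zero => intro l v; rw [zero_add, hzero]
    | add k k' hk hk' => intro l v; rw [add_assoc, hk, hk', ← hadd, add_comm k']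
    | single i m =>
      induction m with
      | zero => intro l v; rw [Finsupp.single_zero, zero_add, hzero]
      | succ m ih =>
        intro l v
        have := H.prodBelow_L i.2 le_rfl (.single (Finsupp.single i m + l) v)
        rw [polyDiff_single, map_sub, sub_eq_zero, ← add_assoc, ← Finsupp.single_add,
          add_comm 1, ih, ← hadd, ← Finsupp.single_add] at this
        exact this
  induction f using poly_induction with
  | h_zero => simp only [map_zero, Finsupp.single_zero]
  | h_add s t hs ht => rw [map_add, map_add, hs, ht, Finsupp.single_add]
  | h_single k v => rw [polyEval_single, ← h0 n, ← hk k 0 v, add_zero]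

/-! ### Naturality in the coefficients. -/

section

variable {W : Type*} [AddCommGroup W] [Module R W] {τ' : (Fin n →₀ ℕ) → W →ₗ[R] W}
  {g : V →ₗ[R] W} (i : Fin n) (f : (Fin n →₀ ℕ) →₀ V)

lemma mapRange_linearMap_single (k : Fin n →₀ ℕ) (v : V) :
    Finsupp.mapRange.linearMap g (.single k v : (Fin n →₀ ℕ) →₀ V) = .single k (g v) := by
  simp

lemma polyDiff_natural (hg : ∀ k v, τ' k (g v) = g (τ k v)) :
    polyDiff τ' i (Finsupp.mapRange.linearMap g f) =
    Finsupp.mapRange.linearMap g (polyDiff τ i f) := by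
  induction f using poly_induction with
  | h_zero => simp only [map_zero]
  | h_add s t hs ht => simp only [map_add, hs, ht]
  | h_single k v =>
    simp only [polyDiff_single, map_sub, mapRange_linearMap_single, hg]

lemma polyDiv_natural (hg : ∀ k v, τ' k (g v) = g (τ k v)) :
    polyDiv τ' i (Finsupp.mapRange.linearMap g f) =
    Finsupp.mapRange.linearMap g (polyDiv τ i f) := by
  induction f using poly_induction with
  | h_zero => simp only [map_zero]
  | h_add s t hs ht => simp only [map_add, hs, ht]
  | h_single k v =>
    simp only [polyDiv_single, map_sum, mapRange_linearMap_single, hg]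

lemma polyEvalAt_natural (hg : ∀ k v, τ' k (g v) = g (τ k v)) :
    polyEvalAt τ' i (Finsupp.mapRange.linearMap g f) =
    Finsupp.mapRange.linearMap g (polyEvalAt τ i f) := by
  induction f using poly_induction with
  | h_zero => simp only [map_zero]
  | h_add s t hs ht => simp only [map_add, hs, ht]
  | h_single k v =>
    simp only [polyEvalAt_single, mapRange_linearMap_single, hg]

/-- Applied to `g = M(f)`, this makes the homotopy a morphism of `𝓕`. Linearity over `u` is not
available: `Dᵢ` need not commute with multiplication by `uᵢ`. -/
lemma koszulHtpy_poly_natural (hg : ∀ k v, τ' k (g v) = g (τ k v)) (p : ℕ)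
    (c : KIdx n p → (Fin n →₀ ℕ) →₀ V) (S : KIdx n (p + 1)) :
    koszulHtpy (polyDiv τ') (polyEvalAt τ') p (fun S => Finsupp.mapRange.linearMap g (c S)) S =
      Finsupp.mapRange.linearMap g (koszulHtpy (polyDiv τ) (polyEvalAt τ) p c S) := by
  rw [koszulHtpy_apply, koszulHtpy_apply, polyDiv_natural _ _ hg,
    prodBelow_natural (fun i f => polyEvalAt_natural i f hg)]

end

end

/-! ### Modules over monoids in `𝓕` -/

section

variable {R : Type w} [CommRing R] {X : Type u} [Category.{v} X] [Preadditive X] [Linear R X]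
  [MonoidalCategory X]

/-- Restriction of scalars along a morphism of monoids. -/
abbrev FMod.restrict {B C : FMonoid R X} (r : B.Hom C) (K : FMod C) : FMod B where
  toFun := K.toFun
  smul x y := K.smul x y ∘ₗ LinFun.comp r.hom x
  smul_natural f g b m := by simp [LinFun.comp_act, K.smul_natural]
  mul_smul a b m := by simp [r.map_mul, K.mul_smul]
  one_smul m := by simp [r.map_one, K.one_smul]

/-- The inclusion `A → A[t_s, s ∈ σ]`. -/
def FMonoid.const (A : FMonoid R X) (σ : Type) : A.Hom (A.poly σ) where
  hom := LinFun.homMk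
    (fun x => (Finsupp.lsingle 0 : A.toFun.val x →ₗ[R] ((σ →₀ ℕ) →₀ A.toFun.val x)))
    (fun f a => (A.toFun.poly_act_single σ f 0 a).symm)
  map_mul {x y} a b := by
    change (Finsupp.single 0 _ : (σ →₀ ℕ) →₀ A.toFun.val (x ⊗ y)) =
      polyMul σ (A.mul x y) (.single 0 a) (.single 0 b)
    rw [polyMul_single, add_zero]
  map_one := rfl

lemma FMonoid.const_apply (A : FMonoid R X) (σ : Type) (x : X) (a : A.toFun.val x) :
    LinFun.comp (A.const σ).hom x a = (Finsupp.single 0 a : (σ →₀ ℕ) →₀ A.toFun.val x) := rfl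

/-- The `A[t_s, s ∈ σ]`-module `N[t_s, s ∈ σ]`. -/
abbrev FMod.poly {A : FMonoid R X} (N : FMod A) (σ : Type) : FMod (A.poly σ) where
  toFun := N.toFun.poly σ
  smul x y := polyMul σ (N.smul x y)
  smul_natural {x x' y y'} f g p q := by
    induction p using poly_induction with
    | h_zero => simp only [map_zero, LinearMap.zero_apply]
    | h_add s t hs ht => simp only [map_add, LinearMap.add_apply, hs, ht]
    | h_single i a =>
    induction q using poly_induction with
    | h_zero => simp only [map_zero]
    | h_add s t hs ht => simp only [map_add, hs, ht]
    | h_single j b =>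
    rw [LinFun.poly_act_single, LinFun.poly_act_single, polyMul_single, polyMul_single,
      LinFun.poly_act_single, N.smul_natural]
  mul_smul {x y z} p q r := by
    induction p using poly_induction with
    | h_zero => simp only [map_zero, LinearMap.zero_apply]
    | h_add s t hs ht => simp only [map_add, LinearMap.add_apply, hs, ht]
    | h_single i a =>
    induction q using poly_induction with
    | h_zero => simp only [map_zero, LinearMap.zero_apply]
    | h_add s t hs ht => simp only [map_add, LinearMap.add_apply, hs, ht]
    | h_single j b =>
    induction r using poly_induction with
    | h_zero => simp only [map_zero]
    | h_add s t hs ht => simp only [map_add, hs, ht]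
    | h_single k c =>
    rw [polyMul_single, polyMul_single, polyMul_single, polyMul_single, LinFun.poly_act_single,
      N.mul_smul, add_assoc]
  one_smul {x} p := by
    induction p using poly_induction with
    | h_zero => simp only [map_zero]
    | h_add s t hs ht => simp only [map_add, hs, ht]
    | h_single i a => rw [polyMul_single, LinFun.poly_act_single, N.one_smul, zero_add]

/-- The power `N^ι`. -/
abbrev FMod.pi {A : FMonoid R X} (ι : Type) (N : FMod A) : FMod A where
  toFun := LinFun.of (fun x => ι → N.toFun.val x)
    (fun {x y} =>
      { toFun := fun f => LinearMap.pi fun S => N.toFun.act f ∘ₗ LinearMap.proj S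
        map_add' := fun f g => by ext; simp [LinFun.act_add]
        map_smul' := fun r f => by ext; simp [LinFun.act_smul] })
    (fun x c => by ext; simp)
    (fun f g c => by ext; simp [LinFun.act_comp])
  smul x y := piMul ι (N.smul x y)
  smul_natural f g a c := by
    funext S
    exact N.smul_natural f g a (c S)
  mul_smul a b c := by
    funext S
    exact N.mul_smul a b (c S)
  one_smul c := by
    funext S
    exact N.one_smul (c S)

/-! ### Finite powers of a module. -/

section pi

variable {A : FMonoid R X} (ι : Type) (N : FMod A)

/-- The projections of `N^ι`. -/
def FMod.piProj (s : ι) : FMod.pi ι N ⟶ N :=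
  ⟨LinFun.homMk (fun _ => LinearMap.proj s) (fun _ _ => rfl), fun _ _ _ _ => rfl⟩

variable {ι N} in
/-- The morphism to `N^ι` with given components. -/
def FMod.piLift {L : FMod A} (φ : ι → (L ⟶ N)) : L ⟶ FMod.pi ι N :=
  ⟨LinFun.homMk (fun x => LinearMap.pi fun s => LinFun.comp (φ s).1 x) (fun f a => by
    funext s
    exact LinFun.comp_act (φ s).1 f a), fun x y a m => by
    funext s
    exact (φ s).2 x y a m⟩

variable {ι N} in
@[simp] lemma FMod.piLift_proj {L : FMod A} (φ : ι → (L ⟶ N)) (s : ι) :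
    FMod.piLift φ ≫ FMod.piProj ι N s = φ s := rfl

variable {ι N} in
lemma FMod.pi_hom_ext {L : FMod A} {φ ψ : L ⟶ FMod.pi ι N}
    (h : ∀ s, φ ≫ FMod.piProj ι N s = ψ ≫ FMod.piProj ι N s) : φ = ψ := by
  apply FMod.hom_ext
  intro x a
  funext s
  exact congrArg (fun χ : L ⟶ N => LinFun.comp χ.1 x a) (h s)

open Classical in
/-- The inclusions of `N^ι`. -/
def FMod.piIncl (s : ι) : N ⟶ FMod.pi ι N :=
  FMod.piLift fun t => if s = t then 𝟙 N else 0

open Classical in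
lemma FMod.piIncl_proj (s t : ι) :
    FMod.piIncl ι N s ≫ FMod.piProj ι N t = if s = t then 𝟙 N else 0 :=
  rfl

lemma FMod.sum_proj_incl [Fintype ι] :
    ∑ s, FMod.piProj ι N s ≫ FMod.piIncl ι N s = 𝟙 (FMod.pi ι N) := by
  classical
  apply FMod.pi_hom_ext
  intro t
  rw [Preadditive.sum_comp, Category.id_comp]
  simp only [Category.assoc, FMod.piIncl_proj]
  rw [Finset.sum_eq_single t (fun s _ h => by rw [if_neg h, Limits.comp_zero]) (by simp),
    if_pos rfl, Category.comp_id]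

/-- Lift on each summand and add up along `1 = ∑ (projection, then inclusion)`. -/
lemma FMod.relProjective_pi [Fintype ι] (hN : RelProjective (FMod.forget A) N) :
    RelProjective (FMod.forget A) (FMod.pi ι N) := by
  intro L N' g hg f
  choose h hh using fun s => hN g hg (FMod.piIncl ι N s ≫ f)
  refine ⟨∑ s, FMod.piProj ι N s ≫ h s, ?_⟩
  rw [Preadditive.sum_comp]
  simp only [Category.assoc, hh]
  simp only [← Category.assoc]
  rw [← Preadditive.sum_comp, FMod.sum_proj_incl, Category.id_comp]

end pi

/-! ### Multiplication by elements of `A(𝟙)`. -/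

namespace FMod

variable {A : FMonoid R X}

/-- The map `M(x) → M(x)`, `m ↦ M(λ_x)(a × m)`, for `a ∈ A(𝟙)`. -/
def leftMul (M : FMod A) (a : A.toFun.val (𝟙_ X)) (x : X) : M.toFun.val x →ₗ[R] M.toFun.val x :=
  M.toFun.act (λ_ x).hom ∘ₗ M.smul (𝟙_ X) x a

lemma leftMul_apply (M : FMod A) (a : A.toFun.val (𝟙_ X)) (x : X) (m : M.toFun.val x) :
    M.leftMul a x m = M.toFun.act (λ_ x).hom (M.smul (𝟙_ X) x a m) := rfl

lemma leftMul_act (M : FMod A) (a : A.toFun.val (𝟙_ X)) {x y : X} (f : x ⟶ y)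
    (m : M.toFun.val x) : M.leftMul a y (M.toFun.act f m) = M.toFun.act f (M.leftMul a x m) := by
  have := M.smul_natural (𝟙 (𝟙_ X)) f a m
  rw [LinFun.act_id] at this
  rw [leftMul_apply, leftMul_apply, this, ← LinFun.act_comp, ← LinFun.act_comp]
  simp

lemma leftMul_smul (M : FMod A) (a : A.toFun.val (𝟙_ X)) {x y : X}
    (b : A.toFun.val x) (m : M.toFun.val y) :
    M.leftMul a (x ⊗ y) (M.smul x y b m) = M.smul x y (A.leftMul a x b) m := by
  have h := M.smul_natural (λ_ x).hom (𝟙 y) (A.mul _ _ a b) m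
  rw [LinFun.act_id] at h
  rw [leftMul_apply, FMonoid.leftMul_apply, h, ← M.mul_smul, ← LinFun.act_comp]
  simp

/-- This is where commutativity is needed: `b · (a · m) = (b a) · m = (a b) · m`, with unitors and
the braiding with `𝟙` absorbed by naturality. -/
lemma smul_leftMul [BraidedCategory X] [A.IsComm] (M : FMod A)
    (a : A.toFun.val (𝟙_ X)) {x y : X} (b : A.toFun.val x) (m : M.toFun.val y) :
    M.smul x y b (M.leftMul a y m) = M.leftMul a (x ⊗ y) (M.smul x y b m) := by
  have h := M.smul_natural (𝟙 x) (λ_ y).hom b (M.smul _ _ a m)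
  have h' := M.smul_natural (ρ_ x).hom (𝟙 y) (A.mul _ _ b a) m
  rw [LinFun.act_id] at h h'
  rw [leftMul_smul, leftMul_apply, h, ← M.mul_smul, ← LinFun.act_comp, FMonoid.leftMul_apply,
    ← FMonoid.IsComm.comm b a, ← LinFun.act_comp, braiding_leftUnitor, h']
  simp

lemma leftMul_leftMul (M : FMod A) (a b : A.toFun.val (𝟙_ X)) {x : X} (m : M.toFun.val x) :
    M.leftMul a x (M.leftMul b x m) = M.leftMul (A.leftMul a (𝟙_ X) b) x m := by
  rw [leftMul_apply M b, leftMul_act, leftMul_smul]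
  rfl

lemma hom_leftMul {M N : FMod A} (φ : M ⟶ N) (a : A.toFun.val (𝟙_ X)) {x : X}
    (m : M.toFun.val x) :
    LinFun.comp φ.1 x (M.leftMul a x m) = N.leftMul a x (LinFun.comp φ.1 x m) := by
  rw [leftMul_apply, leftMul_apply, LinFun.comp_act, φ.2]

end FMod

/-- The monomial `tᵏ`, an element of `A[t_s, s ∈ σ](𝟙)`. -/
def FMonoid.mono (A : FMonoid R X) {σ : Type} (k : σ →₀ ℕ) : (A.poly σ).toFun.val (𝟙_ X) :=
  (Finsupp.single k A.one : (σ →₀ ℕ) →₀ A.toFun.val (𝟙_ X))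

lemma FMod.poly_leftMul_mono {A : FMonoid R X} (N : FMod A) {σ : Type} (k l : σ →₀ ℕ) (x : X)
    (m : N.toFun.val x) :
    (N.poly σ).leftMul (A.mono k) x (Finsupp.single l m : (σ →₀ ℕ) →₀ N.toFun.val x) =
      (Finsupp.single (k + l) m : (σ →₀ ℕ) →₀ N.toFun.val x) := by
  rw [FMod.leftMul_apply]
  change (N.toFun.poly σ).act _ (polyMul σ (N.smul _ _) (.single k A.one) (.single l m)) = _
  rw [polyMul_single, LinFun.poly_act_single, N.one_smul]

lemma FMonoid.leftMul_mono (A : FMonoid R X) {σ : Type} (k l : σ →₀ ℕ) (x : X)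
    (a : A.toFun.val x) :
    (A.poly σ).leftMul (A.mono k) x (Finsupp.single l a : (σ →₀ ℕ) →₀ A.toFun.val x) =
      (Finsupp.single (k + l) a : (σ →₀ ℕ) →₀ A.toFun.val x) :=
  FMod.poly_leftMul_mono A.self k l x a

lemma FMod.mono_zero {A : FMonoid R X} {σ : Type} (M : FMod (A.poly σ)) {x : X}
    (m : M.toFun.val x) : M.leftMul (A.mono 0) x m = m :=
  M.one_smul m

/-- Together with `FMod.mono_zero`, this provides the action `τ` of exponents on coefficients
required by `polyKoszulContraction`. -/
lemma FMod.mono_add {A : FMonoid R X} {σ : Type} (M : FMod (A.poly σ)) (k l : σ →₀ ℕ) {x : X}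
    (m : M.toFun.val x) :
    M.leftMul (A.mono (k + l)) x m = M.leftMul (A.mono k) x (M.leftMul (A.mono l) x m) := by
  rw [FMod.leftMul_leftMul]
  congr 2
  exact (A.leftMul_mono k l _ A.one).symm

/-- The morphism of `A[t]`-modules `N[t] → L` extending a morphism of `A`-modules `N → L`. -/
def FMod.polyLift [BraidedCategory X] {A : FMonoid R X} [A.IsComm] {N : FMod A} {σ : Type}
    {L : FMod (A.poly σ)} (φ : N ⟶ L.restrict (A.const σ)) : N.poly σ ⟶ L :=
  ⟨LinFun.homMk (fun x => (Finsupp.lsum R fun k => L.leftMul (A.mono k) x ∘ₗ LinFun.comp φ.1 x :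
      ((σ →₀ ℕ) →₀ N.toFun.val x) →ₗ[R] L.toFun.val x)) (fun {x y} f p => by
      induction p using poly_induction with
      | h_zero => simp only [map_zero]
      | h_add s t hs ht => simp only [map_add, hs, ht]
      | h_single k m =>
        rw [LinFun.poly_act_single, Finsupp.lsum_single, Finsupp.lsum_single,
          LinearMap.comp_apply, LinearMap.comp_apply, LinFun.comp_act, FMod.leftMul_act]),
    fun x y b p => by
      rw [LinFun.comp_homMk, LinFun.comp_homMk]
      induction p using poly_induction with
      | h_zero => simp only [map_zero]
      | h_add s t hs ht => simp only [map_add, hs, ht]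
      | h_single k m =>
      induction b using poly_induction with
      | h_zero => simp only [map_zero, LinearMap.zero_apply]
      | h_add s t hs ht => simp only [map_add, LinearMap.add_apply, hs, ht]
      | h_single i a =>
        rw [polyMul_single, Finsupp.lsum_single, Finsupp.lsum_single, LinearMap.comp_apply,
          LinearMap.comp_apply, φ.2, LinearMap.comp_apply, FMonoid.const_apply,
          FMod.leftMul_smul, FMonoid.leftMul_mono, FMod.smul_leftMul, FMod.leftMul_smul,
          FMonoid.leftMul_mono, add_zero, add_comm]⟩

lemma FMod.polyLift_single [BraidedCategory X] {A : FMonoid R X} [A.IsComm] {N : FMod A} {σ : Type}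
    {L : FMod (A.poly σ)} (φ : N ⟶ L.restrict (A.const σ)) (x : X) (k : σ →₀ ℕ)
    (m : N.toFun.val x) :
    LinFun.comp (FMod.polyLift φ).1 x (Finsupp.single k m : (σ →₀ ℕ) →₀ N.toFun.val x) =
      L.leftMul (A.mono k) x (LinFun.comp φ.1 x m) := by
  change Finsupp.lsum R _ (Finsupp.single k m) = _
  rw [Finsupp.lsum_single]
  rfl

/-- Each monomial is `tᵏ` times a constant, and morphisms of modules commute with multiplication by
`tᵏ`. -/
lemma FMod.poly_hom_ext {A : FMonoid R X} {N : FMod A} {σ : Type} {L : FMod (A.poly σ)}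
    {φ ψ : N.poly σ ⟶ L}
    (h : ∀ (x : X) (m : N.toFun.val x),
      LinFun.comp φ.1 x (Finsupp.single 0 m : (σ →₀ ℕ) →₀ N.toFun.val x) =
        LinFun.comp ψ.1 x (Finsupp.single 0 m : (σ →₀ ℕ) →₀ N.toFun.val x)) : φ = ψ := by
  apply FMod.hom_ext
  intro x p
  induction p using poly_induction with
  | h_zero => simp only [map_zero]
  | h_add s t hs ht => simp only [map_add, hs, ht]
  | h_single k m =>
    have := N.poly_leftMul_mono k 0 x m
    rw [add_zero] at this
    rw [← this, FMod.hom_leftMul, FMod.hom_leftMul, h]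

end

/-! ### Modules over tensor idempotent monoids -/

section

variable {R : Type w} [CommRing R] {X : Type u} [Category.{v} X] [Preadditive X] [Linear R X]
  [MonoidalCategory X] [MonoidalPreadditive X] [MonoidalLinear R X] [EssentiallySmall.{w} X]
  {A : FMonoid R X}

/-- The map `(A ⊗ A)(z) → N(z ⊗ y)`, `[f, a, b] ↦ N(f ⊗ y)(a · φ(b · m))`. -/
def FMod.sandwich {M N : FMod A} (φ : M.toFun ⟶ N.toFun) {y : X} (m : M.toFun.val y) (z : X) :
    DayVal A.toFun A.toFun z →ₗ[R] N.toFun.val (z ⊗ y) :=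
  DayVal.lift
    (fun x₁ x₂ => N.toFun.actMul ((N.smul x₁ (x₂ ⊗ y)).compl₂
        (LinFun.comp φ (x₂ ⊗ y) ∘ₗ (M.smul x₂ y).flip m)) ∘ₗ
      { toFun := fun f => (α_ x₁ x₂ y).inv ≫ f ▷ y
        map_add' := fun f g => by simp
        map_smul' := fun r f => by simp })
    (fun x x' y₁ y₁' p q f a b => by
      have h := M.smul_natural q (𝟙 y) b m
      have h' := N.smul_natural p (q ⊗ₘ 𝟙 y) a (LinFun.comp φ _ (M.smul y₁ y b m))
      rw [LinFun.act_id] at h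
      simp only [LinearMap.comp_apply, LinearMap.coe_mk, AddHom.coe_mk, LinFun.actMul_apply,
        LinearMap.compl₂_apply, LinearMap.flip_apply]
      rw [h, LinFun.comp_act, h', ← LinFun.act_comp]
      congr 2
      simp [MonoidalCategory.tensorHom_def])

/-- The value `a · φ(b · m)` depends only on the class of `a ⊗ b`, so an equality in `A ⊗ A` turns
into a statement on `φ`. -/
lemma FMod.sandwich_mk {M N : FMod A} (φ : M.toFun ⟶ N.toFun) {y : X} (m : M.toFun.val y)
    {x₁ x₂ z : X} (f : x₁ ⊗ x₂ ⟶ z) (a : A.toFun.val x₁) (b : A.toFun.val x₂) :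
    FMod.sandwich φ m z (DayVal.mk _ _ x₁ x₂ z f a b) = N.toFun.act ((α_ x₁ x₂ y).inv ≫ f ▷ y)
      (N.smul x₁ (x₂ ⊗ y) a (LinFun.comp φ (x₂ ⊗ y) (M.smul x₂ y b m))) := by
  rw [sandwich, DayVal.lift_mk]
  rfl

/-- Over a tensor idempotent monoid, every morphism of `𝓕` between modules is linear. -/
lemma FMonoid.IsTensorIdempotent.mem_homs (hA : A.IsTensorIdempotent) {M N : FMod A}
    (φ : M.toFun ⟶ N.toFun) : φ ∈ FMod.homs M N := by
  intro x y a m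
  have : IsIso A.mulHom := hA
  have hinj : Function.Injective (A.mulVal x) := by
    refine Function.LeftInverse.injective (g := LinFun.comp (inv A.mulHom) x) fun t => ?_
    change LinFun.comp (inv A.mulHom) x (LinFun.comp A.mulHom x t) = t
    rw [← LinFun.comp_comp, IsIso.hom_inv_id]
    rfl
  -- `a ⊗ 1 = 1 ⊗ a`, since both have product `a` and `μ_A` is injective.
  have h : DayVal.mk A.toFun A.toFun x (𝟙_ X) x (ρ_ x).hom a A.one =
      DayVal.mk A.toFun A.toFun (𝟙_ X) x x (λ_ x).hom A.one a := by
    apply hinj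
    rw [A.mulVal_mk, A.mulVal_mk, A.mul_one, A.one_mul]
  -- Up to unit constraints, this reads `a · φ(1 · m) = 1 · φ(a · m)`, the linearity of `φ`. The
  -- remaining steps remove the units.
  have h' := congrArg (FMod.sandwich φ m x) h
  have h1 : M.smul (𝟙_ X) y A.one m = M.toFun.act (λ_ y).inv m := by
    conv_rhs => rw [← M.one_smul m]
    rw [← LinFun.act_comp, Iso.hom_inv_id, LinFun.act_id]
  have h2 := N.smul_natural (𝟙 x) (λ_ y).inv a (LinFun.comp φ y m)
  rw [LinFun.act_id] at h2
  rw [FMod.sandwich_mk, FMod.sandwich_mk, h1, LinFun.comp_act, h2, ← LinFun.act_comp] at h'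
  have h3 : (𝟙 x ⊗ₘ (λ_ y).inv) ≫ (α_ x (𝟙_ X) y).inv ≫ (ρ_ x).hom ▷ y = 𝟙 _ := by simp
  have h4 : (α_ (𝟙_ X) x y).inv ≫ (λ_ x).hom ▷ y = (λ_ (x ⊗ y)).hom := by simp
  rw [h3, h4, LinFun.act_id, N.one_smul] at h'
  exact h'.symm

/-! ### Relative projectivity -/

/-- A morphism from `N[t]` is determined by its restriction to the constants `N`. Following that
restriction by a section in `𝓕` gives a map `N → L` of `𝓕`, which idempotence makes `A`-linear, and
which then extends to `N[t]`. -/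
lemma FMod.relProjective_poly [BraidedCategory X] [A.IsComm] (hA : A.IsTensorIdempotent)
    (N : FMod A) (σ : Type) : RelProjective (FMod.forget (A.poly σ)) (N.poly σ) := by
  intro L N' g hg f
  obtain ⟨⟨s, hs⟩⟩ := hg.exists_splitEpi
  let η : N.toFun ⟶ (N.poly σ).toFun := LinFun.homMk
    (fun x => (Finsupp.lsingle 0 : N.toFun.val x →ₗ[R] ((σ →₀ ℕ) →₀ N.toFun.val x)))
    (fun f a => (N.toFun.poly_act_single σ f 0 a).symm)
  let ψ : N.toFun ⟶ (L.restrict (A.const σ)).toFun := η ≫ f.1 ≫ s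
  refine ⟨FMod.polyLift (L := L) ⟨ψ, hA.mem_homs ψ⟩, ?_⟩
  apply FMod.poly_hom_ext
  intro x m
  change LinFun.comp g.1 x (LinFun.comp (FMod.polyLift _).1 x _) = _
  -- Agreement with `f` is needed only on constants, where the lift is `f` followed by the section
  -- `s`.
  rw [FMod.polyLift_single, FMod.mono_zero]
  exact congrArg (fun χ => LinFun.comp χ x (LinFun.comp f.1 x
    (Finsupp.single 0 m : (σ →₀ ℕ) →₀ N.toFun.val x))) hs

end

/-! ### Exactness of complexes of modules -/

section

/-- The factorization of `ψ` through the range of `φ`. -/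
def rangeLift {R U V W : Type*} [Ring R] [AddCommGroup U] [Module R U] [AddCommGroup V]
    [Module R V] [AddCommGroup W] [Module R W] (φ : U →ₗ[R] V) (ψ : U →ₗ[R] W)
    (h : ∀ u, φ u = 0 → ψ u = 0) : LinearMap.range φ →ₗ[R] W :=
  (LinearMap.ker φ).liftQ ψ (fun u hu => h u hu) ∘ₗ φ.quotKerEquivRange.symm.toLinearMap

lemma rangeLift_apply {R U V W : Type*} [Ring R] [AddCommGroup U] [Module R U] [AddCommGroup V]
    [Module R V] [AddCommGroup W] [Module R W] (φ : U →ₗ[R] V) (ψ : U →ₗ[R] W)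
    (h : ∀ u, φ u = 0 → ψ u = 0) (u : U) : rangeLift φ ψ h ⟨φ u, u, rfl⟩ = ψ u := by
  have : φ.quotKerEquivRange.symm ⟨φ u, u, rfl⟩ = Submodule.Quotient.mk u := by
    rw [LinearEquiv.symm_apply_eq]
    rfl
  rw [rangeLift, LinearMap.comp_apply, LinearEquiv.coe_coe, this]
  rfl

variable {R : Type w} [CommRing R] {X : Type u} [Category.{v} X] [Preadditive X] [Linear R X]
  [MonoidalCategory X] {A : FMonoid R X}

/-- The submodule of `M` given by stable submodules of the `M(x)`. -/
abbrev FMod.sub (M : FMod A) (V : ∀ x, Submodule R (M.toFun.val x))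
    (hact : ∀ {x y : X} (f : x ⟶ y), ∀ m ∈ V x, M.toFun.act f m ∈ V y)
    (hsmul : ∀ {x y : X} (a : A.toFun.val x), ∀ m ∈ V y, M.smul x y a m ∈ V (x ⊗ y)) :
    FMod A where
  toFun := LinFun.of (fun x => V x)
    (fun {x y} =>
      { toFun := fun f => (M.toFun.act f).restrict (hact f)
        map_add' := fun f g => by
          ext m
          exact LinearMap.congr_fun (M.toFun.act_add f g) m.1
        map_smul' := fun r f => by
          ext m
          exact LinearMap.congr_fun (M.toFun.act_smul r f) m.1 })
    (fun x m => Subtype.ext (M.toFun.act_id x m.1))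
    (fun f g m => Subtype.ext (M.toFun.act_comp f g m.1))
  smul x y := LinearMap.mk₂ R (fun a m => ⟨M.smul x y a m.1, hsmul a m.1 m.2⟩)
    (fun a a' m => Subtype.ext (LinearMap.map_add₂ (M.smul x y) a a' m.1))
    (fun r a m => Subtype.ext (LinearMap.map_smul₂ (M.smul x y) r a m.1))
    (fun a m m' => Subtype.ext (map_add (M.smul x y a) m.1 m'.1))
    (fun r a m => Subtype.ext (map_smul (M.smul x y a) r m.1))
  smul_natural f g a m := Subtype.ext (M.smul_natural f g a m.1)
  mul_smul a b m := Subtype.ext (M.mul_smul a b m.1)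
  one_smul m := Subtype.ext (M.one_smul m.1)

/-- The kernel of a morphism of modules. -/
abbrev FMod.ker {M N : FMod A} (φ : M ⟶ N) : FMod A :=
  M.sub (fun x => LinearMap.ker (LinFun.comp φ.1 x))
    (fun f m hm => by
      rw [LinearMap.mem_ker] at hm ⊢
      rw [LinFun.comp_act, hm, map_zero])
    (fun a m hm => by
      rw [LinearMap.mem_ker] at hm ⊢
      rw [φ.2, hm, map_zero])

/-- The image of a morphism of modules. -/
abbrev FMod.range {M N : FMod A} (φ : M ⟶ N) : FMod A :=
  N.sub (fun x => LinearMap.range (LinFun.comp φ.1 x))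
    (fun f m hm => by
      obtain ⟨k, rfl⟩ := hm
      exact ⟨_, LinFun.comp_act φ.1 f k⟩)
    (fun a m hm => by
      obtain ⟨k, rfl⟩ := hm
      exact ⟨_, φ.2 _ _ a k⟩)

/-- The inclusion of the kernel. -/
def FMod.kerι {M N : FMod A} (φ : M ⟶ N) : FMod.ker φ ⟶ M :=
  ⟨LinFun.homMk (fun _ => Submodule.subtype _) (fun _ _ => rfl), fun _ _ _ _ => rfl⟩

/-- The inclusion of the image. -/
def FMod.rangeι {M N : FMod A} (φ : M ⟶ N) : FMod.range φ ⟶ N :=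
  ⟨LinFun.homMk (fun _ => Submodule.subtype _) (fun _ _ => rfl), fun _ _ _ _ => rfl⟩

/-- The corestriction of a morphism to its image. -/
def FMod.toRange {M N : FMod A} (φ : M ⟶ N) : M ⟶ FMod.range φ :=
  ⟨LinFun.homMk (fun x => (LinFun.comp φ.1 x).rangeRestrict)
    (fun f m => Subtype.ext (LinFun.comp_act φ.1 f m)), fun x y a m => Subtype.ext (φ.2 x y a m)⟩

lemma FMod.mono_of_injective {M N : FMod A} (φ : M ⟶ N)
    (h : ∀ x, Function.Injective (LinFun.comp φ.1 x)) : Mono φ where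
  right_cancellation g g' hg := by
    apply FMod.hom_ext
    intro x m
    exact h x (congrArg (fun χ => LinFun.comp χ.1 x m) hg)

lemma FMod.epi_of_surjective {M N : FMod A} (φ : M ⟶ N)
    (h : ∀ x, Function.Surjective (LinFun.comp φ.1 x)) : Epi φ where
  left_cancellation g g' hg := by
    apply FMod.hom_ext
    intro x m
    obtain ⟨m, rfl⟩ := h x m
    exact congrArg (fun χ => LinFun.comp χ.1 x m) hg

lemma FMod.comp_eq_zero {M N P : FMod A} {φ : M ⟶ N} {ψ : N ⟶ P} (h : φ ≫ ψ = 0) (x : X)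
    (m : M.toFun.val x) : LinFun.comp ψ.1 x (LinFun.comp φ.1 x m) = 0 :=
  congrArg (fun χ => LinFun.comp χ.1 x m) h

/-- The factorization through the kernel. -/
def FMod.kerLift {M N P : FMod A} (φ : M ⟶ N) (ψ : P ⟶ M) (h : ψ ≫ φ = 0) : P ⟶ FMod.ker φ :=
  ⟨LinFun.homMk (fun x => (LinFun.comp ψ.1 x).codRestrict _ (FMod.comp_eq_zero h x))
    (fun f m => Subtype.ext (LinFun.comp_act ψ.1 f m)), fun x y a m => Subtype.ext (ψ.2 x y a m)⟩

/-- The factorization through the image. -/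
def FMod.rangeDesc {M N P : FMod A} (φ : M ⟶ N) (ψ : M ⟶ P)
    (h : ∀ x m, LinFun.comp φ.1 x m = 0 → LinFun.comp ψ.1 x m = 0) : FMod.range φ ⟶ P :=
  let θ (x : X) : (FMod.range φ).toFun.val x →ₗ[R] P.toFun.val x :=
    rangeLift (LinFun.comp φ.1 x) (LinFun.comp ψ.1 x) (h x)
  have hθ (x : X) (m : M.toFun.val x) : θ x ⟨LinFun.comp φ.1 x m, m, rfl⟩ =
      LinFun.comp ψ.1 x m := rangeLift_apply _ _ (h x) m
  ⟨LinFun.homMk θ (fun {x y} f m => by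
      obtain ⟨_, m, rfl⟩ := m
      refine Eq.trans ?_ ((hθ y (M.toFun.act f m)).trans ?_)
      · exact congrArg (θ y) (Subtype.ext (LinFun.comp_act φ.1 f m).symm)
      · rw [hθ, LinFun.comp_act]),
    fun x y a m => by
      obtain ⟨_, m, rfl⟩ := m
      refine Eq.trans ?_ ((hθ (x ⊗ y) (M.smul x y a m)).trans ?_)
      · exact congrArg (θ (x ⊗ y)) (Subtype.ext (φ.2 x y a m).symm)
      · rw [LinFun.comp_homMk, hθ, ψ.2]⟩

lemma FMod.toRange_rangeDesc {M N P : FMod A} (φ : M ⟶ N) (ψ : M ⟶ P)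
    (h : ∀ x m, LinFun.comp φ.1 x m = 0 → LinFun.comp ψ.1 x m = 0) :
    FMod.toRange φ ≫ FMod.rangeDesc φ ψ h = ψ := by
  apply FMod.hom_ext
  intro x m
  exact rangeLift_apply _ _ (h x) m

variable (A) in
/-- The zero module. -/
abbrev FMod.zero : FMod A := FMod.pi PEmpty A.self

lemma FMod.isZero_pi {ι : Type} [IsEmpty ι] (N : FMod A) : Limits.IsZero (FMod.pi ι N) := by
  rw [Limits.IsZero.iff_id_eq_zero]
  exact FMod.pi_hom_ext fun s => isEmptyElim s

/-- A short complex of modules which is exact at every object of `X` is exact. -/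
lemma FMod.exact_of_pointwise (S : ShortComplex (FMod A))
    (h : ∀ (x : X) (m : S.X₂.toFun.val x), LinFun.comp S.g.1 x m = 0 →
      ∃ k, LinFun.comp S.f.1 x k = m) : S.Exact := by
  have hz := FMod.isZero_pi (ι := PEmpty) A.self
  have hmono : Mono (FMod.kerι S.g) := FMod.mono_of_injective _ fun x => Subtype.val_injective
  have hmono' : Mono (FMod.rangeι S.g) := FMod.mono_of_injective _ fun x => Subtype.val_injective
  have hepi : Epi (FMod.toRange S.g) := FMod.epi_of_surjective _ fun x =>
    (LinFun.comp S.g.1 x).surjective_rangeRestrict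
  have hepi' : Epi (FMod.kerLift S.g S.f S.zero) := FMod.epi_of_surjective _ fun x m => by
    obtain ⟨k, hk⟩ := h x m.1 m.2
    exact ⟨k, Subtype.ext hk⟩
  have wi : FMod.kerι S.g ≫ S.g = 0 := FMod.hom_ext fun x m => m.2
  have wp : S.f ≫ FMod.toRange S.g = 0 :=
    FMod.hom_ext fun x m => Subtype.ext (FMod.comp_eq_zero S.zero x m)
  let hi : Limits.IsLimit (Limits.KernelFork.ofι (FMod.kerι S.g) wi) :=
    Limits.KernelFork.IsLimit.ofι' _ _ fun k hk => ⟨FMod.kerLift S.g k hk, rfl⟩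
  -- The image of `g` is the cokernel of `f`: by pointwise exactness, a morphism that kills `f`
  -- kills the kernel of `g`.
  let hp : Limits.IsColimit (Limits.CokernelCofork.ofπ (FMod.toRange S.g) wp) :=
    Limits.CokernelCofork.IsColimit.ofπ' _ _ fun k hk =>
      ⟨FMod.rangeDesc S.g k (fun x m hm => by
        obtain ⟨l, rfl⟩ := h x m hm
        exact FMod.comp_eq_zero hk x l), FMod.toRange_rangeDesc _ _ _⟩
  -- Left homology is zero because `f` maps onto the kernel of `g`, so its corestriction has zero
  -- cokernel.
  let Lh : S.LeftHomologyData :=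
    { K := FMod.ker S.g
      H := FMod.zero A
      i := FMod.kerι S.g
      π := 0
      wi := wi
      hi := hi
      wπ := Limits.comp_zero
      hπ := Limits.CokernelCofork.IsColimit.ofπ _ _ (fun _ _ => 0)
        (fun k hk => by
          have : FMod.kerLift S.g S.f S.zero ≫ k = 0 := hk
          rw [Limits.comp_zero, ← cancel_epi (FMod.kerLift S.g S.f S.zero), this,
            Limits.comp_zero])
        (fun k hk m hm => hz.eq_of_src _ _) }
  -- Right homology is zero because the map from the cokernel of `f` induced by `g` is the inclusion
  -- of the image, a monomorphism.
  let Rh : S.RightHomologyData :=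
    { Q := FMod.range S.g
      H := FMod.zero A
      p := FMod.toRange S.g
      ι := 0
      wp := wp
      hp := hp
      wι := Limits.zero_comp
      hι := Limits.KernelFork.IsLimit.ofι _ _ (fun _ _ => 0)
        (fun k hk => by
          have h' : hp.desc (Limits.CokernelCofork.ofπ S.g S.zero) = FMod.rangeι S.g := by
            rw [← cancel_epi (FMod.toRange S.g)]
            exact hp.fac (Limits.CokernelCofork.ofπ S.g S.zero) .one
          have : k ≫ FMod.rangeι S.g = 0 := by
            rw [← h']
            exact hk
          rw [Limits.zero_comp, ← cancel_mono (FMod.rangeι S.g), this, Limits.zero_comp])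
        (fun k hk m hm => hz.eq_of_tgt _ _) }
  have hw : FMod.kerι S.g ≫ FMod.toRange S.g = 0 := FMod.hom_ext fun x m => Subtype.ext m.2
  exact ⟨⟨{ left := Lh, right := Rh, iso := Iso.refl _, comm := by simp [Lh, Rh, hw] }, hz⟩⟩

end

/-! ### Koszul complexes of endomorphisms -/

section

variable {R : Type w} [CommRing R] {X : Type u} [Category.{v} X] [Preadditive X] [Linear R X]
  [MonoidalCategory X] {A : FMonoid R X}

/-- The evaluation of morphisms of modules at an element, as an additive map. -/
def FMod.evalAt (M N : FMod A) (x : X) (m : M.toFun.val x) : (M ⟶ N) →+ N.toFun.val x where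
  toFun φ := LinFun.comp φ.1 x m
  map_zero' := rfl
  map_add' _ _ := rfl

/-- A morphism of modules which is bijective at every object is an isomorphism. -/
lemma FMod.isIso_of_bijective {M N : FMod A} (φ : M ⟶ N)
    (h : ∀ x, Function.Bijective (LinFun.comp φ.1 x)) : IsIso φ := by
  let e (x : X) : M.toFun.val x ≃ₗ[R] N.toFun.val x := LinearEquiv.ofBijective _ (h x)
  have he (x : X) (m : M.toFun.val x) : (e x).symm (LinFun.comp φ.1 x m) = m :=
    (e x).symm_apply_apply m
  have he_inv (x : X) (m : N.toFun.val x) : LinFun.comp φ.1 x ((e x).symm m) = m :=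
    (e x).apply_symm_apply m
  let ψ : N ⟶ M := ⟨LinFun.homMk (fun x => (e x).symm.toLinearMap) (fun {x y} f m => by
      apply (h y).1
      rw [LinFun.comp_act]
      exact (he_inv _ _).trans (congrArg (N.toFun.act f) (he_inv x m)).symm), fun x y a m => by
      apply (h (x ⊗ y)).1
      rw [φ.2]
      exact (he_inv _ _).trans (congrArg (N.smul x y a) (he_inv y m)).symm⟩
  exact ⟨ψ, FMod.hom_ext he, FMod.hom_ext he_inv⟩

/-- The differential of the Koszul complex of endomorphisms `ℓ₁, …, ℓₙ` of a module. -/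
def FMod.koszulHom {N : FMod A} {n : ℕ} (ℓ : Fin n → (N ⟶ N)) (p : ℕ) :
    FMod.pi (KIdx n (p + 1)) N ⟶ FMod.pi (KIdx n p) N :=
  FMod.piLift fun T => ∑ i : {i // i ∉ T.1},
    koszulSign T.1 i.1 • (FMod.piProj (KIdx n (p + 1)) N (T.insert i) ≫ ℓ i.1)

lemma FMod.koszulHom_apply {N : FMod A} {n : ℕ} (ℓ : Fin n → (N ⟶ N)) (p : ℕ) (x : X)
    (c : KIdx n (p + 1) → N.toFun.val x) :
    LinFun.comp (FMod.koszulHom ℓ p).1 x c = koszulMap (fun i => LinFun.comp (ℓ i).1 x) p c := by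
  funext T
  change FMod.evalAt (FMod.pi (KIdx n (p + 1)) N) N x c (∑ i : {i // i ∉ T.1},
    koszulSign T.1 i.1 • (FMod.piProj (KIdx n (p + 1)) N (T.insert i) ≫ ℓ i.1)) = _
  rw [map_sum, koszulMap_apply]
  refine Finset.sum_congr rfl fun i _ => ?_
  rw [map_zsmul]
  rfl

/-- The Koszul complex of commuting endomorphisms `ℓ₁, …, ℓₙ` of a module. -/
def FMod.koszul {N : FMod A} {n : ℕ} (ℓ : Fin n → (N ⟶ N))
    (hℓ : ∀ i j, ℓ i ≫ ℓ j = ℓ j ≫ ℓ i) : ChainComplex (FMod A) ℕ :=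
  ChainComplex.of (fun p => FMod.pi (KIdx n p) N) (FMod.koszulHom ℓ) (fun p => by
    apply FMod.hom_ext
    intro x c
    change LinFun.comp (FMod.koszulHom ℓ p).1 x (LinFun.comp (FMod.koszulHom ℓ (p + 1)).1 x c) = _
    rw [FMod.koszulHom_apply, FMod.koszulHom_apply]
    exact koszulMap_comp _
      (fun i j v => congrArg (FMod.evalAt N N x v) (hℓ j i)) p c)

lemma FMod.koszul_d {N : FMod A} {n : ℕ} (ℓ : Fin n → (N ⟶ N))
    (hℓ : ∀ i j, ℓ i ≫ ℓ j = ℓ j ≫ ℓ i) (p : ℕ) :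
    (FMod.koszul ℓ hℓ).d (p + 1) p = FMod.koszulHom ℓ p :=
  ChainComplex.of_d (fun p => FMod.pi (KIdx n p) N) (FMod.koszulHom ℓ) p

/-! ### Koszul complexes under additive functors. -/

section

variable {C : FMonoid R X} (F : FMod C ⥤ FMod A) [F.Additive] {N : FMod C} {P : FMod A}
  (e : F.obj N ≅ P)

/-- Additive functors preserve finite powers. -/
def FMod.mapPiIso (ι : Type) [Fintype ι] : F.obj (FMod.pi ι N) ≅ FMod.pi ι P where
  hom := FMod.piLift fun s => F.map (FMod.piProj ι N s) ≫ e.hom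
  inv := ∑ s, FMod.piProj ι P s ≫ e.inv ≫ F.map (FMod.piIncl ι N s)
  hom_inv_id := by
    rw [Preadditive.comp_sum]
    simp only [← Category.assoc, FMod.piLift_proj]
    simp only [Category.assoc, Iso.hom_inv_id_assoc, ← F.map_comp]
    rw [← Functor.map_sum, FMod.sum_proj_incl, F.map_id]
  inv_hom_id := by
    classical
    apply FMod.pi_hom_ext
    intro t
    rw [Category.assoc, FMod.piLift_proj, Preadditive.sum_comp, Category.id_comp]
    have : ∀ s, (FMod.piProj ι P s ≫ e.inv ≫ F.map (FMod.piIncl ι N s)) ≫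
        F.map (FMod.piProj ι N t) ≫ e.hom = if s = t then FMod.piProj ι P t else 0 := by
      intro s
      simp only [Category.assoc]
      rw [← F.map_comp_assoc, FMod.piIncl_proj]
      split_ifs with h
      · subst h
        simp
      · simp
    simp [this]

lemma FMod.mapPiIso_hom_proj (ι : Type) [Fintype ι] (s : ι) :
    (FMod.mapPiIso F e ι).hom ≫ FMod.piProj ι P s = F.map (FMod.piProj ι N s) ≫ e.hom := rfl

/-- The differential is an integral combination of projections followed by the `ℓᵢ`, a shape that
additive functors preserve. -/
lemma FMod.mapPiIso_koszulHom {n : ℕ} (ℓ : Fin n → (N ⟶ N)) (ℓ' : Fin n → (P ⟶ P))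
    (h : ∀ i, F.map (ℓ i) ≫ e.hom = e.hom ≫ ℓ' i) (p : ℕ) :
    (FMod.mapPiIso F e (KIdx n (p + 1))).hom ≫ FMod.koszulHom ℓ' p =
      F.map (FMod.koszulHom ℓ p) ≫ (FMod.mapPiIso F e (KIdx n p)).hom := by
  apply FMod.pi_hom_ext
  intro T
  rw [Category.assoc, Category.assoc, FMod.mapPiIso_hom_proj, ← F.map_comp_assoc]
  simp only [FMod.koszulHom, FMod.piLift_proj, Functor.map_sum, Functor.map_zsmul,
    Functor.map_comp, Preadditive.comp_sum, Preadditive.sum_comp, Preadditive.comp_zsmul,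
    Preadditive.zsmul_comp, Category.assoc, h]
  refine Finset.sum_congr rfl fun i _ => ?_
  rw [← Category.assoc, FMod.mapPiIso_hom_proj, Category.assoc]

end

/-- The multiplication by an element of `C(𝟙)`, as an endomorphism of the module `C`. -/
def FMonoid.leftMulHom [BraidedCategory X] (C : FMonoid R X) [C.IsComm]
    (a : C.toFun.val (𝟙_ X)) : C.self ⟶ C.self :=
  ⟨LinFun.homMk (C.leftMul a) (fun f b => C.leftMul_act a f b),
    fun _ _ b c => (C.mul_leftMul a b c).symm⟩

/-- Puts the differential of `K_C(α)` in a form built from morphisms of modules, to which `-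
⊗_{A[t]} M` can be applied. -/
lemma koszulD_eq_koszulHom [BraidedCategory X] (C : FMonoid R X) [C.IsComm] {n : ℕ}
    (α : Fin n → C.toFun.val (𝟙_ X)) (p : ℕ) :
    koszulD C α p = FMod.koszulHom (fun i => C.leftMulHom (α i)) p := by
  apply FMod.hom_ext
  intro x c
  exact (FMod.koszulHom_apply (fun i => C.leftMulHom (α i)) p x c).symm

end

/-! ### The exponents of the two sets of variables -/

section

variable {n : ℕ}

/-- The exponents of `u₁, …, uₙ`. -/
def uExp (k : Fin n ⊕ Fin n →₀ ℕ) : Fin n →₀ ℕ := k.comapDomain Sum.inl Sum.inl_injective.injOn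

/-- The exponents of `v₁, …, vₙ`. -/
def vExp (k : Fin n ⊕ Fin n →₀ ℕ) : Fin n →₀ ℕ := k.comapDomain Sum.inr Sum.inr_injective.injOn

lemma uExp_add (k l : Fin n ⊕ Fin n →₀ ℕ) : uExp (k + l) = uExp k + uExp l := by
  ext i; simp [uExp]

lemma vExp_add (k l : Fin n ⊕ Fin n →₀ ℕ) : vExp (k + l) = vExp k + vExp l := by
  ext i; simp [vExp]

lemma uExp_inl (k : Fin n →₀ ℕ) : uExp (k.mapDomain Sum.inl) = k := by
  ext i; simp [uExp, Finsupp.mapDomain_apply Sum.inl_injective]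

lemma uExp_inr (k : Fin n →₀ ℕ) : uExp (k.mapDomain Sum.inr) = 0 := by
  ext i; simp [uExp, Finsupp.mapDomain_of_notMem_range]

lemma vExp_inl (k : Fin n →₀ ℕ) : vExp (k.mapDomain Sum.inl) = 0 := by
  ext i; simp [vExp, Finsupp.mapDomain_of_notMem_range]

lemma vExp_inr (k : Fin n →₀ ℕ) : vExp (k.mapDomain Sum.inr) = k := by
  ext i; simp [vExp, Finsupp.mapDomain_apply Sum.inr_injective]

lemma uExp_add_vExp (k : Fin n ⊕ Fin n →₀ ℕ) :
    (uExp k).mapDomain Sum.inl + (vExp k).mapDomain Sum.inr = k := by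
  ext i
  rcases i with i | i
  · simp [Finsupp.mapDomain_apply Sum.inl_injective, Finsupp.mapDomain_of_notMem_range, uExp]
  · simp [Finsupp.mapDomain_apply Sum.inr_injective, Finsupp.mapDomain_of_notMem_range, vExp]

/-- Exponents under the morphism `uᵢ, vᵢ ↦ tᵢ`, used to identify the augmentation. -/
lemma mapDomain_elim (k : Fin n ⊕ Fin n →₀ ℕ) :
    k.mapDomain (Sum.elim id id) = uExp k + vExp k := by
  conv_lhs => rw [← uExp_add_vExp k]
  rw [Finsupp.mapDomain_add, ← Finsupp.mapDomain_comp, ← Finsupp.mapDomain_comp]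
  simp

end

/-! ### The module `M[u]`, its operators `uᵢ - tᵢ`, and the maps between `A[u, v] ⊗_{A[t]} M` and
`M[u]`. -/

section

variable {R : Type w} [CommRing R] {X : Type u} [Category.{v} X] [Preadditive X] [Linear R X]
  [MonoidalCategory X] {A : FMonoid R X} {n : ℕ} (M : FMod (A.poly (Fin n)))

/-- The `A[u]`-module `M[u]`, for an `A[t]`-module `M`. -/
abbrev FMod.free : FMod (A.poly (Fin n)) := (M.restrict (A.const (Fin n))).poly (Fin n)

lemma FMod.polyDiff_act {x y : X} (f : x ⟶ y) (i : Fin n)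
    (p : (M.toFun.poly (Fin n)).val x) :
    polyDiff (fun k => M.leftMul (A.mono k) y) i ((M.toFun.poly (Fin n)).act f p) =
      (M.toFun.poly (Fin n)).act f (polyDiff (fun k => M.leftMul (A.mono k) x) i p) :=
  polyDiff_natural i p (fun k m => M.leftMul_act (A.mono k) f m)

/-- The trilinear map `(f, c, m) ↦ M(f)(c · m)`, with values in `M[u]`, where `c ∈ A[v][u]`. -/
def balToFreeMk (x y z : X) :
    (x ⊗ y ⟶ z) →ₗ[R] ((Fin n ⊕ Fin n →₀ ℕ) →₀ A.toFun.val x) →ₗ[R] M.toFun.val y →ₗ[R]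
      ((Fin n →₀ ℕ) →₀ M.toFun.val z) where
  toFun f := Finsupp.lsum R fun k =>
    ((M.toFun.actMul (M.smul x y) f ∘ₗ
      (Finsupp.lsingle (vExp k) : A.toFun.val x →ₗ[R] ((Fin n →₀ ℕ) →₀ A.toFun.val x))).compr₂
        (Finsupp.lsingle (uExp k)))
  map_add' f g := by
    ext
    simp
  map_smul' r f := by
    ext
    simp

lemma balToFreeMk_single {x y z : X} (f : x ⊗ y ⟶ z) (k : Fin n ⊕ Fin n →₀ ℕ)
    (a : A.toFun.val x) (m : M.toFun.val y) :
    balToFreeMk M x y z f (.single k a) m = .single (uExp k) (M.toFun.act f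
      (M.smul x y (Finsupp.single (vExp k) a : (Fin n →₀ ℕ) →₀ A.toFun.val x) m)) := by
  simp [balToFreeMk]
  rfl

lemma FMonoid.leftMul_diff (A : FMonoid R X) (i : Fin n) (k : Fin n ⊕ Fin n →₀ ℕ) (x : X)
    (a : A.toFun.val x) :
    (A.poly₂ n).leftMul (A.diff n i) x
        (Finsupp.single k a : (Fin n ⊕ Fin n →₀ ℕ) →₀ A.toFun.val x) =
      (Finsupp.single ((Finsupp.single i 1).mapDomain Sum.inl + k) a -
        Finsupp.single ((Finsupp.single i 1).mapDomain Sum.inr + k) a :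
          (Fin n ⊕ Fin n →₀ ℕ) →₀ A.toFun.val x) := by
  have h : (A.poly₂ n).leftMul (A.diff n i) x =
      (A.poly₂ n).leftMul (A.mono (Finsupp.single (Sum.inl i) 1)) x -
        (A.poly₂ n).leftMul (A.mono (Finsupp.single (Sum.inr i) 1)) x := by
    refine LinearMap.ext fun b => ?_
    rw [LinearMap.sub_apply, leftMul_apply, leftMul_apply, leftMul_apply, ← map_sub,
      ← LinearMap.sub_apply, ← map_sub]
    rfl
  rw [h, LinearMap.sub_apply, A.leftMul_mono, A.leftMul_mono, Finsupp.mapDomain_single,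
    Finsupp.mapDomain_single]

variable [BraidedCategory X]

lemma FMonoid.self_rsmul {B C : FMonoid R X} [C.IsComm] (r : B.Hom C) {x y : X}
    (c : C.toFun.val x) (b : B.toFun.val y) :
    C.self.rsmul r x y c b = C.mul x y c (LinFun.comp r.hom y b) :=
  FMonoid.IsComm.comm _ _

/-- The variables of `A[t]` act on `M[u]` as `u`, and only constants of `A` reach the coefficients;
these commute with `tᵢ` by commutativity of `A[t]`. -/
lemma FMod.polyDiff_smul [A.IsComm] {x y : X} (i : Fin n) (b : (A.poly (Fin n)).toFun.val x)
    (p : (M.toFun.poly (Fin n)).val y) :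
    polyDiff (fun k => M.leftMul (A.mono k) (x ⊗ y)) i ((FMod.free M).smul x y b p) =
      (FMod.free M).smul x y b (polyDiff (fun k => M.leftMul (A.mono k) y) i p) := by
  induction p using poly_induction with
  | h_zero => simp only [map_zero]
  | h_add s t hs ht => simp only [map_add, hs, ht]
  | h_single k m =>
  induction b using poly_induction with
  | h_zero => simp only [map_zero, LinearMap.zero_apply]
  | h_add s t hs ht => simp only [map_add, LinearMap.add_apply, hs, ht]
  | h_single l b =>
    rw [polyMul_single, polyDiff_single, polyDiff_single, map_sub, polyMul_single,
      polyMul_single, LinearMap.comp_apply, M.smul_leftMul, add_left_comm]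

/-- The endomorphism `uᵢ - tᵢ` of `M[u]`. -/
def FMod.freeDiff [A.IsComm] (i : Fin n) : FMod.free M ⟶ FMod.free M :=
  ⟨LinFun.homMk (fun x => polyDiff (fun k => M.leftMul (A.mono k) x) i)
      (fun f p => M.polyDiff_act f i p),
    fun _ _ b p => M.polyDiff_smul i b p⟩

lemma FMod.freeDiff_apply [A.IsComm] (i : Fin n) (x : X) :
    LinFun.comp (FMod.freeDiff M i).1 x = polyDiff (fun k => M.leftMul (A.mono k) x) i := rfl

lemma FMod.freeDiff_comm [A.IsComm] (i j : Fin n) :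
    FMod.freeDiff M i ≫ FMod.freeDiff M j = FMod.freeDiff M j ≫ FMod.freeDiff M i := by
  apply FMod.hom_ext
  intro x p
  change LinFun.comp (FMod.freeDiff M j).1 x (LinFun.comp (FMod.freeDiff M i).1 x p) =
    LinFun.comp (FMod.freeDiff M i).1 x (LinFun.comp (FMod.freeDiff M j).1 x p)
  rw [FMod.freeDiff_apply, FMod.freeDiff_apply]
  exact polyDiff_comm (fun k l m => M.mono_add k l m) j i p

/-- The augmentation `M[u] → M`, `uᵢ ↦ tᵢ`. -/
def FMod.freeEval [A.IsComm] : FMod.free M ⟶ M :=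
  FMod.polyLift (𝟙 (M.restrict (A.const (Fin n))))

lemma FMod.freeEval_single [A.IsComm] (x : X) (k : Fin n →₀ ℕ) (m : M.toFun.val x) :
    LinFun.comp (FMod.freeEval M).1 x (Finsupp.single k m : (Fin n →₀ ℕ) →₀ M.toFun.val x) =
      M.leftMul (A.mono k) x m :=
  FMod.polyLift_single (𝟙 (M.restrict (A.const (Fin n)))) x k m

lemma FMod.freeEval_apply [A.IsComm] (x : X) (p : (Fin n →₀ ℕ) →₀ M.toFun.val x) :
    LinFun.comp (FMod.freeEval M).1 x p = polyEval (fun k => M.leftMul (A.mono k) x) p := by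
  induction p using poly_induction with
  | h_zero => simp only [map_zero]
  | h_add s t hs ht => simp only [map_add, hs, ht]
  | h_single k m => rw [polyEval_single, FMod.freeEval_single]

variable [EssentiallySmall.{w} X]

/-- Two additive maps on `A[u, v] ⊗_{A[t]} M` agree if they agree on the classes of monomials. -/
lemma bal_induction {z : X} {p : BalVal (A.vIncl n) (A.poly₂ n).self M z → Prop}
    (t : BalVal (A.vIncl n) (A.poly₂ n).self M z)
    (h_mk : ∀ x y f k a m, p (BalVal.mk (A.vIncl n) (A.poly₂ n).self M x y z f
      (Finsupp.single k a : (Fin n ⊕ Fin n →₀ ℕ) →₀ A.toFun.val x) m)) (h_zero : p 0)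
    (h_add : ∀ s t, p s → p t → p (s + t)) : p t := by
  induction t using BalVal.induction with
  | h_zero => exact h_zero
  | h_add s t hs ht => exact h_add s t hs ht
  | h_mk x y f c m =>
    induction c using poly_induction with
    | h_zero => rw [map_zero, LinearMap.zero_apply]; exact h_zero
    | h_add s t hs ht => rw [map_add, LinearMap.add_apply]; exact h_add _ _ hs ht
    | h_single k a => exact h_mk x y f k a m

/-- The map `M(z)[u] → (A[u, v] ⊗_{A[t]} M)(z)`, `uᵏ m ↦ [uᵏ, m]`. -/
def freeToBalVal (z : X) :
    ((Fin n →₀ ℕ) →₀ M.toFun.val z) →ₗ[R] BalVal (A.vIncl n) (A.poly₂ n).self M z :=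
  Finsupp.lsum R fun k => BalVal.mk (A.vIncl n) (A.poly₂ n).self M (𝟙_ X) z z (λ_ z).hom
    (Finsupp.single (k.mapDomain Sum.inl) A.one :
      (Fin n ⊕ Fin n →₀ ℕ) →₀ A.toFun.val (𝟙_ X))

lemma freeToBalVal_single (z : X) (k : Fin n →₀ ℕ) (m : M.toFun.val z) :
    freeToBalVal M z (.single k m) =
      BalVal.mk (A.vIncl n) (A.poly₂ n).self M (𝟙_ X) z z (λ_ z).hom
        (Finsupp.single (k.mapDomain Sum.inl) A.one :
          (Fin n ⊕ Fin n →₀ ℕ) →₀ A.toFun.val (𝟙_ X)) m := by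
  rw [freeToBalVal, Finsupp.lsum_single]

/-- The map `(A[u, v] ⊗_{A[t]} M)(z) → M(z)[u]`. -/
def balToFreeVal [A.IsComm] (z : X) :
    BalVal (A.vIncl n) (A.poly₂ n).self M z →ₗ[R] ((Fin n →₀ ℕ) →₀ M.toFun.val z) :=
  BalVal.lift (r := A.vIncl n) (fun x y => balToFreeMk M x y z)
    (fun x x' y y' p q f c m => by
      induction c using poly_induction with
      | h_zero => simp only [map_zero, LinearMap.zero_apply]
      | h_add s t hs ht => simp only [map_add, LinearMap.add_apply, hs, ht]
      | h_single k a =>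
        have h := M.smul_natural p q
          (Finsupp.single (vExp k) a : (Fin n →₀ ℕ) →₀ A.toFun.val x) m
        rw [LinFun.poly_act_single] at h
        rw [LinFun.poly_act_single, balToFreeMk_single, balToFreeMk_single, h, LinFun.act_comp])
    (fun x y y' f c b m => by
      rw [FMonoid.self_rsmul]
      induction c using poly_induction with
      | h_zero => simp only [map_zero, LinearMap.zero_apply]
      | h_add s t hs ht => simp only [map_add, LinearMap.add_apply, hs, ht]
      | h_single k a =>
      induction b using poly_induction with
      | h_zero => simp only [map_zero, LinearMap.zero_apply]
      | h_add s t hs ht => simp only [map_add, LinearMap.add_apply, hs, ht]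
      | h_single l b =>
        have hl : LinFun.comp (A.vIncl n).hom y
            (Finsupp.single l b : (Fin n →₀ ℕ) →₀ A.toFun.val y) =
            (Finsupp.single (l.mapDomain Sum.inr) b : (Fin n ⊕ Fin n →₀ ℕ) →₀ A.toFun.val y) :=
          Finsupp.mapDomain_single
        -- The balancing relation becomes associativity of the action on `M`: the right action of
        -- `tˡ b` only raises the `v`-exponent, and `v` acts on `M` as `t`.
        have hm := M.mul_smul (Finsupp.single (vExp k) a : (Fin n →₀ ℕ) →₀ A.toFun.val x)
          (Finsupp.single l b : (Fin n →₀ ℕ) →₀ A.toFun.val y) m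
        rw [polyMul_single] at hm
        rw [hl, polyMul_single, balToFreeMk_single, balToFreeMk_single, uExp_add, vExp_add,
          uExp_inr, vExp_inr, add_zero, ← hm, ← LinFun.act_comp, Iso.hom_inv_id_assoc])

lemma balToFreeVal_mk [A.IsComm] {x y z : X} (f : x ⊗ y ⟶ z) (k : Fin n ⊕ Fin n →₀ ℕ)
    (a : A.toFun.val x) (m : M.toFun.val y) :
    balToFreeVal M z (BalVal.mk (A.vIncl n) (A.poly₂ n).self M x y z f
      (Finsupp.single k a : (Fin n ⊕ Fin n →₀ ℕ) →₀ A.toFun.val x) m) =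
    .single (uExp k) (M.toFun.act f
      (M.smul x y (Finsupp.single (vExp k) a : (Fin n →₀ ℕ) →₀ A.toFun.val x) m)) := by
  rw [balToFreeVal, BalVal.lift_mk, balToFreeMk_single]

lemma balToFreeVal_freeToBalVal [A.IsComm] (z : X) (p : (Fin n →₀ ℕ) →₀ M.toFun.val z) :
    balToFreeVal M z (freeToBalVal M z p) = p := by
  induction p using poly_induction with
  | h_zero => simp only [map_zero]
  | h_add s t hs ht => simp only [map_add, hs, ht]
  | h_single k m =>
    rw [freeToBalVal_single, balToFreeVal_mk, uExp_inl, vExp_inl]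
    exact congrArg _ (M.one_smul m)

/-- Factor `uᵏ vˡ a` as `uᵏ ∈ C(𝟙)` times the image of `tˡ a`. The balancing relation moves the
second factor to `M`, and dinaturality absorbs `f` and the unitor. -/
lemma freeToBalVal_balToFreeVal [A.IsComm] (z : X) (t : BalVal (A.vIncl n) (A.poly₂ n).self M z) :
    freeToBalVal M z (balToFreeVal M z t) = t := by
  induction t using bal_induction with
  | h_zero => simp only [map_zero]
  | h_add s t hs ht => simp only [map_add, hs, ht]
  | h_mk x y f k a m =>
    let b : (A.poly (Fin n)).toFun.val x :=
      (Finsupp.single (vExp k) a : (Fin n →₀ ℕ) →₀ A.toFun.val x)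
    let c : (A.poly₂ n).toFun.val (𝟙_ X) :=
      (Finsupp.single ((uExp k).mapDomain Sum.inl) A.one :
        (Fin n ⊕ Fin n →₀ ℕ) →₀ A.toFun.val (𝟙_ X))
    -- `h1` moves `f` onto `M`, `h2` moves `b` across the tensor sign, and `h6` recombines `c` and
    -- `b` into the original monomial.
    have h1 := BalVal.mk_dinatural (r := A.vIncl n) (K := (A.poly₂ n).self) (M := M)
      (𝟙 (𝟙_ X)) f (λ_ z).hom c (M.smul x y b m)
    have h2 := BalVal.mk_balanced (r := A.vIncl n) (K := (A.poly₂ n).self) (M := M)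
      ((α_ (𝟙_ X) x y).hom ≫ (𝟙 (𝟙_ X) ⊗ₘ f) ≫ (λ_ z).hom) c b m
    have h3 : (A.poly₂ n).self.rsmul (A.vIncl n) (𝟙_ X) x c b =
        (A.poly₂ n).mul (𝟙_ X) x c (LinFun.comp (A.vIncl n).hom x b) :=
      FMonoid.self_rsmul _ _ _
    have h4 : LinFun.comp (A.vIncl n).hom x b = (Finsupp.single ((vExp k).mapDomain Sum.inr) a :
        (Fin n ⊕ Fin n →₀ ℕ) →₀ A.toFun.val x) := Finsupp.mapDomain_single
    have h5 : (α_ (𝟙_ X) x y).hom ≫ (𝟙 (𝟙_ X) ⊗ₘ f) ≫ (λ_ z).hom =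
        ((λ_ x).hom ⊗ₘ 𝟙 y) ≫ f := by simp
    have h6 : (A.poly₂ n).toFun.act (λ_ x).hom
        ((A.poly₂ n).mul (𝟙_ X) x c (LinFun.comp (A.vIncl n).hom x b)) =
        (Finsupp.single k a : (Fin n ⊕ Fin n →₀ ℕ) →₀ A.toFun.val x) := by
      rw [h4]
      refine (A.leftMul_mono ((uExp k).mapDomain Sum.inl) ((vExp k).mapDomain Sum.inr) x a).trans ?_
      rw [uExp_add_vExp]
    rw [balToFreeVal_mk, freeToBalVal_single]
    rw [LinFun.act_id] at h1
    rw [Iso.inv_hom_id_assoc] at h2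
    refine h1.symm.trans (h2.symm.trans ?_)
    rw [h3, h5, BalVal.mk_dinatural, h6, LinFun.act_id]

/-- Multiplication by `uᵢ` raises the `u`-exponent, while `vᵢ` is carried to `M` and acts there as
`tᵢ`. -/
lemma balToFreeVal_map_leftMulHom [A.IsComm] (i : Fin n) (z : X)
    (t : BalVal (A.vIncl n) (A.poly₂ n).self M z) :
    balToFreeVal M z (BalVal.map (A.vIncl n) ((A.poly₂ n).leftMulHom (A.diff n i)) M z t) =
      polyDiff (fun k => M.leftMul (A.mono k) z) i (balToFreeVal M z t) := by
  induction t using bal_induction with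
  | h_zero => simp only [map_zero]
  | h_add s t hs ht => simp only [map_add, hs, ht]
  | h_mk x y f k a m =>
    have h : LinFun.comp ((A.poly₂ n).leftMulHom (A.diff n i)).1 x
        (Finsupp.single k a : (Fin n ⊕ Fin n →₀ ℕ) →₀ A.toFun.val x) = _ :=
      A.leftMul_diff i k x a
    rw [BalVal.map_mk, h, map_sub, LinearMap.sub_apply, map_sub, balToFreeVal_mk, balToFreeVal_mk,
      balToFreeVal_mk]
    rw [polyDiff_single, uExp_add, uExp_add, vExp_add, vExp_add, uExp_inl, uExp_inr,
      vExp_inl, vExp_inr, zero_add, zero_add]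
    rw [M.leftMul_act, M.leftMul_smul, A.leftMul_mono]

end

/-! ### The tensor product `A[u, v] ⊗_{A[t]} M` as a module of polynomials -/

section

variable {R : Type w} [CommRing R] {X : Type u} [Category.{v} X] [Preadditive X] [Linear R X]
  [MonoidalCategory X] [SymmetricCategory X] [MonoidalPreadditive X] [MonoidalLinear R X]
  [EssentiallySmall.{w} X] {A : FMonoid R X} [A.IsComm] {n : ℕ} (M : FMod (A.poly (Fin n)))

/-- The morphism of `A[t]`-modules `A[u, v] ⊗_{A[t]} M → M[u]`. -/
def balToFree : (balFunctor (A.uIncl n) (A.vIncl n) M).obj (A.poly₂ n).self ⟶ FMod.free M :=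
  ⟨LinFun.homMk (balToFreeVal M) (fun {z z'} g t => by
      change balToFreeVal M z' (BalVal.act (A.vIncl n) (A.poly₂ n).self M z z' g t) =
        (M.toFun.poly (Fin n)).act g (balToFreeVal M z t)
      induction t using bal_induction with
      | h_zero => simp only [map_zero]
      | h_add s t hs ht => simp only [map_add, hs, ht]
      | h_mk x y f k a m =>
        rw [BalVal.act_mk, balToFreeVal_mk, balToFreeVal_mk, LinFun.poly_act_single,
          LinFun.act_comp]),
    fun x' z b t => by
      change balToFreeVal M _ (BalVal.smul (A.uIncl n) (A.vIncl n) (A.poly₂ n).self M x' z b t) =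
        (FMod.free M).smul x' z b (balToFreeVal M z t)
      induction t using bal_induction with
      | h_zero => simp only [map_zero]
      | h_add s t hs ht => simp only [map_add, hs, ht]
      | h_mk x y f k a m =>
      induction b using poly_induction with
      | h_zero => simp only [map_zero, LinearMap.zero_apply]
      | h_add s t hs ht => simp only [map_add, LinearMap.add_apply, hs, ht]
      | h_single l b =>
        have hl : LinFun.comp (A.uIncl n).hom x'
            (Finsupp.single l b : (Fin n →₀ ℕ) →₀ A.toFun.val x') =
            (Finsupp.single (l.mapDomain Sum.inl) b : (Fin n ⊕ Fin n →₀ ℕ) →₀ A.toFun.val x') :=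
          Finsupp.mapDomain_single
        -- The left action of `tˡ b` is through `uˡ b`: `uˡ` only changes the exponent, and `b` acts
        -- on the coefficient as a constant.
        have hm := M.mul_smul (Finsupp.single 0 b : (Fin n →₀ ℕ) →₀ A.toFun.val x')
          (Finsupp.single (vExp k) a : (Fin n →₀ ℕ) →₀ A.toFun.val x) m
        have hn := M.smul_natural (𝟙 x') f (Finsupp.single 0 b : (Fin n →₀ ℕ) →₀ A.toFun.val x')
          (M.smul x y (Finsupp.single (vExp k) a : (Fin n →₀ ℕ) →₀ A.toFun.val x) m)
        rw [polyMul_single] at hm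
        rw [LinFun.act_id] at hn
        rw [BalVal.smul_mk, hl, polyMul_single, balToFreeVal_mk, balToFreeVal_mk, polyMul_single,
          uExp_add, vExp_add, uExp_inl, vExp_inl, LinearMap.comp_apply, FMonoid.const_apply, hn,
          ← hm, LinFun.act_comp, id_tensorHom]⟩

instance : IsIso (balToFree M) :=
  FMod.isIso_of_bijective _ fun z =>
    ⟨Function.LeftInverse.injective (freeToBalVal_balToFreeVal M z),
      Function.RightInverse.surjective (balToFreeVal_freeToBalVal M z)⟩

/-- The isomorphism of `A[t]`-modules `A[u, v] ⊗_{A[t]} M ≅ M[u]`. -/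
def balIsoFree : (balFunctor (A.uIncl n) (A.vIncl n) M).obj (A.poly₂ n).self ≅ FMod.free M :=
  asIso (balToFree M)

lemma balToFree_freeDiff (i : Fin n) :
    (balFunctor (A.uIncl n) (A.vIncl n) M).map ((A.poly₂ n).leftMulHom (A.diff n i)) ≫
      balToFree M = balToFree M ≫ FMod.freeDiff M i := by
  apply FMod.hom_ext
  intro z t
  exact balToFreeVal_map_leftMulHom M i z t

/-- On `uᵏ vˡ`, evaluating after the identification gives `tᵏ · (tˡ · m)`, and folding first gives
`tᵏ⁺ˡ · m`. -/
lemma balToFree_freeEval :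
    balToFree M ≫ FMod.freeEval M =
      balAug (A.uIncl n) (A.vIncl n) (A.fold n) (A.fold_uIncl n) (A.fold_vIncl n) M := by
  apply FMod.hom_ext
  intro z t
  change LinFun.comp (FMod.freeEval M).1 z (balToFreeVal M z t) =
    BalVal.aug (A.vIncl n) (A.fold n) (A.fold_vIncl n) M z t
  induction t using bal_induction with
  | h_zero => simp only [map_zero]
  | h_add s t hs ht => simp only [map_add, hs, ht]
  | h_mk x y f k a m =>
    have h : LinFun.comp (A.fold n).hom x
        (Finsupp.single k a : (Fin n ⊕ Fin n →₀ ℕ) →₀ A.toFun.val x) =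
        (Finsupp.single (uExp k + vExp k) a : (Fin n →₀ ℕ) →₀ A.toFun.val x) :=
      Finsupp.mapDomain_single.trans (by rw [mapDomain_elim])
    rw [balToFreeVal_mk, BalVal.aug_mk, h, FMod.freeEval_apply, polyEval_single, M.leftMul_act,
      M.leftMul_smul, A.leftMul_mono]

end

/-! ### Contractible complexes of modules -/

section

variable {R : Type w} [CommRing R] {X : Type u} [Category.{v} X] [Preadditive X] [Linear R X]
  [MonoidalCategory X] {A : FMonoid R X}

/-- A complex of modules that is contractible in `𝓕` is exact. -/
lemma FMod.acyclic_of_contraction (K : ChainComplex (FMod A) ℕ)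
    (s : ∀ i, (K.X i).toFun ⟶ (K.X (i + 1)).toFun) (h₀ : s 0 ≫ (K.d 1 0).1 = 𝟙 _)
    (h : ∀ i, (K.d (i + 1) i).1 ≫ s i + s (i + 1) ≫ (K.d (i + 2) (i + 1)).1 = 𝟙 _) :
    K.Acyclic := by
  intro i
  cases i with
  | zero =>
    -- No degree follows 0, and the outgoing map `d 0 0` is zero. Exactness here is surjectivity of
    -- `d 1 0`, which has the section `s 0`.
    rw [K.exactAt_iff' 1 0 0 (by simp) (by simp)]
    refine FMod.exact_of_pointwise _ fun x m _ => ⟨LinFun.comp (s 0) x m, ?_⟩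
    exact congrArg (fun χ => LinFun.comp χ x m) h₀
  | succ i =>
    rw [K.exactAt_iff' (i + 2) (i + 1) i (by simp) (by simp)]
    refine FMod.exact_of_pointwise _ fun x m hm => ⟨LinFun.comp (s (i + 1)) x m, ?_⟩
    have hsum : LinFun.comp (s i) x (LinFun.comp (K.d (i + 1) i).1 x m) +
        LinFun.comp (K.d (i + 2) (i + 1)).1 x (LinFun.comp (s (i + 1)) x m) = m :=
      congrArg (fun χ => LinFun.comp χ x m) (h i)
    have hm' : LinFun.comp (K.d (i + 1) i).1 x m = 0 := hm
    rw [hm', map_zero, zero_add] at hsum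
    exact hsum

/-- A complex of modules that is contractible in `𝓕` is split in `𝓕`. -/
lemma FMod.isSplitComplex_of_contraction (K : ChainComplex (FMod A) ℕ)
    (s : ∀ i, (K.X i).toFun ⟶ (K.X (i + 1)).toFun) (h₀ : s 0 ≫ (K.d 1 0).1 = 𝟙 _)
    (h : ∀ i, (K.d (i + 1) i).1 ≫ s i + s (i + 1) ≫ (K.d (i + 2) (i + 1)).1 = 𝟙 _) :
    IsSplitComplex (((FMod.forget A).mapHomologicalComplex _).obj K) := by
  refine ⟨s, fun i => ?_⟩
  change (K.d (i + 1) i).1 ≫ s i ≫ (K.d (i + 1) i).1 = (K.d (i + 1) i).1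
  cases i with
  | zero => rw [h₀, Category.comp_id]
  | succ i =>
    have h0 : (K.d (i + 2) (i + 1)).1 ≫ (K.d (i + 1) i).1 = 0 :=
      congrArg Subtype.val (K.d_comp_d (i + 2) (i + 1) i)
    -- Replace the later `s d` by `1 - d s`; the correction to `d s d = d` then contains `d d = 0`.
    rw [← sub_eq_iff_eq_add'.2 (h i).symm, Preadditive.comp_sub, Category.comp_id,
      ← Category.assoc, h0, Limits.zero_comp, sub_zero]

end

/-! ### The resolution -/

section

variable {R : Type w} [CommRing R] {X : Type u} [Category.{v} X] [Preadditive X] [Linear R X]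
  [MonoidalCategory X] [BraidedCategory X] {A : FMonoid R X} [A.IsComm] {n : ℕ}
  (M : FMod (A.poly (Fin n)))

/-- The Koszul complex of the endomorphisms `uᵢ - tᵢ` of `M[u]`. -/
def FMod.freeKoszul : ChainComplex (FMod (A.poly (Fin n))) ℕ :=
  FMod.koszul (FMod.freeDiff M) (FMod.freeDiff_comm M)

/-- The augmentation of `freeKoszul`. -/
def FMod.freeKoszulAug : FMod.pi (KIdx n 0) (FMod.free M) ⟶ M :=
  FMod.piProj (KIdx n 0) (FMod.free M) ⟨∅, rfl⟩ ≫ FMod.freeEval M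

lemma FMod.freeKoszul_d (p : ℕ) :
    (FMod.freeKoszul M).d (p + 1) p = FMod.koszulHom (FMod.freeDiff M) p :=
  FMod.koszul_d _ _ p

lemma FMod.freeKoszulAug_apply (x : X) (c : KIdx n 0 → (Fin n →₀ ℕ) →₀ M.toFun.val x) :
    LinFun.comp (FMod.freeKoszulAug M).1 x c =
      polyEval (fun k => M.leftMul (A.mono k) x) (c ⟨∅, rfl⟩) :=
  FMod.freeEval_apply M x (c ⟨∅, rfl⟩)

lemma FMod.koszulHom_freeKoszulAug :
    FMod.koszulHom (FMod.freeDiff M) 0 ≫ FMod.freeKoszulAug M = 0 := by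
  apply FMod.hom_ext
  intro x c
  change LinFun.comp (FMod.freeKoszulAug M).1 x
    (LinFun.comp (FMod.koszulHom (FMod.freeDiff M) 0).1 x c) = 0
  rw [FMod.koszulHom_apply, FMod.freeKoszulAug_apply, koszulMap_apply, map_sum]
  refine Finset.sum_eq_zero fun i _ => ?_
  rw [map_zsmul, FMod.freeDiff_apply, polyEval_polyDiff (fun k l m => M.mono_add k l m), smul_zero]

lemma FMod.freeKoszul_d_aug :
    (FMod.freeKoszul M).d 1 0 ≫ (FMod.freeKoszulAug M : (FMod.freeKoszul M).X 0 ⟶ M) = 0 := by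
  rw [FMod.freeKoszul_d]
  exact FMod.koszulHom_freeKoszulAug M

/-- The contracting homotopy of the augmented complex, in positive degrees. -/
def FMod.freeKoszulHtpy (p : ℕ) :
    (FMod.pi (KIdx n p) (FMod.free M)).toFun ⟶ (FMod.pi (KIdx n (p + 1)) (FMod.free M)).toFun :=
  LinFun.homMk (fun x => koszulHtpy (polyDiv fun k => M.leftMul (A.mono k) x)
    (polyEvalAt fun k => M.leftMul (A.mono k) x) p) (fun {x y} f c => by
      funext S
      exact koszulHtpy_poly_natural (fun k m => M.leftMul_act (A.mono k) f m) p c S)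

/-- The contracting homotopy of the augmented complex, in degree zero. -/
def FMod.freeKoszulUnit : M.toFun ⟶ (FMod.pi (KIdx n 0) (FMod.free M)).toFun :=
  LinFun.homMk (fun x => (LinearMap.pi fun _ => Finsupp.lsingle 0 :
      M.toFun.val x →ₗ[R] (KIdx n 0 → (Fin n →₀ ℕ) →₀ M.toFun.val x))) (fun {x y} f m => by
    funext S
    exact (M.toFun.poly_act_single (Fin n) f 0 m).symm)

lemma FMod.freeKoszulUnit_aug : FMod.freeKoszulUnit M ≫ (FMod.freeKoszulAug M).1 = 𝟙 _ := by
  apply LinFun.hom_ext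
  intro x m
  change LinFun.comp (FMod.freeKoszulAug M).1 x (LinFun.comp (FMod.freeKoszulUnit M) x m) = m
  rw [FMod.freeKoszulAug_apply]
  refine (polyEval_single _ 0 m).trans (M.mono_zero m)

/-- The defect `E₀ ⋯ E_{n-1}` of the Koszul homotopy in degree 0 is evaluation followed by the
inclusion of constants, that is, the composite through `M`. -/
lemma FMod.freeKoszul_contraction_zero :
    (FMod.freeKoszulAug M).1 ≫ FMod.freeKoszulUnit M +
      FMod.freeKoszulHtpy M 0 ≫ (FMod.koszulHom (FMod.freeDiff M) 0).1 = 𝟙 _ := by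
  apply LinFun.hom_ext
  intro x c
  change LinFun.comp (FMod.freeKoszulUnit M) x (LinFun.comp (FMod.freeKoszulAug M).1 x c) +
    LinFun.comp (FMod.koszulHom (FMod.freeDiff M) 0).1 x
      (LinFun.comp (FMod.freeKoszulHtpy M 0) x c) = c
  rw [FMod.koszulHom_apply, FMod.freeKoszulAug_apply]
  simp only [FMod.freeDiff_apply]
  have hzero (m : M.toFun.val x) : M.leftMul (A.mono 0) x m = m := M.mono_zero m
  have hadd (k l : Fin n →₀ ℕ) (m : M.toFun.val x) : M.leftMul (A.mono (k + l)) x m =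
    M.leftMul (A.mono k) x (M.leftMul (A.mono l) x m) := M.mono_add k l m
  funext T
  have hT : (⟨∅, rfl⟩ : KIdx n 0) = T := Subtype.ext (Finset.card_eq_zero.1 T.2).symm
  have h := (polyKoszulContraction (τ := fun k => M.leftMul (A.mono k) x) hzero
    hadd).koszulMap_koszulHtpy_zero c T
  rw [prodBelow_polyEvalAt hzero hadd] at h
  rw [hT]
  refine (congrArg (Finsupp.single 0 (polyEval (fun k => M.leftMul (A.mono k) x) (c T)) + ·)
    h).trans ?_
  exact add_sub_cancel _ _

lemma FMod.freeKoszul_contraction_succ (p : ℕ) :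
    (FMod.koszulHom (FMod.freeDiff M) p).1 ≫ FMod.freeKoszulHtpy M p +
      FMod.freeKoszulHtpy M (p + 1) ≫ (FMod.koszulHom (FMod.freeDiff M) (p + 1)).1 = 𝟙 _ := by
  apply LinFun.hom_ext
  intro x c
  change LinFun.comp (FMod.freeKoszulHtpy M p) x
      (LinFun.comp (FMod.koszulHom (FMod.freeDiff M) p).1 x c) +
    LinFun.comp (FMod.koszulHom (FMod.freeDiff M) (p + 1)).1 x
      (LinFun.comp (FMod.freeKoszulHtpy M (p + 1)) x c) = c
  rw [FMod.koszulHom_apply, FMod.koszulHom_apply]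
  simp only [FMod.freeDiff_apply]
  refine (add_comm _ _).trans ?_
  exact (polyKoszulContraction (τ := fun k => M.leftMul (A.mono k) x) (fun m => M.mono_zero m)
    (fun k l m => M.mono_add k l m)).koszulMap_koszulHtpy_succ p c

lemma FMod.isSplitResolution_freeKoszul :
    IsSplitResolution (FMod.forget (A.poly (Fin n))) (FMod.freeKoszul M) (FMod.freeKoszulAug M)
      (FMod.freeKoszul_d_aug M) := by
  let K := (FMod.freeKoszul M).augment (FMod.freeKoszulAug M) (FMod.freeKoszul_d_aug M)
  -- Augmentation puts `M` in degree 0 and shifts the Koszul complex up by one.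
  let s : ∀ i, (K.X i).toFun ⟶ (K.X (i + 1)).toFun
    | 0 => FMod.freeKoszulUnit M
    | i + 1 => FMod.freeKoszulHtpy M i
  have h₀ : s 0 ≫ (K.d 1 0).1 = 𝟙 _ := FMod.freeKoszulUnit_aug M
  have h : ∀ i, (K.d (i + 1) i).1 ≫ s i + s (i + 1) ≫ (K.d (i + 2) (i + 1)).1 = 𝟙 _ := by
    intro i
    cases i with
    | zero =>
      have h1 : K.d 2 1 = FMod.koszulHom (FMod.freeDiff M) 0 := FMod.freeKoszul_d M 0
      rw [h1]
      exact FMod.freeKoszul_contraction_zero M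
    | succ i =>
      have h1 : K.d (i + 3) (i + 2) = FMod.koszulHom (FMod.freeDiff M) (i + 1) :=
        FMod.freeKoszul_d M (i + 1)
      have h2 : K.d (i + 2) (i + 1) = FMod.koszulHom (FMod.freeDiff M) i :=
        FMod.freeKoszul_d M i
      rw [h1, h2]
      exact FMod.freeKoszul_contraction_succ M i
  exact ⟨FMod.acyclic_of_contraction K s h₀ h, FMod.isSplitComplex_of_contraction K s h₀ h⟩

end

/-! ### Comparison of `K_C(α) ⊗_{A[t]} M` with the Koszul complex of `M[u]`. -/

section

variable {R : Type w} [CommRing R] {X : Type u} [Category.{v} X] [Preadditive X] [Linear R X]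
  [MonoidalCategory X] [SymmetricCategory X] [MonoidalPreadditive X] [MonoidalLinear R X]
  [EssentiallySmall.{w} X] (A : FMonoid R X) [A.IsComm] (n : ℕ) (M : FMod (A.poly (Fin n)))

lemma koszulTensor_d (p : ℕ) :
    (koszulTensor A n M).d (p + 1) p = (balFunctor (A.uIncl n) (A.vIncl n) M).map
      (FMod.koszulHom (fun i => (A.poly₂ n).leftMulHom (A.diff n i)) p) := by
  rw [← koszulD_eq_koszulHom]
  exact congrArg (balFunctor (A.uIncl n) (A.vIncl n) M).map
    (ChainComplex.of_d (koszulObj (A.poly₂ n) n) (koszulD (A.poly₂ n) (A.diff n)) p)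

/-- The isomorphism in degree `p`. -/
def koszulTensorXIso (p : ℕ) : (koszulTensor A n M).X p ≅ (FMod.freeKoszul M).X p :=
  FMod.mapPiIso (balFunctor (A.uIncl n) (A.vIncl n) M) (balIsoFree M) (KIdx n p)

/-- The identification `A[u, v] ⊗_{A[t]} M ≅ M[u]` carries `αᵢ` to `uᵢ - tᵢ`, and both differentials
are given by the same formula in these endomorphisms. -/
lemma koszulTensorXIso_comm (p : ℕ) :
    (koszulTensorXIso A n M (p + 1)).hom ≫ (FMod.freeKoszul M).d (p + 1) p =
      (koszulTensor A n M).d (p + 1) p ≫ (koszulTensorXIso A n M p).hom := by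
  rw [koszulTensor_d, FMod.freeKoszul_d]
  exact FMod.mapPiIso_koszulHom _ (balIsoFree M) _ _ (fun i => balToFree_freeDiff M i) p

/-- The isomorphism between `K_C(α) ⊗_{A[t]} M` and the Koszul complex of `M[u]`. -/
def koszulTensorIso : koszulTensor A n M ≅ FMod.freeKoszul M :=
  HomologicalComplex.Hom.isoOfComponents (koszulTensorXIso A n M) (fun i j hij => by
    obtain rfl : j + 1 = i := hij
    exact koszulTensorXIso_comm A n M j)

lemma koszulTensorIso_hom_aug :
    (koszulTensorIso A n M).hom.f 0 ≫ FMod.freeKoszulAug M = koszulTensorAug A n M := by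
  have h := FMod.mapPiIso_hom_proj (balFunctor (A.uIncl n) (A.vIncl n) M) (balIsoFree M)
    (KIdx n 0) ⟨∅, rfl⟩
  rw [koszulTensorAug, ← balToFree_freeEval]
  change (FMod.mapPiIso _ (balIsoFree M) (KIdx n 0)).hom ≫ FMod.piProj _ _ _ ≫ _ = _
  rw [← Category.assoc, h, Category.assoc]
  rfl

end

end
/-- **Relative Hilbert syzygy theorem.** -/
theorem proposition4p8 {R : Type w} [CommRing R] {X : Type u} [Category.{v} X] [Preadditive X]
    [Linear R X] [MonoidalCategory X] [MonoidalPreadditive X] [MonoidalLinear R X]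
    [SymmetricCategory X] [EssentiallySmall.{w} X]
    (A : FMonoid R X) [A.IsComm] (hA : A.IsTensorIdempotent) (n : ℕ)
    (M : FMod (A.poly (Fin n))) :
    ∃ (L : ChainComplex (FMod (A.poly (Fin n))) ℕ) (ε : L.X 0 ⟶ M) (hε : L.d 1 0 ≫ ε = 0),
      (∀ p, n < p → Limits.IsZero (L.X p)) ∧
      (∀ p, RelProjective (FMod.forget (A.poly (Fin n))) (L.X p)) ∧
      IsSplitResolution (FMod.forget (A.poly (Fin n))) L ε hε ∧
      ∃ e : L ≅ koszulTensor A n M, e.hom.f 0 ≫ koszulTensorAug A n M = ε := by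
  refine ⟨FMod.freeKoszul M, FMod.freeKoszulAug M, FMod.freeKoszul_d_aug M, fun p hp => ?_,
    fun p => ?_, FMod.isSplitResolution_freeKoszul M, (koszulTensorIso A n M).symm, ?_⟩
  -- Beyond degree `n` there are no index sets.
  · have : IsEmpty (KIdx n p) := ⟨fun S => by
      have := S.1.card_le_univ
      rw [S.2, Fintype.card_fin] at this
      omega⟩
    exact FMod.isZero_pi (ι := KIdx n p) (FMod.free M)
  -- Each term is a finite power of `N[u]`, where `N` is `M` regarded as an `A`-module.
  · exact FMod.relProjective_pi (KIdx n p) (FMod.free M)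
      (FMod.relProjective_poly hA (M.restrict (A.const (Fin n))) (Fin n))
  · exact ((HomologicalComplex.eval _ _ 0).mapIso (koszulTensorIso A n M)).inv_comp_eq.2
      (koszulTensorIso_hom_aug A n M).symm
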